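/- Let $H$ be a finite undirected graph, in which loops are allowed (parallel edges are harmless and allowed too). For $n\in\mathbb N$ let $K_n$ be the complete graph on $[n]$ and define the polynomial over $\mathbb Q$ $$f_n^H\big((x_e)_{e\in E(K_n)}\big)=\sum_{\epsilon\in\{0,1\}^{E(K_n)}}\Phi_n^H(\epsilon)\prod_{e\in E(K_n)}x_e^{\epsilon_e},$$ where $\Phi_n^H(\epsilon)=1$ if the graph with vertex set $[n]$ and edge set $\{e:\epsilon_e=1\}$ has a homomorphism to $H$ (a map of vertices that sends adjacent vertices to adjacent vertices), and $\Phi_n^H(\epsilon)=0$ otherwise. Definitions. A p-family is a sequence $(f_n)_{n\in\mathbb N}$ of polynomials over $\mathbb Q$ whose number of variables and degree are bounded by a polynomial in $n$. Arithmetic circuits are directed acyclic graphs whose input gates are labelled by variables or by constants of $\mathbb Q$ and whose computation gates are labelled $+$ or $\times$. - $\mathrm{VAC}_0$ is the class of p-families computed by circuits with unbounded fan-in, of depth bounded by a constant and of size bounded by a polynomial in $n$. - $\mathrm{VP}$ is the class of p-families computed by circuits of fan-in two with polynomially many computation gates. - $\mathrm{VNP}$ is the class of p-families $(f_n)$ for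 which there are $m(n)\in\mathbb N$ and $(g_n)\in\mathrm{VP}$ with $f_n(x)=\sum_{\epsilon\in\{0,1\}^{m(n)}}g_n(x,\epsilon)$ for all $n$. - $(f_n)$ c-reduces to $(g_n)$ if there are polynomially bounded functions $p,s:\mathbb N\to\mathbb N$ such that, for every $n$, $f_n$ can be computed from its variables and constants of $\mathbb Q$ by at most $s(n)$ operations, each being an addition or a multiplication of two previously obtained values or an evaluation of $g_{p(n)}$ at previously obtained values. - A family $(g_n)$ is $\mathrm{VNP}$-complete for c-reductions if $(g_n)\in\mathrm{VNP}$ and every $(f_n)\in\mathrm{VNP}$ c-reduces to $(g_n)$. Theorem. If $H$ has a loop or has no edges, then $(f_n^H)$ is in $\mathrm{VAC}_0$. Otherwise, $(f_n^H)$ is $\mathrm{VNP}$-complete for c-reductions. -/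

import Mathlib

open scoped Graph

/-! ### Arithmetic circuits -/

/-- A gate, at position `i` in the topological order, of an arithmetic circuit with fan-in two:
either an input gate (a variable or a constant) or a computation gate whose two children occur
strictly earlier. -/
inductive ArithGate (K σ : Type) (i : ℕ) : Type
  | var (x : σ) : ArithGate K σ i
  | const (c : K) : ArithGate K σ i
  | add (a b : Fin i) : ArithGate K σ i
  | mul (a b : Fin i) : ArithGate K σ i

/-- An arithmetic circuit over `K` in the variables `σ`: a directed acyclic graph of gates, listed
in a topological order, with a designated output gate. -/
structure ArithCircuit (K σ : Type) where
  numGates : ℕ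
  gate : (i : Fin numGates) → ArithGate K σ i
  output : Fin numGates

/-- Whether a gate is a computation gate (as opposed to an input gate). -/
def ArithGate.isComputation {K σ : Type} {i : ℕ} : ArithGate K σ i → Bool
  | .var _ => false
  | .const _ => false
  | .add _ _ => true
  | .mul _ _ => true

namespace ArithCircuit

variable {K σ : Type}

/-- The number of computation gates. -/
def size (C : ArithCircuit K σ) : ℕ :=
  (Finset.univ.filter fun i : Fin C.numGates => (C.gate i).isComputation = true).card

/-- The polynomial computed by a gate. -/
noncomputable def value [CommSemiring K] (C : ArithCircuit K σ) (i : Fin C.numGates) :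
    MvPolynomial σ K :=
  match C.gate i with
  | .var x => MvPolynomial.X x
  | .const c => MvPolynomial.C c
  | .add a b => C.value ⟨a, a.2.trans i.2⟩ + C.value ⟨b, b.2.trans i.2⟩
  | .mul a b => C.value ⟨a, a.2.trans i.2⟩ * C.value ⟨b, b.2.trans i.2⟩
termination_by i.val

/-- The circuit computes `f`: its output gate does. -/
def Computes [CommSemiring K] (C : ArithCircuit K σ) (f : MvPolynomial σ K) : Prop :=
  C.value C.output = f

end ArithCircuit

/-! ### Arithmetic circuits with an oracle -/

/-- As `ArithGate`, with an additional kind of gate, evaluating an oracle polynomial in the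
variables `τ` at a tuple of previously computed values. -/
inductive OracleGate (K σ τ : Type) (i : ℕ) : Type
  | var (x : σ) : OracleGate K σ τ i
  | const (c : K) : OracleGate K σ τ i
  | add (a b : Fin i) : OracleGate K σ τ i
  | mul (a b : Fin i) : OracleGate K σ τ i
  | oracle (a : τ → Fin i) : OracleGate K σ τ i

/-- An arithmetic circuit in the variables `σ` with oracle gates for a polynomial in the
variables `τ`. -/
structure OracleCircuit (K σ τ : Type) where
  numGates : ℕ
  gate : (i : Fin numGates) → OracleGate K σ τ i
  output : Fin numGates

/-- Whether a gate is a computation gate or an oracle gate (as opposed to an input gate). -/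
def OracleGate.isComputation {K σ τ : Type} {i : ℕ} : OracleGate K σ τ i → Bool
  | .var _ => false
  | .const _ => false
  | .add _ _ => true
  | .mul _ _ => true
  | .oracle _ => true

namespace OracleCircuit

variable {K σ τ : Type}

/-- The number of computation gates and oracle evaluations. -/
def size (C : OracleCircuit K σ τ) : ℕ :=
  (Finset.univ.filter fun i : Fin C.numGates => (C.gate i).isComputation = true).card

/-- The polynomial computed by a gate when the oracle is the polynomial `g`. -/
noncomputable def value [CommSemiring K] (g : MvPolynomial τ K) (C : OracleCircuit K σ τ)
    (i : Fin C.numGates) : MvPolynomial σ K :=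
  match C.gate i with
  | .var x => MvPolynomial.X x
  | .const c => MvPolynomial.C c
  | .add a b => C.value g ⟨a, a.2.trans i.2⟩ + C.value g ⟨b, b.2.trans i.2⟩
  | .mul a b => C.value g ⟨a, a.2.trans i.2⟩ * C.value g ⟨b, b.2.trans i.2⟩
  | .oracle a => MvPolynomial.aeval (fun t : τ => C.value g ⟨a t, (a t).2.trans i.2⟩) g
termination_by i.val

/-- The circuit computes `f` with oracle `g`. -/
def Computes [CommSemiring K] (C : OracleCircuit K σ τ) (g : MvPolynomial τ K)
    (f : MvPolynomial σ K) : Prop :=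
  C.value g C.output = f

end OracleCircuit

/-! ### Arithmetic circuits with unbounded fan-in -/

/-- A gate, at position `i` in the topological order, of an arithmetic circuit with unbounded
fan-in; a child occurring several times in a list stands for several wires. -/
inductive UnboundedGate (K σ : Type) (i : ℕ) : Type
  | var (x : σ) : UnboundedGate K σ i
  | const (c : K) : UnboundedGate K σ i
  | add (l : List (Fin i)) : UnboundedGate K σ i
  | mul (l : List (Fin i)) : UnboundedGate K σ i

/-- The children of a gate. -/
def UnboundedGate.children {K σ : Type} {i : ℕ} : UnboundedGate K σ i → List (Fin i)
  | .var _ => []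
  | .const _ => []
  | .add l => l
  | .mul l => l

/-- An arithmetic circuit with unbounded fan-in. -/
structure UnboundedCircuit (K σ : Type) where
  numGates : ℕ
  gate : (i : Fin numGates) → UnboundedGate K σ i
  output : Fin numGates

namespace UnboundedCircuit

variable {K σ : Type}

/-- The size: the number of gates plus the number of wires. -/
def size (C : UnboundedCircuit K σ) : ℕ :=
  C.numGates + ∑ i : Fin C.numGates, (C.gate i).children.length

/-- The polynomial computed by a gate. -/
noncomputable def value [CommSemiring K] (C : UnboundedCircuit K σ) (i : Fin C.numGates) :
    MvPolynomial σ K :=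
  match C.gate i with
  | .var x => MvPolynomial.X x
  | .const c => MvPolynomial.C c
  | .add l => (l.map fun a : Fin i => C.value ⟨a, a.2.trans i.2⟩).sum
  | .mul l => (l.map fun a : Fin i => C.value ⟨a, a.2.trans i.2⟩).prod
termination_by i.val

/-- The depth of a gate: the number of computation gates on a longest path ending in it. -/
def gateDepth (C : UnboundedCircuit K σ) (i : Fin C.numGates) : ℕ :=
  match C.gate i with
  | .var _ => 0
  | .const _ => 0
  | .add l => (l.map fun a : Fin i => C.gateDepth ⟨a, a.2.trans i.2⟩).foldr max 0 + 1
  | .mul l => (l.map fun a : Fin i => C.gateDepth ⟨a, a.2.trans i.2⟩).foldr max 0 + 1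
termination_by i.val

/-- The depth of the circuit: the largest depth of a gate. -/
def depth (C : UnboundedCircuit K σ) : ℕ :=
  Finset.univ.sup C.gateDepth

/-- The circuit computes `f`: its output gate does. -/
def Computes [CommSemiring K] (C : UnboundedCircuit K σ) (f : MvPolynomial σ K) : Prop :=
  C.value C.output = f

end UnboundedCircuit

/-! ### Valiant's classes

A family is a sequence of polynomials `f n`, in variables indexed by a type `σ n`. -/

/-- The function `s` is polynomially bounded. -/
def PolyBounded (s : ℕ → ℕ) : Prop :=
  ∃ q : Polynomial ℕ, ∀ n, s n ≤ q.eval n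

section Classes

variable {K : Type} [CommSemiring K] {σ τ : ℕ → Type}

/-- A p-family: the number of variables and the degree are polynomially bounded. -/
def IsPFamily (f : ∀ n, MvPolynomial (σ n) K) : Prop :=
  (∀ n, Finite (σ n)) ∧ PolyBounded (fun n => Nat.card (σ n)) ∧
    PolyBounded (fun n => (f n).totalDegree)

/-- The class `VP`: p-families computed by arithmetic circuits of fan-in two with polynomially many
computation gates. -/
def InVP (f : ∀ n, MvPolynomial (σ n) K) : Prop :=
  IsPFamily f ∧ ∃ s : ℕ → ℕ, PolyBounded s ∧
    ∀ n, ∃ C : ArithCircuit K (σ n), C.size ≤ s n ∧ C.Computes (f n)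

/-- The class `VNP`: p-families of the form `f n = ∑ ε ∈ {0,1}^(m n), g n (x, ε)` with `g` in `VP`
(so that `m` is polynomially bounded). -/
def InVNP (f : ∀ n, MvPolynomial (σ n) K) : Prop :=
  IsPFamily f ∧ ∃ (m : ℕ → ℕ) (g : ∀ n, MvPolynomial (σ n ⊕ Fin (m n)) K), InVP g ∧
    ∀ n, f n = ∑ ε : Fin (m n) → Fin 2,
      MvPolynomial.aeval
        (Sum.elim MvPolynomial.X fun j => MvPolynomial.C ((ε j : ℕ) : K)) (g n)

/-- The class `VAC₀`: p-families computed by unbounded fan-in arithmetic circuits of constant depth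
and polynomial size. -/
def InVAC0 (f : ∀ n, MvPolynomial (σ n) K) : Prop :=
  IsPFamily f ∧ ∃ (d : ℕ) (s : ℕ → ℕ), PolyBounded s ∧
    ∀ n, ∃ C : UnboundedCircuit K (σ n), C.depth ≤ d ∧ C.size ≤ s n ∧ C.Computes (f n)

/-- `f` c-reduces to `g`: for some polynomially bounded `p`, the polynomial `f n` is computed by a
polynomial number of arithmetic operations and evaluations of the oracle `g (p n)`. -/
def CReduces (f : ∀ n, MvPolynomial (σ n) K) (g : ∀ n, MvPolynomial (τ n) K) : Prop :=
  ∃ p s : ℕ → ℕ, PolyBounded p ∧ PolyBounded s ∧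
    ∀ n, ∃ C : OracleCircuit K (σ n) (τ (p n)), C.size ≤ s n ∧ C.Computes (g (p n)) (f n)

/-- `g` is `VNP`-complete for c-reductions. -/
def IsVNPComplete (g : ∀ n, MvPolynomial (τ n) K) : Prop :=
  InVNP g ∧ ∀ (σ : ℕ → Type) (f : ∀ n, MvPolynomial (σ n) K), InVNP f → CReduces f g

end Classes

/-! ### Homomorphism polynomials -/

/-- The edges of the complete graph `K_n` on the vertex set `Fin n`. -/
abbrev CompleteEdge (n : ℕ) : Type := (⊤ : SimpleGraph (Fin n)).edgeSet

/-- The graph on `Fin n` whose edges are the `e` with `ε e = 1`. -/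
def graphOfIndicator {n : ℕ} (ε : CompleteEdge n → Fin 2) : SimpleGraph (Fin n) :=
  SimpleGraph.fromEdgeSet {e | ∃ h : e ∈ (⊤ : SimpleGraph (Fin n)).edgeSet, ε ⟨e, h⟩ = 1}

/-- There is a homomorphism from the simple graph `G` to `H`, where `H` may have loops: a map of
vertices sending adjacent vertices to adjacent vertices. -/
def IsHomomorphicTo {V α β : Type*} (G : SimpleGraph V) (H : Graph α β) : Prop :=
  ∃ φ : V → α, (∀ v, φ v ∈ V(H)) ∧ ∀ u v, G.Adj u v → H.Adj (φ u) (φ v)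

open Classical in
/-- The polynomial `f_n^H` enumerating the graphs on `n` vertices that are homomorphic to `H`. -/
noncomputable def homPolynomial (K : Type) [CommSemiring K] {α β : Type*} (H : Graph α β) (n : ℕ) :
    MvPolynomial (CompleteEdge n) K :=
  ∑ ε : CompleteEdge n → Fin 2,
    (if IsHomomorphicTo (graphOfIndicator ε) H then 1 else 0) *
      ∏ e : CompleteEdge n, MvPolynomial.X e ^ (ε e : ℕ)

/-! ### Polynomially bounded functions -/

/-! If `H` has a loop, every graph maps to it and the polynomial is `∏ (1 + x_e)`; if `H` has no
edge, only the empty graph can map and the polynomial is constant.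

Membership in `VNP` has one difficulty: `Φ` asks whether a homomorphism exists, while a sum over
bits counts. The cure is nonuniform isolation. A random weighting of the witness bits gives a fixed
nonempty witness set a unique element of least weight with probability at least one half, so `|E| +
1` fixed weightings serve all graphs at once (`exists_isolating_weights`). Then `1 - ∏ (1 - number
of witnesses of weight k under w_i)` is the 0-1 value of `Φ`, and it unfolds into a single sum over
bits, with one copy of the witness for each factor (`exists_isolation_formula`).

Hardness turns `∑_ε g(x, ε)`, with `g` given by a circuit, into evaluations of `f^H` in three moves.
(1) A homogeneous component of `g` is a sum over derivations. A component of degree `d` is placed on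
a cyclic interval of `d` positions, and a product splits the interval, so nothing is demanded twice
and a derivation is a 0-1 vector subject to linear constraints (`sum_derivations`). Summing the
squared defects, plus a penalty tying the vector to `ε`, leaves a sum of monomials over the zeros of
a nonnegative, polynomially bounded quadratic form in bits (`exists_sum_evalBits_eq_zeroSum`). (2)
The indicator of `Q = 0` is interpolated from the values `s ^ (2 * Q)`. As `c_i c_j = c_i - [c_i =
1, c_j = 0]`, such a power is a product of vertex weights and cut weights, which leaves weighted
sums over the cuts of a complete graph (`exists_cutSum_eq_zeroSum`). (3) Let `r + 2` be the clique
number of `H`. Take a clique on `r + 2` vertices, two of them called poles, and join each further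
vertex to the `r` others. A second interpolation forces these edges and exactly `|ι|` edges at the
poles. Since no clique on `r + 3` vertices maps to `H`, each further vertex is joined to exactly one
pole, which is a 2-colouring, and only edges between different colours may occur
(`homomorphic_and_degree_iff`). Weights `y - 1` on those optional edges sum to `y` on each cut edge
(`exists_sum_homSum_eq`). -/

namespace PolyBounded

theorem mono {s t : ℕ → ℕ} (ht : PolyBounded t) (h : ∀ n, s n ≤ t n) : PolyBounded s := by
  obtain ⟨q, hq⟩ := ht
  exact ⟨q, fun n => (h n).trans (hq n)⟩

theorem const (c : ℕ) : PolyBounded fun _ => c := ⟨Polynomial.C c, fun n => by simp⟩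

theorem id : PolyBounded fun n => n := ⟨Polynomial.X, fun n => by simp⟩

theorem add {s t : ℕ → ℕ} (hs : PolyBounded s) (ht : PolyBounded t) :
    PolyBounded fun n => s n + t n := by
  obtain ⟨p, hp⟩ := hs
  obtain ⟨q, hq⟩ := ht
  exact ⟨p + q, fun n => by simpa using add_le_add (hp n) (hq n)⟩

theorem mul {s t : ℕ → ℕ} (hs : PolyBounded s) (ht : PolyBounded t) :
    PolyBounded fun n => s n * t n := by
  obtain ⟨p, hp⟩ := hs
  obtain ⟨q, hq⟩ := ht
  exact ⟨p * q, fun n => by simpa using Nat.mul_le_mul (hp n) (hq n)⟩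

theorem pow {s : ℕ → ℕ} (hs : PolyBounded s) (k : ℕ) : PolyBounded fun n => s n ^ k := by
  induction k with
  | zero => simpa using const 1
  | succ k ih => simpa only [pow_succ] using ih.mul hs

end PolyBounded

/-! ### Interpolation -/

/-- Extraction of a coefficient of a polynomial of degree at most `D` from its values at
`1, …, D + 1`. -/
theorem exists_interpolation_weights (D k : ℕ) :
    ∃ c : Fin (D + 1) → ℚ, ∀ e ≤ D,
      ∑ j : Fin (D + 1), c j * ((j : ℚ) + 1) ^ e = if e = k then 1 else 0 := by
  set M : Matrix (Fin (D + 1)) (Fin (D + 1)) ℚ :=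
    Matrix.vandermonde fun j : Fin (D + 1) => (j : ℚ) + 1
  have hM : IsUnit M.det := by
    rw [isUnit_iff_ne_zero, Matrix.det_vandermonde_ne_zero_iff]
    intro a b h
    have h' : ((a : ℕ) : ℚ) = (b : ℕ) := by simpa using h
    exact Fin.ext (by exact_mod_cast h')
  -- The weights solve `c M = e_k` for the Vandermonde matrix with the distinct nodes `j + 1`. For
  -- `k > D` the right-hand side is zero, and the statement remains true.
  refine ⟨Matrix.vecMul (fun e : Fin (D + 1) => if (e : ℕ) = k then 1 else 0) M⁻¹, fun e he => ?_⟩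
  have h := Matrix.vecMul_vecMul (fun e : Fin (D + 1) => if (e : ℕ) = k then (1 : ℚ) else 0) M⁻¹ M
  rw [Matrix.nonsing_inv_mul _ hM, Matrix.vecMul_one] at h
  exact congrFun h ⟨e, Nat.lt_succ_of_le he⟩

/-! ### Formulas -/

open MvPolynomial

/-- The polynomial `f` has an arithmetic formula of size at most `n`. -/
inductive HasFormula {K σ : Type} [CommSemiring K] : ℕ → MvPolynomial σ K → Prop
  | var (x : σ) : HasFormula 1 (X x)
  | const (c : K) : HasFormula 1 (C c)
  | add {n m : ℕ} {f g : MvPolynomial σ K} :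
      HasFormula n f → HasFormula m g → HasFormula (n + m + 1) (f + g)
  | mul {n m : ℕ} {f g : MvPolynomial σ K} :
      HasFormula n f → HasFormula m g → HasFormula (n + m + 1) (f * g)
  | mono {n m : ℕ} {f : MvPolynomial σ K} : HasFormula n f → n ≤ m → HasFormula m f

/-- The polynomial `f` has a formula of size at most `n` with oracle `g`. -/
inductive HasOracleFormula {K σ τ : Type} [CommSemiring K] [Fintype τ] (g : MvPolynomial τ K) :
    ℕ → MvPolynomial σ K → Prop
  | var (x : σ) : HasOracleFormula g 1 (X x)
  | const (c : K) : HasOracleFormula g 1 (C c)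
  | add {n m : ℕ} {f h : MvPolynomial σ K} :
      HasOracleFormula g n f → HasOracleFormula g m h → HasOracleFormula g (n + m + 1) (f + h)
  | mul {n m : ℕ} {f h : MvPolynomial σ K} :
      HasOracleFormula g n f → HasOracleFormula g m h → HasOracleFormula g (n + m + 1) (f * h)
  | oracle {n : ℕ} (a : τ → MvPolynomial σ K) :
      (∀ t, HasOracleFormula g n (a t)) → HasOracleFormula g (Fintype.card τ * n + 1) (aeval a g)
  | mono {n m : ℕ} {f : MvPolynomial σ K} :
      HasOracleFormula g n f → n ≤ m → HasOracleFormula g m f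

namespace HasFormula

variable {K σ ι : Type} [CommSemiring K] {n : ℕ}

/-- Size counts leaves, and the degree is at most the number of leaves. A small formula thus gives
the degree bound of a p-family as well as the circuit. -/
theorem totalDegree_le {f : MvPolynomial σ K} (h : HasFormula n f) : f.totalDegree ≤ n := by
  induction h with
  | var x =>
    rw [X]
    exact (totalDegree_monomial_le _ _).trans (by simp)
  | const c => simp
  | add _ _ h₁ h₂ => exact (totalDegree_add _ _).trans (by omega)
  | mul _ _ h₁ h₂ => exact (totalDegree_mul _ _).trans (by omega)
  | mono _ h ih => exact ih.trans h

theorem sum {s : Finset ι} {f : ι → MvPolynomial σ K} (h : ∀ i ∈ s, HasFormula n (f i)) :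
    HasFormula (s.card * (n + 1) + 1) (∑ i ∈ s, f i) := by
  classical
  induction s using Finset.induction_on with
  | empty => simpa using (const (0 : K)).mono (m := 0 * (n + 1) + 1) (by omega)
  | insert a s ha ih =>
    rw [Finset.sum_insert ha, Finset.card_insert_of_notMem ha]
    refine ((h a (by simp)).add (ih fun i hi => h i (by simp [hi]))).mono ?_
    rw [add_mul]; omega

theorem prod {s : Finset ι} {f : ι → MvPolynomial σ K} (h : ∀ i ∈ s, HasFormula n (f i)) :
    HasFormula (s.card * (n + 1) + 1) (∏ i ∈ s, f i) := by
  classical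
  induction s using Finset.induction_on with
  | empty => simpa using (const (1 : K)).mono (m := 0 * (n + 1) + 1) (by omega)
  | insert a s ha ih =>
    rw [Finset.prod_insert ha, Finset.card_insert_of_notMem ha]
    refine ((h a (by simp)).mul (ih fun i hi => h i (by simp [hi]))).mono ?_
    rw [add_mul]; omega

end HasFormula

theorem HasOracleFormula.sum {K σ τ ι : Type} [CommSemiring K] [Fintype τ] {g : MvPolynomial τ K}
    {n : ℕ} {s : Finset ι} {f : ι → MvPolynomial σ K} (h : ∀ i ∈ s, HasOracleFormula g n (f i)) :
    HasOracleFormula g (s.card * (n + 1) + 1) (∑ i ∈ s, f i) := by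
  classical
  induction s using Finset.induction_on with
  | empty => simpa using (const (0 : K)).mono (m := 0 * (n + 1) + 1) (by omega)
  | insert a s ha ih =>
    rw [Finset.sum_insert ha, Finset.card_insert_of_notMem ha]
    refine ((h a (by simp)).add (ih fun i hi => h i (by simp [hi]))).mono ?_
    rw [add_mul]; omega

/-! ### Straight-line programs as lists of values -/

/-- The list of values, latest first, of a straight-line program. -/
inductive StraightLine {K σ : Type} [CommSemiring K] : List (MvPolynomial σ K) → Prop
  | nil : StraightLine []
  | var {l : List (MvPolynomial σ K)} (x : σ) : StraightLine l → StraightLine (X x :: l)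
  | const {l : List (MvPolynomial σ K)} (c : K) : StraightLine l → StraightLine (C c :: l)
  | add {l : List (MvPolynomial σ K)} {a b : MvPolynomial σ K} :
      StraightLine l → a ∈ l → b ∈ l → StraightLine ((a + b) :: l)
  | mul {l : List (MvPolynomial σ K)} {a b : MvPolynomial σ K} :
      StraightLine l → a ∈ l → b ∈ l → StraightLine ((a * b) :: l)

/-- The list of values, latest first, of a straight-line program with an oracle. -/
inductive OracleStraightLine {K σ τ : Type} [CommSemiring K] (g : MvPolynomial τ K) :
    List (MvPolynomial σ K) → Prop
  | nil : OracleStraightLine g []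
  | var {l : List (MvPolynomial σ K)} (x : σ) :
      OracleStraightLine g l → OracleStraightLine g (X x :: l)
  | const {l : List (MvPolynomial σ K)} (c : K) :
      OracleStraightLine g l → OracleStraightLine g (C c :: l)
  | add {l : List (MvPolynomial σ K)} {a b : MvPolynomial σ K} :
      OracleStraightLine g l → a ∈ l → b ∈ l → OracleStraightLine g ((a + b) :: l)
  | mul {l : List (MvPolynomial σ K)} {a b : MvPolynomial σ K} :
      OracleStraightLine g l → a ∈ l → b ∈ l → OracleStraightLine g ((a * b) :: l)
  | oracle {l : List (MvPolynomial σ K)} (a : τ → MvPolynomial σ K) :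
      OracleStraightLine g l → (∀ t, a t ∈ l) → OracleStraightLine g (aeval a g :: l)

theorem StraightLine.append {K σ : Type} [CommSemiring K] {l₁ l₂ : List (MvPolynomial σ K)}
    (h₁ : StraightLine l₁) (h₂ : StraightLine l₂) : StraightLine (l₁ ++ l₂) := by
  induction h₁ with
  | nil => exact h₂
  | var x _ ih => exact ih.var x
  | const c _ ih => exact ih.const c
  | add _ ha hb ih => exact ih.add (List.mem_append_left _ ha) (List.mem_append_left _ hb)
  | mul _ ha hb ih => exact ih.mul (List.mem_append_left _ ha) (List.mem_append_left _ hb)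

theorem OracleStraightLine.append {K σ τ : Type} [CommSemiring K] {g : MvPolynomial τ K}
    {l₁ l₂ : List (MvPolynomial σ K)}
    (h₁ : OracleStraightLine g l₁) (h₂ : OracleStraightLine g l₂) :
    OracleStraightLine g (l₁ ++ l₂) := by
  induction h₁ with
  | nil => exact h₂
  | var x _ ih => exact ih.var x
  | const c _ ih => exact ih.const c
  | add _ ha hb ih => exact ih.add (List.mem_append_left _ ha) (List.mem_append_left _ hb)
  | mul _ ha hb ih => exact ih.mul (List.mem_append_left _ ha) (List.mem_append_left _ hb)
  | oracle a _ ha ih => exact ih.oracle a fun t => List.mem_append_left _ (ha t)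

theorem HasFormula.exists_straightLine {K σ : Type} [CommSemiring K] {n : ℕ}
    {f : MvPolynomial σ K} (h : HasFormula n f) :
    ∃ l, StraightLine l ∧ l.length ≤ n ∧ f ∈ l := by
  induction h with
  | var x => exact ⟨[X x], .var x .nil, by simp, by simp⟩
  | const c => exact ⟨[C c], .const c .nil, by simp, by simp⟩
  | add _ _ h₁ h₂ =>
    obtain ⟨l₁, s₁, n₁, m₁⟩ := h₁
    obtain ⟨l₂, s₂, n₂, m₂⟩ := h₂
    exact ⟨_, (s₁.append s₂).add (List.mem_append_left _ m₁) (List.mem_append_right _ m₂),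
      by simp; omega, by simp⟩
  | mul _ _ h₁ h₂ =>
    obtain ⟨l₁, s₁, n₁, m₁⟩ := h₁
    obtain ⟨l₂, s₂, n₂, m₂⟩ := h₂
    exact ⟨_, (s₁.append s₂).mul (List.mem_append_left _ m₁) (List.mem_append_right _ m₂),
      by simp; omega, by simp⟩
  | mono _ h ih =>
    obtain ⟨l, s, k, m⟩ := ih
    exact ⟨l, s, k.trans h, m⟩

theorem OracleStraightLine.exists_forall_mem {K σ τ ι : Type} [CommSemiring K]
    {g : MvPolynomial τ K} {n : ℕ} {a : ι → MvPolynomial σ K} (s : Finset ι)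
    (h : ∀ t, ∃ l, OracleStraightLine g l ∧ l.length ≤ n ∧ a t ∈ l) :
    ∃ l, OracleStraightLine g l ∧ l.length ≤ s.card * n ∧ ∀ t ∈ s, a t ∈ l := by
  classical
  induction s using Finset.induction_on with
  | empty => exact ⟨[], .nil, by simp, by simp⟩
  | insert i s hi ih =>
    obtain ⟨l, s₁, n₁, m₁⟩ := ih
    obtain ⟨l', s₂, n₂, m₂⟩ := h i
    refine ⟨l' ++ l, s₂.append s₁, ?_, ?_⟩
    · rw [Finset.card_insert_of_notMem hi, List.length_append, add_mul]
      omega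
    · intro t ht
      rcases Finset.mem_insert.1 ht with rfl | ht
      · exact List.mem_append_left _ m₂
      · exact List.mem_append_right _ (m₁ t ht)

theorem HasOracleFormula.exists_straightLine {K σ τ : Type} [CommSemiring K] [Fintype τ]
    {g : MvPolynomial τ K} {n : ℕ} {f : MvPolynomial σ K} (h : HasOracleFormula g n f) :
    ∃ l, OracleStraightLine g l ∧ l.length ≤ n ∧ f ∈ l := by
  induction h with
  | var x => exact ⟨[X x], .var x .nil, by simp, by simp⟩
  | const c => exact ⟨[C c], .const c .nil, by simp, by simp⟩
  | add _ _ h₁ h₂ =>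
    obtain ⟨l₁, s₁, n₁, m₁⟩ := h₁
    obtain ⟨l₂, s₂, n₂, m₂⟩ := h₂
    exact ⟨_, (s₁.append s₂).add (List.mem_append_left _ m₁) (List.mem_append_right _ m₂),
      by simp; omega, by simp⟩
  | mul _ _ h₁ h₂ =>
    obtain ⟨l₁, s₁, n₁, m₁⟩ := h₁
    obtain ⟨l₂, s₂, n₂, m₂⟩ := h₂
    exact ⟨_, (s₁.append s₂).mul (List.mem_append_left _ m₁) (List.mem_append_right _ m₂),
      by simp; omega, by simp⟩
  | oracle a _ ih =>
    obtain ⟨l, s, k, m⟩ := OracleStraightLine.exists_forall_mem Finset.univ ih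
    exact ⟨_, s.oracle a fun t => m t (Finset.mem_univ t), by simpa using k, by simp⟩
  | mono _ h ih =>
    obtain ⟨l, s, k, m⟩ := ih
    exact ⟨l, s, k.trans h, m⟩

/-! ### From straight-line programs to circuits -/

/-- The circuit formed by the first `n` gates of a sequence of gates. -/
def ArithCircuit.ofSeq {K σ : Type} (G : ∀ i, ArithGate K σ i) (n : ℕ) (o : Fin n) :
    ArithCircuit K σ :=
  ⟨n, fun i => G i, o⟩

/-- The oracle circuit formed by the first `n` gates of a sequence of gates. -/
def OracleCircuit.ofSeq {K σ τ : Type} (G : ∀ i, OracleGate K σ τ i) (n : ℕ) (o : Fin n) :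
    OracleCircuit K σ τ :=
  ⟨n, fun i => G i, o⟩

/-- A gate sees only earlier gates, so neither the length of the prefix, nor the output, nor later
changes matter. Infinite gate sequences thus allow gates to be appended without changing index
types. -/
theorem ArithCircuit.value_ofSeq_congr {K σ : Type} [CommSemiring K]
    {G G' : ∀ i, ArithGate K σ i} {n n' : ℕ} (o : Fin n) (o' : Fin n') (i : ℕ)
    (hi : i < n) (hi' : i < n') (h : ∀ j ≤ i, G j = G' j) :
    (ofSeq G n o).value ⟨i, hi⟩ = (ofSeq G' n' o').value ⟨i, hi'⟩ := by
  induction i using Nat.strong_induction_on with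
  | _ i ih =>
    have hc (a : Fin i) := ih a a.2 (a.2.trans hi) (a.2.trans hi')
      fun j hj => h j (hj.trans a.2.le)
    unfold value
    simp only [ofSeq, h i le_rfl]
    cases G' i with
    | var x => rfl
    | const c => rfl
    | add a b => exact congrArg₂ (· + ·) (hc a) (hc b)
    | mul a b => exact congrArg₂ (· * ·) (hc a) (hc b)

theorem OracleCircuit.value_ofSeq_congr {K σ τ : Type} [CommSemiring K] (g : MvPolynomial τ K)
    {G G' : ∀ i, OracleGate K σ τ i} {n n' : ℕ} (o : Fin n) (o' : Fin n') (i : ℕ)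
    (hi : i < n) (hi' : i < n') (h : ∀ j ≤ i, G j = G' j) :
    (ofSeq G n o).value g ⟨i, hi⟩ = (ofSeq G' n' o').value g ⟨i, hi'⟩ := by
  induction i using Nat.strong_induction_on with
  | _ i ih =>
    have hc (a : Fin i) := ih a a.2 (a.2.trans hi) (a.2.trans hi')
      fun j hj => h j (hj.trans a.2.le)
    unfold value
    simp only [ofSeq, h i le_rfl]
    cases G' i with
    | var x => rfl
    | const c => rfl
    | add a b => exact congrArg₂ (· + ·) (hc a) (hc b)
    | mul a b => exact congrArg₂ (· * ·) (hc a) (hc b)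
    | oracle a => exact congrArg (fun v => aeval v g) (funext fun t => hc (a t))

theorem StraightLine.exists_seq {K σ : Type} [CommSemiring K] {l : List (MvPolynomial σ K)}
    (hl : StraightLine l) :
    ∃ G : ∀ i, ArithGate K σ i, ∀ (n : ℕ) (o : Fin n) (i : ℕ) (hi : i < n) (h : i < l.length),
      (ArithCircuit.ofSeq G n o).value ⟨i, hi⟩ = l.reverse[i]'(by simpa using h) := by
  have key : ∀ (l : List (MvPolynomial σ K)) (f : MvPolynomial σ K) (G : ∀ i, ArithGate K σ i),
      (∀ (n : ℕ) (o : Fin n) (i : ℕ) (hi : i < n) (h : i < l.length),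
        (ArithCircuit.ofSeq G n o).value ⟨i, hi⟩ = l.reverse[i]'(by simpa using h)) →
      (∀ γ : ArithGate K σ l.length,
        (∀ (n : ℕ) (o : Fin n) (hi : l.length < n),
          (ArithCircuit.ofSeq (Function.update G l.length γ) n o).value ⟨l.length, hi⟩ = f) →
        ∃ G' : ∀ i, ArithGate K σ i,
          ∀ (n : ℕ) (o : Fin n) (i : ℕ) (hi : i < n) (h : i < (f :: l).length),
          (ArithCircuit.ofSeq G' n o).value ⟨i, hi⟩ = (f :: l).reverse[i]'(by simpa using h)) := by
    intro l f G hG γ hγ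
    refine ⟨Function.update G l.length γ, fun n o i hi h => ?_⟩
    rcases Nat.lt_succ_iff_lt_or_eq.1 h with h | h
    · rw [ArithCircuit.value_ofSeq_congr o o i hi hi (G' := G), hG n o i hi h]
      · simp [h]
      · intro j hj
        exact Function.update_of_ne (by omega) _ _
    · subst h
      rw [hγ]
      simp
  induction hl with
  | nil => exact ⟨fun i => .const 0, fun n o i hi h => by simp at h⟩
  | @var l x _ ih =>
    obtain ⟨G, hG⟩ := ih
    refine key l _ G hG (.var x) fun n o hi => ?_
    unfold ArithCircuit.value
    simp [ArithCircuit.ofSeq]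
  | @const l c _ ih =>
    obtain ⟨G, hG⟩ := ih
    refine key l _ G hG (.const c) fun n o hi => ?_
    unfold ArithCircuit.value
    simp [ArithCircuit.ofSeq]
  | @add l a b _ ha hb ih =>
    obtain ⟨G, hG⟩ := ih
    obtain ⟨i, hi, rfl⟩ := List.getElem_of_mem (List.mem_reverse.2 ha)
    obtain ⟨j, hj, rfl⟩ := List.getElem_of_mem (List.mem_reverse.2 hb)
    rw [List.length_reverse] at hi hj
    refine key l _ G hG (.add ⟨i, hi⟩ ⟨j, hj⟩) fun n o hn => ?_
    rw [← hG n o i (hi.trans hn) hi, ← hG n o j (hj.trans hn) hj,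
      ← ArithCircuit.value_ofSeq_congr (G := Function.update G l.length (.add ⟨i, hi⟩ ⟨j, hj⟩))
        o o i (hi.trans hn) (hi.trans hn) (fun k hk => Function.update_of_ne (by omega) _ _),
      ← ArithCircuit.value_ofSeq_congr (G := Function.update G l.length (.add ⟨i, hi⟩ ⟨j, hj⟩))
        o o j (hj.trans hn) (hj.trans hn) (fun k hk => Function.update_of_ne (by omega) _ _)]
    conv_lhs => unfold ArithCircuit.value
    simp [ArithCircuit.ofSeq]
  | @mul l a b _ ha hb ih =>
    obtain ⟨G, hG⟩ := ih
    obtain ⟨i, hi, rfl⟩ := List.getElem_of_mem (List.mem_reverse.2 ha)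
    obtain ⟨j, hj, rfl⟩ := List.getElem_of_mem (List.mem_reverse.2 hb)
    rw [List.length_reverse] at hi hj
    refine key l _ G hG (.mul ⟨i, hi⟩ ⟨j, hj⟩) fun n o hn => ?_
    rw [← hG n o i (hi.trans hn) hi, ← hG n o j (hj.trans hn) hj,
      ← ArithCircuit.value_ofSeq_congr (G := Function.update G l.length (.mul ⟨i, hi⟩ ⟨j, hj⟩))
        o o i (hi.trans hn) (hi.trans hn) (fun k hk => Function.update_of_ne (by omega) _ _),
      ← ArithCircuit.value_ofSeq_congr (G := Function.update G l.length (.mul ⟨i, hi⟩ ⟨j, hj⟩))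
        o o j (hj.trans hn) (hj.trans hn) (fun k hk => Function.update_of_ne (by omega) _ _)]
    conv_lhs => unfold ArithCircuit.value
    simp [ArithCircuit.ofSeq]

theorem OracleStraightLine.exists_seq {K σ τ : Type} [CommSemiring K] {g : MvPolynomial τ K}
    {l : List (MvPolynomial σ K)} (hl : OracleStraightLine g l) :
    ∃ G : ∀ i, OracleGate K σ τ i, ∀ (n : ℕ) (o : Fin n) (i : ℕ) (hi : i < n) (h : i < l.length),
      (OracleCircuit.ofSeq G n o).value g ⟨i, hi⟩ = l.reverse[i]'(by simpa using h) := by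
  have key : ∀ (l : List (MvPolynomial σ K)) (f : MvPolynomial σ K) (G : ∀ i, OracleGate K σ τ i),
      (∀ (n : ℕ) (o : Fin n) (i : ℕ) (hi : i < n) (h : i < l.length),
        (OracleCircuit.ofSeq G n o).value g ⟨i, hi⟩ = l.reverse[i]'(by simpa using h)) →
      (∀ γ : OracleGate K σ τ l.length,
        (∀ (n : ℕ) (o : Fin n) (hi : l.length < n),
          (OracleCircuit.ofSeq (Function.update G l.length γ) n o).value g ⟨l.length, hi⟩ = f) →
        ∃ G' : ∀ i, OracleGate K σ τ i,
          ∀ (n : ℕ) (o : Fin n) (i : ℕ) (hi : i < n) (h : i < (f :: l).length),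
          (OracleCircuit.ofSeq G' n o).value g ⟨i, hi⟩ =
            (f :: l).reverse[i]'(by simpa using h)) := by
    intro l f G hG γ hγ
    refine ⟨Function.update G l.length γ, fun n o i hi h => ?_⟩
    rcases Nat.lt_succ_iff_lt_or_eq.1 h with h | h
    · rw [OracleCircuit.value_ofSeq_congr g o o i hi hi (G' := G), hG n o i hi h]
      · simp [h]
      · intro j hj
        exact Function.update_of_ne (by omega) _ _
    · subst h
      rw [hγ]
      simp
  -- An operand already listed keeps its position and its value, whatever gate is put at the end.
  have old : ∀ (l : List (MvPolynomial σ K)) (G : ∀ i, OracleGate K σ τ i),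
      (∀ (n : ℕ) (o : Fin n) (i : ℕ) (hi : i < n) (h : i < l.length),
        (OracleCircuit.ofSeq G n o).value g ⟨i, hi⟩ = l.reverse[i]'(by simpa using h)) →
      ∀ f ∈ l, ∃ i, ∃ hi : i < l.length, ∀ (γ : OracleGate K σ τ l.length) (n : ℕ) (o : Fin n)
        (hn : l.length < n), (OracleCircuit.ofSeq (Function.update G l.length γ) n o).value g
          ⟨i, hi.trans hn⟩ = f := by
    intro l G hG f hf
    obtain ⟨i, hi, rfl⟩ := List.getElem_of_mem (List.mem_reverse.2 hf)
    rw [List.length_reverse] at hi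
    refine ⟨i, hi, fun γ n o hn => ?_⟩
    rw [← hG n o i (hi.trans hn) hi]
    exact OracleCircuit.value_ofSeq_congr g o o i _ _
      (fun k hk => Function.update_of_ne (by omega) _ _)
  induction hl with
  | nil => exact ⟨fun i => .const 0, fun n o i hi h => by simp at h⟩
  | @var l x _ ih =>
    obtain ⟨G, hG⟩ := ih
    refine key l _ G hG (.var x) fun n o hi => ?_
    unfold OracleCircuit.value
    simp [OracleCircuit.ofSeq]
  | @const l c _ ih =>
    obtain ⟨G, hG⟩ := ih
    refine key l _ G hG (.const c) fun n o hi => ?_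
    unfold OracleCircuit.value
    simp [OracleCircuit.ofSeq]
  | @add l a b _ ha hb ih =>
    obtain ⟨G, hG⟩ := ih
    obtain ⟨i, hi, hi'⟩ := old l G hG a ha
    obtain ⟨j, hj, hj'⟩ := old l G hG b hb
    refine key l _ G hG (.add ⟨i, hi⟩ ⟨j, hj⟩) fun n o hn => ?_
    rw [← hi' (.add ⟨i, hi⟩ ⟨j, hj⟩) n o hn, ← hj' (.add ⟨i, hi⟩ ⟨j, hj⟩) n o hn]
    conv_lhs => unfold OracleCircuit.value
    simp [OracleCircuit.ofSeq]
  | @mul l a b _ ha hb ih =>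
    obtain ⟨G, hG⟩ := ih
    obtain ⟨i, hi, hi'⟩ := old l G hG a ha
    obtain ⟨j, hj, hj'⟩ := old l G hG b hb
    refine key l _ G hG (.mul ⟨i, hi⟩ ⟨j, hj⟩) fun n o hn => ?_
    rw [← hi' (.mul ⟨i, hi⟩ ⟨j, hj⟩) n o hn, ← hj' (.mul ⟨i, hi⟩ ⟨j, hj⟩) n o hn]
    conv_lhs => unfold OracleCircuit.value
    simp [OracleCircuit.ofSeq]
  | @oracle l a _ ha ih =>
    obtain ⟨G, hG⟩ := ih
    choose i hi hi' using fun t => old l G hG (a t) (ha t)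
    refine key l _ G hG (.oracle fun t => ⟨i t, hi t⟩) fun n o hn => ?_
    rw [← funext fun t => hi' t (.oracle fun t => ⟨i t, hi t⟩) n o hn]
    conv_lhs => unfold OracleCircuit.value
    simp [OracleCircuit.ofSeq]

theorem HasFormula.exists_circuit {K σ : Type} [CommSemiring K] {n : ℕ}
    {f : MvPolynomial σ K} (h : HasFormula n f) :
    ∃ C : ArithCircuit K σ, C.size ≤ n ∧ C.Computes f := by
  obtain ⟨l, hl, hn, hf⟩ := h.exists_straightLine
  obtain ⟨G, hG⟩ := hl.exists_seq
  obtain ⟨i, hi, rfl⟩ := List.getElem_of_mem (List.mem_reverse.2 hf)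
  rw [List.length_reverse] at hi
  refine ⟨.ofSeq G l.length ⟨i, hi⟩, ?_, hG _ _ _ _ hi⟩
  exact (Finset.card_le_univ _).trans ((Fintype.card_fin _).trans_le hn)

theorem HasOracleFormula.exists_circuit {K σ τ : Type} [CommSemiring K] [Fintype τ]
    {g : MvPolynomial τ K} {n : ℕ} {f : MvPolynomial σ K} (h : HasOracleFormula g n f) :
    ∃ C : OracleCircuit K σ τ, C.size ≤ n ∧ C.Computes g f := by
  obtain ⟨l, hl, hn, hf⟩ := h.exists_straightLine
  obtain ⟨G, hG⟩ := hl.exists_seq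
  obtain ⟨i, hi, rfl⟩ := List.getElem_of_mem (List.mem_reverse.2 hf)
  rw [List.length_reverse] at hi
  refine ⟨.ofSeq G l.length ⟨i, hi⟩, ?_, hG _ _ _ _ hi⟩
  exact (Finset.card_le_univ _).trans ((Fintype.card_fin _).trans_le hn)

/-! ### From circuits to straight-line programs -/

/-- An input gate can be recreated by one new entry; a computation gate is assumed to be listed
already. -/
theorem StraightLine.exists_append_gate {K σ : Type} [CommSemiring K] (C : ArithCircuit K σ)
    {l : List (MvPolynomial σ K)} (hl : StraightLine l) (i : Fin C.numGates)
    (h : (C.gate i).isComputation = true → C.value i ∈ l) :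
    ∃ l', StraightLine l' ∧ l'.length ≤ l.length + 1 ∧ C.value i ∈ l' ∧ l ⊆ l' := by
  cases hg : C.gate i with
  | var x =>
    refine ⟨_, hl.var x, by simp, ?_, by simp⟩
    unfold ArithCircuit.value
    simp [hg]
  | const c =>
    refine ⟨_, hl.const c, by simp, ?_, by simp⟩
    unfold ArithCircuit.value
    simp [hg]
  | add a b => exact ⟨l, hl, by simp, h (by simp [hg, ArithGate.isComputation]), by simp⟩
  | mul a b => exact ⟨l, hl, by simp, h (by simp [hg, ArithGate.isComputation]), by simp⟩

/-- The size does not count input gates, so their number is unbounded. Only computation gates are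
kept, and inputs are recreated where they are used: two operands and one result account for the
factor 3. -/
theorem ArithCircuit.exists_straightLine_lt {K σ : Type} [CommSemiring K] (C : ArithCircuit K σ)
    (n : ℕ) (hn : n ≤ C.numGates) :
    ∃ l, StraightLine l ∧
      l.length ≤ 3 * (Finset.univ.filter fun i : Fin C.numGates =>
        (i : ℕ) < n ∧ (C.gate i).isComputation = true).card ∧
      ∀ i : Fin C.numGates, (i : ℕ) < n → (C.gate i).isComputation = true → C.value i ∈ l := by
  induction n with
  | zero => exact ⟨[], .nil, by simp, by simp⟩
  | succ n ih =>
    obtain ⟨l, hl, hlen, hmem⟩ := ih (by omega)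
    set k : Fin C.numGates := ⟨n, hn⟩
    by_cases hk : (C.gate k).isComputation = true
    · have hcard : (Finset.univ.filter fun i : Fin C.numGates =>
          (i : ℕ) < n ∧ (C.gate i).isComputation = true).card + 1 ≤
          (Finset.univ.filter fun i : Fin C.numGates =>
          (i : ℕ) < n + 1 ∧ (C.gate i).isComputation = true).card := by
        rw [← Finset.card_insert_of_notMem (a := k) (by simp [k])]
        refine Finset.card_le_card fun i hi => ?_
        simp only [Finset.mem_insert, Finset.mem_filter, Finset.mem_univ, true_and] at hi ⊢
        rcases hi with rfl | hi
        · exact ⟨by simp [k], hk⟩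
        · exact ⟨by omega, hi.2⟩
      have step : ∀ a b : Fin k, ∃ l', StraightLine l' ∧ l'.length ≤ l.length + 2 ∧
          C.value ⟨a, a.2.trans k.2⟩ ∈ l' ∧ C.value ⟨b, b.2.trans k.2⟩ ∈ l' ∧ l ⊆ l' := by
        intro a b
        obtain ⟨l₁, s₁, n₁, m₁, i₁⟩ := hl.exists_append_gate C ⟨a, a.2.trans k.2⟩ (hmem _ a.2)
        obtain ⟨l₂, s₂, n₂, m₂, i₂⟩ := s₁.exists_append_gate C ⟨b, b.2.trans k.2⟩
          (fun h => i₁ (hmem _ b.2 h))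
        exact ⟨l₂, s₂, by omega, i₂ m₁, m₂, fun x hx => i₂ (i₁ hx)⟩
      have fin : ∀ l', StraightLine l' → l'.length ≤ l.length + 3 → C.value k ∈ l' → l ⊆ l' →
          ∃ l, StraightLine l ∧
            l.length ≤ 3 * (Finset.univ.filter fun i : Fin C.numGates =>
              (i : ℕ) < n + 1 ∧ (C.gate i).isComputation = true).card ∧
            ∀ i : Fin C.numGates, (i : ℕ) < n + 1 → (C.gate i).isComputation = true →
              C.value i ∈ l := by
        intro l' s' n' m' i'
        refine ⟨l', s', by omega, fun i hi h => ?_⟩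
        rcases Nat.lt_succ_iff_lt_or_eq.1 hi with hi | hi
        · exact i' (hmem i hi h)
        · obtain rfl : i = k := Fin.ext hi
          exact m'
      cases hg : C.gate k with
      | var x => simp [hg, ArithGate.isComputation] at hk
      | const c => simp [hg, ArithGate.isComputation] at hk
      | add a b =>
        obtain ⟨l', s', n', ma, mb, i'⟩ := step a b
        have hv : C.value k =
            C.value ⟨a, a.2.trans k.2⟩ + C.value ⟨b, b.2.trans k.2⟩ := by
          conv_lhs => unfold ArithCircuit.value
          simp only [hg]
        exact fin _ (s'.add ma mb) (by simp; omega) (by simp [hv])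
          (fun x hx => List.mem_cons_of_mem _ (i' hx))
      | mul a b =>
        obtain ⟨l', s', n', ma, mb, i'⟩ := step a b
        have hv : C.value k =
            C.value ⟨a, a.2.trans k.2⟩ * C.value ⟨b, b.2.trans k.2⟩ := by
          conv_lhs => unfold ArithCircuit.value
          simp only [hg]
        exact fin _ (s'.mul ma mb) (by simp; omega) (by simp [hv])
          (fun x hx => List.mem_cons_of_mem _ (i' hx))
    · refine ⟨l, hl, hlen.trans (Nat.mul_le_mul_left _ (Finset.card_le_card fun i hi => ?_)), ?_⟩
      · simp only [Finset.mem_filter, Finset.mem_univ, true_and] at hi ⊢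
        exact ⟨by omega, hi.2⟩
      · intro i hi h
        rcases Nat.lt_succ_iff_lt_or_eq.1 hi with hi | hi
        · exact hmem i hi h
        · obtain rfl : i = k := Fin.ext hi
          exact absurd h hk

theorem ArithCircuit.Computes.exists_straightLine {K σ : Type} [CommSemiring K]
    {C : ArithCircuit K σ} {f : MvPolynomial σ K} (h : C.Computes f) :
    ∃ l, StraightLine l ∧ l.length ≤ 3 * C.size + 1 ∧ f ∈ l := by
  obtain ⟨l, hl, hlen, hmem⟩ := C.exists_straightLine_lt C.numGates le_rfl
  obtain ⟨l', s', n', m', -⟩ := hl.exists_append_gate C C.output (hmem _ C.output.2)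
  refine ⟨l', s', n'.trans (Nat.succ_le_succ (hlen.trans (Nat.mul_le_mul_left _ ?_))), h ▸ m'⟩
  exact Finset.card_le_card fun i hi => by simpa using (Finset.mem_filter.1 hi).2.2

/-- An instruction of a straight-line program of length `L`; the indices of the arguments are
larger than that of the result, as the latest value comes first. -/
inductive Instr (K σ : Type) (L : ℕ) : Type
  | var (x : σ) : Instr K σ L
  | const (c : K) : Instr K σ L
  | add (a b : Fin L) : Instr K σ L
  | mul (a b : Fin L) : Instr K σ L

/-- The instruction `r` at position `i` produces the value `v i` from values at later positions. -/
def Instr.Produces {K σ : Type} [CommSemiring K] {L : ℕ} (v : Fin L → MvPolynomial σ K)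
    (i : Fin L) : Instr K σ L → Prop
  | .var x => v i = X x
  | .const c => v i = C c
  | .add a b => i < a ∧ i < b ∧ v i = v a + v b
  | .mul a b => i < a ∧ i < b ∧ v i = v a * v b

/-- Replaces membership of operands in the list by explicit positions, which can then index a system
of equations. The latest value has position `0`, so a new entry shifts all others by `succ`. -/
theorem StraightLine.exists_instr {K σ : Type} [CommSemiring K] {l : List (MvPolynomial σ K)}
    (hl : StraightLine l) (i : Fin l.length) :
    ∃ r : Instr K σ l.length, r.Produces l.get i := by
  have key : ∀ (l : List (MvPolynomial σ K)) (f : MvPolynomial σ K),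
      (∀ i : Fin l.length, ∃ r : Instr K σ l.length, r.Produces l.get i) →
      (∃ r : Instr K σ (l.length + 1), r.Produces (f :: l).get 0) →
      ∀ i : Fin (f :: l).length, ∃ r : Instr K σ (f :: l).length, r.Produces (f :: l).get i := by
    intro l f h h₀ i
    induction i using Fin.cases with
    | zero => exact h₀
    | succ i =>
      obtain ⟨r, hr⟩ := h i
      cases r with
      | var x => exact ⟨.var x, hr⟩
      | const c => exact ⟨.const c, hr⟩
      | add a b =>
        exact ⟨.add a.succ b.succ, Fin.succ_lt_succ_iff.2 hr.1, Fin.succ_lt_succ_iff.2 hr.2.1, hr.2.2⟩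
      | mul a b =>
        exact ⟨.mul a.succ b.succ, Fin.succ_lt_succ_iff.2 hr.1, Fin.succ_lt_succ_iff.2 hr.2.1, hr.2.2⟩
  induction hl with
  | nil => exact i.elim0
  | var x _ ih => exact key _ _ ih ⟨.var x, rfl⟩ i
  | const c _ ih => exact key _ _ ih ⟨.const c, rfl⟩ i
  | add _ ha hb ih =>
    obtain ⟨a, rfl⟩ := List.mem_iff_get.1 ha
    obtain ⟨b, rfl⟩ := List.mem_iff_get.1 hb
    exact key _ _ ih ⟨.add a.succ b.succ, Fin.succ_pos a, Fin.succ_pos b, rfl⟩ i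
  | mul _ ha hb ih =>
    obtain ⟨a, rfl⟩ := List.mem_iff_get.1 ha
    obtain ⟨b, rfl⟩ := List.mem_iff_get.1 hb
    exact key _ _ ih ⟨.mul a.succ b.succ, Fin.succ_pos a, Fin.succ_pos b, rfl⟩ i

/-! ### Isolation -/

section Isolation

variable {I : Type} [Fintype I]

/-- The weight of a 0-1 vector. -/
def weight {M : ℕ} (w : I → Fin M) (z : I → Fin 2) : ℕ := ∑ i, (w i : ℕ) * (z i : ℕ)

/-- Exactly one element of `S` has weight `k`, for some `k`. -/
def Isolates {M : ℕ} (w : I → Fin M) (S : Set (I → Fin 2)) : Prop :=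
  ∃ k, ∃! z, z ∈ S ∧ weight w z = k

theorem weight_le {M : ℕ} (w : I → Fin M) (z : I → Fin 2) :
    weight w z ≤ Fintype.card I * M := by
  refine (Finset.sum_le_card_nsmul _ _ M fun i _ => ?_).trans (by simp)
  have h₁ := (w i).2
  have h₂ := (z i).2
  calc (w i : ℕ) * (z i : ℕ) ≤ M * 1 := Nat.mul_le_mul (by omega) (by omega)
    _ = M := mul_one M

/-- Two elements of `S` of least weight differ at `i`. -/
def Ambiguous {M : ℕ} (S : Set (I → Fin 2)) (i : I) (w : I → Fin M) : Prop :=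
  ∃ z ∈ S, ∃ z' ∈ S, z i = 1 ∧ z' i = 0 ∧ weight w z = weight w z' ∧
    ∀ y ∈ S, weight w z ≤ weight w y

/-- Without isolation the least weight is attained twice, and the two minimizers differ somewhere;
the one with value 1 there takes the first role. -/
theorem exists_ambiguous {M : ℕ} {S : Set (I → Fin 2)} (hS : S.Nonempty) {w : I → Fin M}
    (hw : ¬ Isolates w S) : ∃ i, Ambiguous S i w := by
  obtain ⟨z, hz, hmin⟩ : ∃ z ∈ S, ∀ y ∈ S, weight w z ≤ weight w y :=
    Set.exists_min_image S (weight w) S.toFinite hS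
  have : ∃ z' ∈ S, weight w z' = weight w z ∧ z' ≠ z := by
    by_contra! h
    exact hw ⟨weight w z, z, ⟨hz, rfl⟩, fun y hy => h y hy.1 hy.2⟩
  obtain ⟨z', hz', heq, hne⟩ := this
  obtain ⟨i, hi⟩ := Function.ne_iff.1 hne
  refine ⟨i, ?_⟩
  have h₁ := (z i).2
  have h₂ := (z' i).2
  have h₃ : (z' i : ℕ) ≠ z i := fun h => hi (Fin.ext h)
  rcases (by omega : (z i : ℕ) = 1 ∧ (z' i : ℕ) = 0 ∨ (z i : ℕ) = 0 ∧ (z' i : ℕ) = 1) with h | h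
  · exact ⟨z, hz, z', hz', Fin.ext h.1, Fin.ext h.2, heq.symm, hmin⟩
  · exact ⟨z', hz', z, hz, Fin.ext h.2, Fin.ext h.1, heq, fun y hy => heq ▸ hmin y hy⟩

/-- Ambiguity at `i` forces `w i` to be the least weight off `i` among elements with `z i = 0`,
minus the same among those with `z i = 1`. This number does not depend on `w i`; by symmetry one
inequality suffices. -/
theorem Ambiguous.apply_le {M : ℕ} {S : Set (I → Fin 2)} {i : I} {w w' : I → Fin M}
    (hw : Ambiguous S i w) (hw' : Ambiguous S i w') (h : ∀ j ≠ i, w j = w' j) :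
    (w' i : ℕ) ≤ w i := by
  classical
  obtain ⟨z, hz, z', hz', h₁, h₀, heq, hmin⟩ := hw
  obtain ⟨y, hy, y', hy', k₁, k₀, keq, kmin⟩ := hw'
  have split (v : I → Fin M) (u : I → Fin 2) : weight v u =
      (v i : ℕ) * (u i : ℕ) + ∑ j ∈ Finset.univ.erase i, (v j : ℕ) * (u j : ℕ) :=
    (Finset.add_sum_erase _ _ (Finset.mem_univ i)).symm
  have same (u : I → Fin 2) : ∑ j ∈ Finset.univ.erase i, (w j : ℕ) * (u j : ℕ) =
      ∑ j ∈ Finset.univ.erase i, (w' j : ℕ) * (u j : ℕ) :=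
    Finset.sum_congr rfl fun j hj => by rw [h j (Finset.ne_of_mem_erase hj)]
  have e₁ := hmin y hy
  have e₂ := kmin z' hz'
  simp only [split, same, h₁, h₀, k₁, k₀, Fin.val_one, Fin.val_zero, mul_one, mul_zero, zero_add]
    at e₁ e₂ heq keq
  omega

-- Overwriting the value at `i` is injective on pairs of an ambiguous weight and a new value,
-- because the lost value is determined by the others. Hence a fraction of at most `1 / M` of all
-- weights is ambiguous at `i`.
open Classical in
theorem card_ambiguous_mul_le {M : ℕ} (S : Set (I → Fin 2)) (i : I) :
    (Finset.univ.filter fun w : I → Fin M => Ambiguous S i w).card * M ≤ M ^ Fintype.card I := by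
  have hcard : (Finset.univ : Finset (I → Fin M)).card = M ^ Fintype.card I := by
    simp [Finset.card_univ]
  rw [← hcard]
  calc _ = ((Finset.univ.filter fun w : I → Fin M => Ambiguous S i w) ×ˢ
        (Finset.univ : Finset (Fin M))).card := by simp [Finset.card_product]
    _ ≤ _ := ?_
  refine Finset.card_le_card_of_injOn (fun p => Function.update p.1 i p.2) (by simp) ?_
  rintro ⟨w, a⟩ hw ⟨w', a'⟩ hw' h
  simp only [Finset.coe_product, Finset.coe_filter, Finset.mem_univ, true_and, Set.mem_prod,
    Set.mem_ofPred_eq, Finset.coe_univ, Set.mem_univ, and_true] at hw hw'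
  have hoff : ∀ j ≠ i, w j = w' j := fun j hj => by
    simpa [Function.update_of_ne hj] using congrFun h j
  have ha : a = a' := by simpa using congrFun h i
  have hon : w i = w' i := Fin.ext (le_antisymm (hw'.apply_le hw fun j hj => (hoff j hj).symm)
    (hw.apply_le hw' hoff))
  have : w = w' := funext fun j => by
    by_cases hj : j = i
    · rw [hj, hon]
    · exact hoff j hj
  rw [this, ha]

open Classical in
/-- At least half of all weights isolate a given nonempty set. -/
theorem card_not_isolates_le {S : Set (I → Fin 2)} (hS : S.Nonempty) :
    2 * (Finset.univ.filter fun w : I → Fin (2 * Fintype.card I + 1) => ¬ Isolates w S).card ≤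
      Fintype.card (I → Fin (2 * Fintype.card I + 1)) := by
  -- Union bound over the coordinates: the failing fraction is at most `|I| / M`, which this `M`
  -- makes smaller than one half.
  set M := 2 * Fintype.card I + 1
  have h₁ : (Finset.univ.filter fun w : I → Fin M => ¬ Isolates w S).card ≤
      ∑ i, (Finset.univ.filter fun w : I → Fin M => Ambiguous S i w).card := by
    refine (Finset.card_le_card fun w hw => ?_).trans Finset.card_biUnion_le
    obtain ⟨i, hi⟩ := exists_ambiguous hS (Finset.mem_filter.1 hw).2
    exact Finset.mem_biUnion.2 ⟨i, Finset.mem_univ i, by simpa using hi⟩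
  have h₂ : (∑ i, (Finset.univ.filter fun w : I → Fin M => Ambiguous S i w).card) * M ≤
      Fintype.card I * M ^ Fintype.card I := by
    rw [Finset.sum_mul]
    exact (Finset.sum_le_card_nsmul _ _ _ fun i _ => card_ambiguous_mul_le S i).trans (by simp)
  rw [Fintype.card_fun, Fintype.card_fin]
  refine Nat.le_of_mul_le_mul_right (c := M) ?_ (by omega)
  calc _ = 2 * ((Finset.univ.filter fun w : I → Fin M => ¬ Isolates w S).card * M) := by ring
    _ ≤ 2 * (Fintype.card I * M ^ Fintype.card I) :=
      Nat.mul_le_mul_left _ ((Nat.mul_le_mul_right _ h₁).trans h₂)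
    _ = (2 * Fintype.card I) * M ^ Fintype.card I := by ring
    _ ≤ M * M ^ Fintype.card I := Nat.mul_le_mul_right _ (by omega)
    _ = _ := mul_comm _ _

/-- Few weights isolate all members of a small family of nonempty sets. -/
theorem exists_isolating_weights {E : Type*} (S : E → Set (I → Fin 2)) (m : ℕ) (T : Finset E)
    (hT : T.card < 2 ^ m) (hS : ∀ ε ∈ T, (S ε).Nonempty) :
    ∃ w : Fin m → I → Fin (2 * Fintype.card I + 1), ∀ ε ∈ T, ∃ i, Isolates (w i) (S ε) := by
  classical
  induction m generalizing T with
  | zero =>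
    obtain rfl : T = ∅ := Finset.card_eq_zero.1 (by simpa using hT)
    exact ⟨Fin.elim0, by simp⟩
  | succ m ih =>
    set W := I → Fin (2 * Fintype.card I + 1)
    -- Averaging: each set is missed by at most half of the weights, so some weight misses at most
    -- half of the sets. The induction goes on with the missed ones, fewer than `2 ^ m`.
    have key : ∃ w : W, 2 * (T.filter fun ε => ¬ Isolates w (S ε)).card ≤ T.card := by
      by_contra! h
      have h₁ : ∑ w : W, (T.card + 1) ≤ ∑ w : W, 2 * (T.filter fun ε => ¬ Isolates w (S ε)).card :=
        Finset.sum_le_sum fun w _ => h w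
      have h₂ : ∑ w : W, 2 * (T.filter fun ε => ¬ Isolates w (S ε)).card =
          ∑ ε ∈ T, 2 * (Finset.univ.filter fun w : W => ¬ Isolates w (S ε)).card := by
        simp only [Finset.card_filter, Finset.mul_sum]
        exact Finset.sum_comm
      have h₃ : ∑ ε ∈ T, 2 * (Finset.univ.filter fun w : W => ¬ Isolates w (S ε)).card ≤
          T.card * Fintype.card W :=
        (Finset.sum_le_card_nsmul _ _ _ fun ε hε => card_not_isolates_le (hS ε hε)).trans (by simp [W])
      rw [h₂] at h₁
      have h₄ := h₁.trans h₃
      simp only [Finset.sum_const, Finset.card_univ, smul_eq_mul] at h₄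
      have h₅ : 0 < Fintype.card W := Fintype.card_pos
      nlinarith
    obtain ⟨w, hw⟩ := key
    obtain ⟨w', hw'⟩ := ih (T.filter fun ε => ¬ Isolates w (S ε)) (by rw [pow_succ] at hT; omega)
      fun ε hε => hS ε (Finset.mem_filter.1 hε).1
    refine ⟨Fin.cons w w', fun ε hε => ?_⟩
    by_cases h : Isolates w (S ε)
    · exact ⟨0, h⟩
    · obtain ⟨i, hi⟩ := hw' ε (Finset.mem_filter.2 ⟨hε, h⟩)
      exact ⟨i.succ, by simpa using hi⟩

end Isolation

/-! ### Membership in `VNP` -/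

namespace HasFormula

variable {K σ ρ : Type} [CommSemiring K] {n m : ℕ}

theorem rename (φ : σ → ρ) {f : MvPolynomial σ K} (h : HasFormula n f) :
    HasFormula n (MvPolynomial.rename φ f) := by
  induction h with
  | var x => simpa using var (φ x)
  | const c => simpa using const c
  | add _ _ h₁ h₂ => simpa using h₁.add h₂
  | mul _ _ h₁ h₂ => simpa using h₁.mul h₂
  | mono _ h ih => exact ih.mono h

theorem sub {K σ : Type} [CommRing K] {n m : ℕ} {f g : MvPolynomial σ K} (hf : HasFormula n f)
    (hg : HasFormula m g) : HasFormula (n + m + 3) (f - g) := by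
  have h := hf.add ((const (-1 : K)).mul hg)
  rw [C_neg, C_1, neg_one_mul, ← sub_eq_add_neg] at h
  exact h.mono (by omega)

theorem one : HasFormula 1 (1 : MvPolynomial σ K) := by simpa using const (σ := σ) (1 : K)

end HasFormula

/-- The evaluation of the auxiliary variables of `g` at a 0-1 vector. -/
noncomputable def evalBits {K σ β : Type} [CommSemiring K] (ε : β → Fin 2) :
    MvPolynomial (σ ⊕ β) K →ₐ[K] MvPolynomial σ K :=
  aeval (Sum.elim X fun j => C ((ε j : ℕ) : K))

/-- Auxiliary bits may be indexed by any finite type; they are renumbered by `Fin`. -/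
theorem inVNP_of_sum_evalBits {σ β : ℕ → Type} [∀ n, Finite (σ n)] [∀ n, Fintype (β n)]
    [∀ n, DecidableEq (β n)]
    {f : ∀ n, MvPolynomial (σ n) ℚ} (g : ∀ n, MvPolynomial (σ n ⊕ β n) ℚ) (s : ℕ → ℕ)
    (hσ : PolyBounded fun n => Nat.card (σ n)) (hβ : PolyBounded fun n => Fintype.card (β n))
    (hs : PolyBounded s) (hdeg : PolyBounded fun n => (f n).totalDegree)
    (hg : ∀ n, HasFormula (s n) (g n)) (hf : ∀ n, f n = ∑ ε : β n → Fin 2, evalBits ε (g n)) :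
    InVNP f := by
  classical
  let e n : β n ≃ Fin (Fintype.card (β n)) := Fintype.equivFin (β n)
  have hg' n : HasFormula (s n) (rename (Sum.map id (e n)) (g n)) := (hg n).rename _
  refine ⟨⟨inferInstance, hσ, hdeg⟩, fun n => Fintype.card (β n),
    fun n => rename (Sum.map id (e n)) (g n), ⟨⟨fun n => inferInstance, ?_, ?_⟩, s, hs, ?_⟩, ?_⟩
  · simpa [Nat.card_sum] using hσ.add hβ
  · exact hs.mono fun n => (hg' n).totalDegree_le
  · exact fun n => (hg' n).exists_circuit
  · intro n
    rw [hf n]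
    refine Fintype.sum_equiv ((e n).arrowCongr (Equiv.refl _)) _ _ fun ε => ?_
    rw [aeval_rename, evalBits]
    refine congrArg (fun v => aeval v (g n)) (funext fun x => ?_)
    rcases x with x | x
    · rfl
    · simp

/-! ### Existential quantifiers as sums over bits, by isolation. -/

section Projection

variable {E I : Type} [Fintype E] [Fintype I] [DecidableEq E] [DecidableEq I]

/-- The size of the formula obtained by isolation from a formula of size `s` for an
existentially quantified condition with `i` quantified bits and `e` free bits. -/
def isolationSize (e i s : ℕ) : ℕ :=
  (1 + ((e + 1) * (i * (2 * i + 1) + 1) * (1 + (s + ((i * (2 * i + 1) + 1) *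
    (1 + (i * (5 + 1) + 1) + 1 + 1) + 1) + 1) + 3 + 1) + 1) + 3) + (e * (11 + 1) + 1) + 1

theorem evalBits_comp_rename {σ β γ : Type} (ε : β → Fin 2) (ρ : γ → β) (P : MvPolynomial γ ℚ) :
    evalBits (σ := σ) ε (rename (Sum.inr ∘ ρ) P) = C (eval (fun x => ((ε (ρ x) : ℕ) : ℚ)) P) := by
  rw [evalBits, aeval_rename]
  exact aeval_algebraMap_apply (MvPolynomial σ ℚ) (fun x => ((ε (ρ x) : ℕ) : ℚ)) P

open Classical in
/-- Numbers of solutions of prescribed weights determine whether there is a solution. -/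
theorem prod_one_sub_count {m K M : ℕ} (S : Set (I → Fin 2)) (w : Fin m → I → Fin M)
    (hK : Fintype.card I * M ≤ K) (hw : S.Nonempty → ∃ i, Isolates (w i) S) :
    ∏ t : Fin m × Fin (K + 1), (1 - ∑ z : I → Fin 2,
      if z ∈ S ∧ weight (w t.1) z = t.2 then (1 : ℚ) else 0) = if S.Nonempty then 0 else 1 := by
  split_ifs with h
  · obtain ⟨i, k, z, ⟨hz, hk⟩, huniq⟩ := hw h
    have hkK : k < K + 1 := by
      have := weight_le (w i) z
      omega
    refine Finset.prod_eq_zero (Finset.mem_univ (i, ⟨k, hkK⟩)) ?_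
    rw [Finset.sum_eq_single z]
    · simp [hz, hk]
    · intro y _ hy
      exact if_neg fun hc => hy (huniq y hc)
    · simp
  · refine Finset.prod_eq_one fun t _ => ?_
    rw [Finset.sum_eq_zero, sub_zero]
    intro z _
    exact if_neg fun hc => h ⟨z, hc.1⟩

/-- Spreads the constant 1 evenly over all `z`, so that `1 - ∑ q` becomes one sum over bits and a
product of such factors one sum over independent copies of `z`. -/
theorem sum_half_pow (I : Type) [Fintype I] [DecidableEq I] (q : (I → Fin 2) → ℚ) :
    ∑ z : I → Fin 2, ((2⁻¹ : ℚ) ^ Fintype.card I - q z) = 1 - ∑ z, q z := by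
  rw [Finset.sum_sub_distrib]
  simp

-- If some weight isolates a witness, one factor `1 - count` vanishes; if there is no witness, every
-- factor is 1. One minus the product is therefore the truth value of `∃ z, R ε z`. The auxiliary
-- bits hold `ε` and, for each pair of a weighting and a weight, a separate copy of `z`.
open Classical in
theorem exists_isolation_formula (R : (E → Fin 2) → (I → Fin 2) → Prop)
    (P : MvPolynomial (E ⊕ I) ℚ) (s : ℕ) (hP : HasFormula s P)
    (hR : ∀ ε z, eval (Sum.elim (fun e => ((ε e : ℕ) : ℚ)) fun i => ((z i : ℕ) : ℚ)) P =
      if R ε z then 1 else 0) :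
    ∃ g : MvPolynomial (E ⊕ (E ⊕ (Fin (Fintype.card E + 1) ×
        Fin (Fintype.card I * (2 * Fintype.card I + 1) + 1)) × I)) ℚ,
      HasFormula (isolationSize (Fintype.card E) (Fintype.card I) s) g ∧
      ∑ ε : E → Fin 2, (if ∃ z, R ε z then 1 else 0) * ∏ e, X e ^ (ε e : ℕ) =
        ∑ ε, evalBits ε g := by
  set M := 2 * Fintype.card I + 1 with hM
  set K := Fintype.card I * M with hK
  set m := Fintype.card E + 1 with hm
  obtain ⟨w, hw⟩ := exists_isolating_weights (fun ε => {z | R ε z}) m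
    (Finset.univ.filter fun ε : E → Fin 2 => ∃ z, R ε z)
    ((Finset.card_le_univ _).trans_lt (by
      rw [Fintype.card_fun, Fintype.card_fin]
      exact Nat.pow_lt_pow_right (by omega) (Nat.lt_succ_self _)))
    (fun ε hε => (Finset.mem_filter.1 hε).2)
  choose c hc using exists_interpolation_weights K
  let T := Fin m × Fin (K + 1)
  let zv (t : T) (i : I) : MvPolynomial (E ⊕ (E ⊕ T × I)) ℚ := X (.inr (.inr (t, i)))
  let ev (e : E) : MvPolynomial (E ⊕ (E ⊕ T × I)) ℚ := X (.inr (.inl e))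
  -- At bits `z`, the product over `i` is `(j + 1) ^ weight`; the interpolation weights make the sum
  -- the indicator of weight `t.2`.
  let wt (t : T) : MvPolynomial (E ⊕ (E ⊕ T × I)) ℚ := ∑ j : Fin (K + 1), C (c t.2 j) *
    ∏ i, (1 + C (((j : ℚ) + 1) ^ (w t.1 i : ℕ) - 1) * zv t i)
  let ρ (t : T) : E ⊕ I → E ⊕ T × I := Sum.map id fun i => (t, i)
  let Q (t : T) : MvPolynomial (E ⊕ (E ⊕ T × I)) ℚ := rename (Sum.inr ∘ ρ t) P * wt t
  -- The constant is `2 ^ (-|I||T|)`, which adds up to 1 over all copies of `z`.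
  let G : MvPolynomial (E ⊕ (E ⊕ T × I)) ℚ :=
    C (((2⁻¹ : ℚ) ^ Fintype.card I) ^ Fintype.card T) -
      ∏ t, (C ((2⁻¹ : ℚ) ^ Fintype.card I) - Q t)
  -- At a bit, `1 - ε + ε x` equals `x ^ ε`.
  let F : MvPolynomial (E ⊕ (E ⊕ T × I)) ℚ := ∏ e, (1 - ev e + ev e * X (.inl e))
  have hwt (t : T) : HasFormula ((K + 1) * (1 + (Fintype.card I * (5 + 1) + 1) + 1 + 1) + 1)
      (wt t) := by
    have := HasFormula.sum (s := Finset.univ) (n := 1 + (Fintype.card I * (5 + 1) + 1) + 1)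
      (f := fun j : Fin (K + 1) => C (c t.2 j) *
        ∏ i, (1 + C (((j : ℚ) + 1) ^ (w t.1 i : ℕ) - 1) * zv t i)) fun j _ =>
      (HasFormula.const _).mul (HasFormula.prod (n := 5) fun i _ =>
        (HasFormula.one.add ((HasFormula.const _).mul (HasFormula.var _))))
    rwa [Finset.card_univ, Fintype.card_fin] at this
  have hG : HasFormula (1 + (m * (K + 1) * (1 + (s + ((K + 1) *
      (1 + (Fintype.card I * (5 + 1) + 1) + 1 + 1) + 1) + 1) + 3 + 1) + 1) + 3) G := by
    have := (HasFormula.const (σ := E ⊕ (E ⊕ T × I))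
      (((2⁻¹ : ℚ) ^ Fintype.card I) ^ Fintype.card T)).sub
      (HasFormula.prod (s := Finset.univ) (f := fun t : T => C ((2⁻¹ : ℚ) ^ Fintype.card I) - Q t)
      fun t _ => (HasFormula.const _).sub ((hP.rename _).mul (hwt t)))
    simpa [T, G] using this
  have hF : HasFormula (Fintype.card E * (11 + 1) + 1) F := by
    have := HasFormula.prod (s := Finset.univ) (n := 11)
      (f := fun e : E => (1 - ev e + ev e * X (.inl e) : MvPolynomial (E ⊕ (E ⊕ T × I)) ℚ))
      fun e _ => ((HasFormula.one.sub (HasFormula.var _)).add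
        ((HasFormula.var _).mul (HasFormula.var _))).mono (by omega)
    simpa using this
  refine ⟨G * F, hG.mul hF, ?_⟩
  let q (ε : E → Fin 2) (t : T) (z : I → Fin 2) : ℚ :=
    if z ∈ {z | R ε z} ∧ weight (w t.1) z = t.2 then 1 else 0
  have hQe (ε : E ⊕ T × I → Fin 2) (t : T) : evalBits ε (Q t) =
      C (q (ε ∘ Sum.inl) t fun i => ε (.inr (t, i))) := by
    have h₁ : evalBits (σ := E) ε (rename (Sum.inr ∘ ρ t) P) =
        C (if R (ε ∘ Sum.inl) fun i => ε (.inr (t, i)) then 1 else 0) := by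
      rw [evalBits_comp_rename, ← hR]
      congr 3
      funext x
      rcases x with x | x <;> rfl
    have h₂ : evalBits (σ := E) ε (wt t) =
        C (if weight (w t.1) (fun i => ε (.inr (t, i))) = t.2 then 1 else 0) := by
      rw [← hc t.2 _ (weight_le (w t.1) _)]
      simp only [wt, zv, evalBits, map_sum, map_mul, map_prod, map_add, map_one, algHom_C,
        algebraMap_eq, aeval_X, Sum.elim_inr]
      refine Finset.sum_congr rfl fun j _ => ?_
      rw [weight, ← Finset.prod_pow_eq_pow_sum, map_prod]
      congr 1
      refine Finset.prod_congr rfl fun i _ => ?_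
      rw [← C_mul, ← C_1, ← C_add]
      congr 1
      rcases Fin.exists_fin_two.1 ⟨ε (.inr (t, i)), rfl⟩ with h | h <;> simp [h]
    rw [map_mul, h₁, h₂, ← C_mul]
    refine congrArg C ?_
    simp only [q, Set.mem_ofPred_eq, ite_and, ite_mul, one_mul, zero_mul]
  have hGe (ε : E ⊕ T × I → Fin 2) : evalBits ε G =
      C (((2⁻¹ : ℚ) ^ Fintype.card I) ^ Fintype.card T - ∏ t, ((2⁻¹ : ℚ) ^ Fintype.card I -
        q (ε ∘ Sum.inl) t fun i => ε (.inr (t, i)))) := by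
    simp only [G, map_sub, map_prod, hQe, algHom_C, algebraMap_eq]
  have hFe (ε : E ⊕ T × I → Fin 2) : evalBits ε F = ∏ e, X e ^ (ε (.inl e) : ℕ) := by
    simp only [F, ev, evalBits, map_prod, map_add, map_sub, map_mul, map_one, aeval_X,
      Sum.elim_inr, Sum.elim_inl]
    refine Finset.prod_congr rfl fun e _ => ?_
    rcases Fin.exists_fin_two.1 ⟨ε (.inl e), rfl⟩ with h | h <;> simp [h]
  have hsum (ε : E → Fin 2) : ∑ Z : T → I → Fin 2, (((2⁻¹ : ℚ) ^ Fintype.card I) ^ Fintype.card T -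
      ∏ t, ((2⁻¹ : ℚ) ^ Fintype.card I - q ε t (Z t))) = if ∃ z, R ε z then 1 else 0 := by
    rw [Finset.sum_sub_distrib, ← Fintype.piFinset_univ,
      ← Finset.prod_univ_sum (fun _ => Finset.univ)
        (fun t z => (2⁻¹ : ℚ) ^ Fintype.card I - q ε t z)]
    simp only [sum_half_pow]
    rw [prod_one_sub_count {z | R ε z} w le_rfl fun h => hw ε (by simpa [Set.Nonempty] using h)]
    have hone : ∑ _Z : T → I → Fin 2, ((2⁻¹ : ℚ) ^ Fintype.card I) ^ Fintype.card T = 1 := by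
      rw [Finset.sum_const, Finset.card_univ, Fintype.card_fun, Fintype.card_fun, Fintype.card_fin,
        nsmul_eq_mul, Nat.cast_pow, Nat.cast_pow, ← mul_pow, ← mul_pow]
      norm_num
    rw [Fintype.piFinset_univ, hone]
    by_cases h : ∃ z, R ε z
    · rw [if_pos (show {z | R ε z}.Nonempty from h), if_pos h, sub_zero]
    · rw [if_neg (show ¬ {z | R ε z}.Nonempty from h), if_neg h, sub_self]
  rw [← (Equiv.sumArrowEquivProdArrow E (T × I) (Fin 2)).symm.sum_comp, Fintype.sum_prod_type]
  refine Finset.sum_congr rfl fun ε _ => ?_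
  rw [← (Equiv.curry T I (Fin 2)).symm.sum_comp]
  have := congrArg (C (σ := E)) (hsum ε)
  rw [map_sum] at this
  simp only [map_mul, hGe, hFe, Equiv.sumArrowEquivProdArrow, Equiv.curry, Equiv.coe_fn_symm_mk,
    Sum.elim_inl, Sum.elim_inr, Sum.elim_comp_inl, Function.uncurry_apply_pair, ← Finset.sum_mul]
  congr 1
  rw [this]
  split_ifs <;> simp

end Projection

/-! ### Homomorphism polynomials are in `VNP` -/

section HomPolynomial

theorem prod_ite_one_zero {ι : Type*} [Fintype ι] (p : ι → Prop) [∀ i, Decidable (p i)]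
    [Decidable (∀ i, p i)] :
    ∏ i, (if p i then (1 : ℚ) else 0) = if ∀ i, p i then 1 else 0 := by
  rw [Finset.prod_boole]
  exact if_congr (by simp) rfl rfl

theorem card_completeEdge_le (n : ℕ) : Fintype.card (CompleteEdge n) ≤ n * n := by
  rw [← Nat.card_eq_fintype_card]
  refine (Nat.card_le_card_of_injective (fun e : CompleteEdge n => (e : Sym2 (Fin n)))
    Subtype.val_injective).trans ?_
  have := Nat.card_le_card_of_surjective (fun p : Fin n × Fin n => s(p.1, p.2))
    (fun e => by induction e using Sym2.ind with | _ a b => exact ⟨(a, b), rfl⟩)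
  simpa using this

variable {α β : Type*}

theorem totalDegree_homPolynomial_le (H : Graph α β) (n : ℕ) :
    (homPolynomial ℚ H n).totalDegree ≤ n * n := by
  classical
  refine (totalDegree_finsetSum_le fun ε _ => ?_).trans (card_completeEdge_le n)
  refine (totalDegree_mul _ _).trans ?_
  have h₁ : (if IsHomomorphicTo (graphOfIndicator ε) H then 1 else 0 :
      MvPolynomial (CompleteEdge n) ℚ).totalDegree = 0 := by
    split_ifs <;> simp
  rw [h₁, zero_add]
  refine (totalDegree_finsetProd _ _).trans ((Finset.sum_le_card_nsmul _ _ 1 fun e _ => ?_).trans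
    (by simp))
  refine (totalDegree_pow _ _).trans ?_
  rw [totalDegree_X, mul_one]
  exact Nat.le_of_lt_succ (ε e).2

theorem isPFamily_homPolynomial (H : Graph α β) : IsPFamily fun n => homPolynomial ℚ H n :=
  ⟨fun n => inferInstance,
    (PolyBounded.id.mul .id).mono fun n => by
      rw [Nat.card_eq_fintype_card]; exact card_completeEdge_le n,
    (PolyBounded.id.mul .id).mono fun n => totalDegree_homPolynomial_le H n⟩

theorem graphOfIndicator_adj {n : ℕ} (ε : CompleteEdge n → Fin 2) {u v : Fin n} (h : u ≠ v) :
    (graphOfIndicator ε).Adj u v ↔ ε ⟨s(u, v), by simpa using h⟩ = 1 := by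
  simp [graphOfIndicator, h]

/-- The 0-1 matrix `z` describes for each vertex of `K_n` a nonempty set of vertices of `H`, such
that vertices chosen for endpoints of an edge selected by `ε` are adjacent. -/
def IsMultiHom (H : Graph α β) {n q : ℕ} (vert : Fin q → α) (ε : CompleteEdge n → Fin 2)
    (z : Fin n × Fin q → Fin 2) : Prop :=
  (∀ v, ∃ a, z (v, a) = 1) ∧ ∀ (e : CompleteEdge n) (u v : Fin n) (a b : Fin q),
    (e : Sym2 (Fin n)) = s(u, v) → ¬ H.Adj (vert a) (vert b) →
      ¬ (ε e = 1 ∧ z (u, a) = 1 ∧ z (v, b) = 1)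

/-- Any selection from the nonempty sets is a homomorphism, so no clause requiring unique images is
needed. Several witnesses for one homomorphism do no harm, since only existence matters. -/
theorem exists_isMultiHom_iff (H : Graph α β) {n q : ℕ} {vert : Fin q → α}
    (hvert : Set.range vert = V(H)) (ε : CompleteEdge n → Fin 2) :
    (∃ z, IsMultiHom H vert ε z) ↔ IsHomomorphicTo (graphOfIndicator ε) H := by
  classical
  constructor
  · rintro ⟨z, hz, hadj⟩
    choose a ha using hz
    refine ⟨fun v => vert (a v), fun v => hvert ▸ Set.mem_range_self _, fun u v huv => ?_⟩
    have hne := huv.ne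
    rw [graphOfIndicator_adj ε hne] at huv
    by_contra hc
    exact hadj _ u v (a u) (a v) rfl hc ⟨huv, ha u, ha v⟩
  · rintro ⟨φ, hφ, hadj⟩
    have : ∀ v, ∃ a, vert a = φ v := fun v => by
      have := hφ v
      rwa [← hvert] at this
    choose a ha using this
    refine ⟨fun p => if a p.1 = p.2 then 1 else 0, fun v => ⟨a v, by simp⟩, ?_⟩
    rintro e u v b c he hbc ⟨h₁, h₂, h₃⟩
    have hb : a u = b := by by_contra h; simp [h] at h₂
    have hc : a v = c := by by_contra h; simp [h] at h₃
    subst hb hc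
    have hne : u ≠ v := by
      have := e.2
      rw [he] at this
      simpa using this
    rw [ha, ha] at hbc
    refine hbc (hadj u v ((graphOfIndicator_adj ε hne).2 ?_))
    convert h₁
    exact he.symm

-- Arithmetization of the clauses: a product of factors, each the 0-1 value of one clause.
open Classical in
theorem exists_isMultiHom_formula (H : Graph α β) {n q : ℕ} (vert : Fin q → α) :
    ∃ P : MvPolynomial (CompleteEdge n ⊕ Fin n × Fin q) ℚ,
      HasFormula ((n * (1 + (q * (5 + 1) + 1) + 3 + 1) + 1) +
        (n * n * (n * (n * (q * q))) * (9 + 1) + 1) + 1) P ∧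
      ∀ (ε : CompleteEdge n → Fin 2) (z : Fin n × Fin q → Fin 2),
        eval (Sum.elim (fun e => ((ε e : ℕ) : ℚ)) fun i => ((z i : ℕ) : ℚ)) P =
          if IsMultiHom H vert ε z then 1 else 0 := by
  let y (v : Fin n) (a : Fin q) : MvPolynomial (CompleteEdge n ⊕ Fin n × Fin q) ℚ := X (.inr (v, a))
  let P₁ : MvPolynomial (CompleteEdge n ⊕ Fin n × Fin q) ℚ := ∏ v, (1 - ∏ a, (1 - y v a))
  let f (p : CompleteEdge n × Fin n × Fin n × Fin q × Fin q) :
      MvPolynomial (CompleteEdge n ⊕ Fin n × Fin q) ℚ :=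
    if (p.1 : Sym2 (Fin n)) = s(p.2.1, p.2.2.1) ∧ ¬ H.Adj (vert p.2.2.2.1) (vert p.2.2.2.2) then
      1 - X (.inl p.1) * (y p.2.1 p.2.2.2.1 * y p.2.2.1 p.2.2.2.2) else 1
  have h₁ : HasFormula (n * (1 + (q * (5 + 1) + 1) + 3 + 1) + 1) P₁ := by
    have := HasFormula.prod (s := Finset.univ) (f := fun v => (1 - ∏ a, (1 - y v a))) fun v _ =>
      HasFormula.one.sub (HasFormula.prod (s := Finset.univ) fun a _ =>
        HasFormula.one.sub (HasFormula.var _))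
    simpa [P₁] using this
  have h₂ : HasFormula (n * n * (n * (n * (q * q))) * (9 + 1) + 1) (∏ p, f p) := by
    refine (HasFormula.prod (n := 9) fun p _ => ?_).mono ?_
    · simp only [f]
      split_ifs
      · exact (HasFormula.one.sub ((HasFormula.var _).mul
          ((HasFormula.var _).mul (HasFormula.var _)))).mono (by omega)
      · exact HasFormula.one.mono (by omega)
    · rw [Finset.card_univ]
      simp only [Fintype.card_prod, Fintype.card_fin]
      gcongr
      exact card_completeEdge_le n
  refine ⟨P₁ * ∏ p, f p, h₁.mul h₂, fun ε z => ?_⟩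
  have hz (x : Fin 2) : (1 : ℚ) - ((x : ℕ) : ℚ) = if x = 0 then 1 else 0 := by
    rcases Fin.exists_fin_two.1 ⟨x, rfl⟩ with h | h <;> simp [h]
  have e₁ : eval (Sum.elim (fun e => ((ε e : ℕ) : ℚ)) fun i => ((z i : ℕ) : ℚ)) P₁ =
      if ∀ v, ∃ a, z (v, a) = 1 then 1 else 0 := by
    simp only [P₁, y, map_prod, map_sub, map_one, eval_X, Sum.elim_inr, hz, Finset.prod_boole,
      Finset.mem_univ, true_implies]
    refine (Finset.prod_congr rfl fun v _ => ?_).trans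
      (prod_ite_one_zero fun v => ∃ a, z (v, a) = 1)
    by_cases h : ∃ a, z (v, a) = 1
    · rw [if_pos h, if_neg, sub_zero]
      obtain ⟨a, ha⟩ := h
      exact fun h => by simpa [ha] using h a
    · rw [if_neg h, if_pos, sub_self]
      exact fun a => by
        by_contra hc
        exact h ⟨a, by omega⟩
  have e₂ : eval (Sum.elim (fun e => ((ε e : ℕ) : ℚ)) fun i => ((z i : ℕ) : ℚ)) (∏ p, f p) =
      if ∀ (e : CompleteEdge n) (u v : Fin n) (a b : Fin q),
        (e : Sym2 (Fin n)) = s(u, v) → ¬ H.Adj (vert a) (vert b) →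
          ¬ (ε e = 1 ∧ z (u, a) = 1 ∧ z (v, b) = 1) then 1 else 0 := by
    have hf : ∀ p, eval (Sum.elim (fun e => ((ε e : ℕ) : ℚ)) fun i => ((z i : ℕ) : ℚ)) (f p) =
        if (p.1 : Sym2 (Fin n)) = s(p.2.1, p.2.2.1) → ¬ H.Adj (vert p.2.2.2.1) (vert p.2.2.2.2) →
          ¬ (ε p.1 = 1 ∧ z (p.2.1, p.2.2.2.1) = 1 ∧ z (p.2.2.1, p.2.2.2.2) = 1)
          then 1 else 0 := by
      intro p
      simp only [f]
      split_ifs with h h' h'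
      · have := h' h.1 h.2
        rcases Fin.exists_fin_two.1 ⟨ε p.1, rfl⟩ with k₁ | k₁ <;>
        rcases Fin.exists_fin_two.1 ⟨z (p.2.1, p.2.2.2.1), rfl⟩ with k₂ | k₂ <;>
        rcases Fin.exists_fin_two.1 ⟨z (p.2.2.1, p.2.2.2.2), rfl⟩ with k₃ | k₃ <;>
        simp_all [y]
      · push Not at h'
        simp [y, h'.2.2.1, h'.2.2.2.1, h'.2.2.2.2]
      · simp
      · exact absurd (fun h₁ h₂ => absurd ⟨h₁, h₂⟩ h) h'
    simp only [map_prod, hf, Fintype.prod_boole, Prod.forall]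
  rw [map_mul, e₁, e₂]
  by_cases h : ∀ v, ∃ a, z (v, a) = 1
  · rw [if_pos h, one_mul]
    exact if_congr ⟨fun k => ⟨h, k⟩, And.right⟩ rfl rfl
  · rw [if_neg h, zero_mul, if_neg fun k => h k.1]

theorem inVNP_homPolynomial (H : Graph α β) (hH : V(H).Finite) :
    InVNP fun n => homPolynomial ℚ H n := by
  classical
  obtain ⟨q, vert, -, hvert⟩ := hH.fin_param
  have hvert : Set.range vert = V(H) := hvert
  choose P hP hPe using fun n => exists_isMultiHom_formula H (n := n) vert
  choose g hg hge using fun n => exists_isolation_formula _ (P n) _ (hP n) (hPe n)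
  have hp := isPFamily_homPolynomial H
  have hN : PolyBounded fun n => Fintype.card (CompleteEdge n) := by
    simpa [Nat.card_eq_fintype_card] using hp.2.1
  refine inVNP_of_sum_evalBits g _ hp.2.1 ?_ ?_ hp.2.2 hg fun n => ?_
  · simp only [Fintype.card_sum, Fintype.card_prod, Fintype.card_fin]
    repeat first
      | exact hN
      | exact .const _
      | exact .id
      | refine .add ?_ ?_
      | refine .mul ?_ ?_
  · simp only [isolationSize, Fintype.card_prod, Fintype.card_fin]
    repeat first
      | exact hN
      | exact .const _
      | exact .id
      | refine .add ?_ ?_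
      | refine .mul ?_ ?_
  · rw [← hge, homPolynomial]
    refine Finset.sum_congr rfl fun ε _ => ?_
    simp only [exists_isMultiHom_iff H hvert]

end HomPolynomial

/-! ### The easy cases: `VAC₀` -/

section VACZero

theorem List.foldr_max_zero_le {l : List ℕ} {d : ℕ} (h : ∀ x ∈ l, x ≤ d) : l.foldr max 0 ≤ d := by
  induction l with
  | nil => simp
  | cons a l ih =>
    simp only [List.foldr_cons, max_le_iff]
    exact ⟨h a (by simp), ih fun x hx => h x (by simp [hx])⟩

/-- The depth-two circuit for a product of factors `1 + x`. -/
def prodOneAddCircuit {E : Type} {N : ℕ} (e : Fin N → E) : UnboundedCircuit ℚ E where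
  numGates := 2 * N + 2
  gate i :=
    -- Positions below `N` hold the variables, `N` the constant 1, `N + 1` to `2 * N` the sums, and
    -- `2 * N + 1` their product.
    if h : (i : ℕ) < N then .var (e ⟨i, h⟩)
    else if h₁ : (i : ℕ) = N then .const 1
    else if h₂ : (i : ℕ) < 2 * N + 1 then .add [⟨N, by omega⟩, ⟨i - (N + 1), by omega⟩]
    else .mul ((List.finRange N).map fun j : Fin N => ⟨(j : ℕ) + (N + 1), by omega⟩)
  output := ⟨2 * N + 1, by omega⟩

variable {E : Type} {N : ℕ} (e : Fin N → E)

theorem prodOneAddCircuit_computes :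
    (prodOneAddCircuit e).Computes (∏ i, (1 + X (e i))) := by
  have hvar (i : ℕ) (h : i < N) : (prodOneAddCircuit e).value ⟨i, by simp [prodOneAddCircuit]; omega⟩ =
      X (e ⟨i, h⟩) := by
    unfold UnboundedCircuit.value
    simp [prodOneAddCircuit, h]
  have hone : (prodOneAddCircuit e).value ⟨N, by simp [prodOneAddCircuit]; omega⟩ = 1 := by
    unfold UnboundedCircuit.value
    simp [prodOneAddCircuit]
  have hadd (i : ℕ) (h : i < N) :
      (prodOneAddCircuit e).value ⟨i + (N + 1), by simp [prodOneAddCircuit]; omega⟩ =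
        1 + X (e ⟨i, h⟩) := by
    have h₁ : ¬ i + (N + 1) < N := by omega
    have h₂ : ¬ i + (N + 1) = N := by omega
    have h₃ : i + (N + 1) < 2 * N + 1 := by omega
    rw [← hone, ← hvar i h]
    conv_lhs => unfold UnboundedCircuit.value
    simp [prodOneAddCircuit, h₁, h₂, h₃]
  have h₁ : ¬ 2 * N + 1 < N := by omega
  have h₂ : ¬ 2 * N + 1 = N := by omega
  rw [UnboundedCircuit.Computes, Finset.prod_congr rfl fun (i : Fin N) _ => (hadd i i.2).symm]
  conv_lhs => unfold UnboundedCircuit.value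
  simp [prodOneAddCircuit, h₁, h₂, List.prod_ofFn, ← List.ofFn_eq_map, Function.comp_def]

theorem prodOneAddCircuit_depth_le : (prodOneAddCircuit e).depth ≤ 2 := by
  have hleaf (i : ℕ) (h : i ≤ N) (hi : i < (prodOneAddCircuit e).numGates) :
      (prodOneAddCircuit e).gateDepth ⟨i, hi⟩ = 0 := by
    unfold UnboundedCircuit.gateDepth
    rcases h.lt_or_eq with h | h <;> simp [prodOneAddCircuit, h]
  have hadd (i : ℕ) (h : i < 2 * N + 1) (hi : i < (prodOneAddCircuit e).numGates) :
      (prodOneAddCircuit e).gateDepth ⟨i, hi⟩ ≤ 1 := by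
    rcases le_or_gt i N with h' | h'
    · rw [hleaf i h']; omega
    · have h₁ : ¬ i < N := by omega
      have h₂ : ¬ i = N := by omega
      have k₁ := hleaf N le_rfl (by simp [prodOneAddCircuit]; omega)
      have k₂ := hleaf (i - (N + 1)) (by omega) (by simp [prodOneAddCircuit]; omega)
      have hg : (prodOneAddCircuit e).gate ⟨i, hi⟩ =
          .add [⟨N, h'⟩, ⟨i - (N + 1), by simp; omega⟩] := by
        simp [prodOneAddCircuit, h₁, h₂, h]
      unfold UnboundedCircuit.gateDepth
      rw [hg]
      simp [k₁, k₂]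
  refine Finset.sup_le fun i _ => ?_
  rcases lt_or_ge (i : ℕ) (2 * N + 1) with h | h
  · exact (hadd i h i.2).trans (by omega)
  · have h₀ : ¬ (i : ℕ) < N := by omega
    have h₁ : ¬ (i : ℕ) = N := by omega
    have h₂ : ¬ (i : ℕ) < 2 * N + 1 := by omega
    unfold UnboundedCircuit.gateDepth
    have hg : (prodOneAddCircuit e).gate i =
        .mul ((List.finRange N).map fun j : Fin N => ⟨(j : ℕ) + (N + 1), by omega⟩) := by
      simp [prodOneAddCircuit, h₀, h₁, h₂]
    rw [hg]
    refine Nat.succ_le_succ (List.foldr_max_zero_le fun x hx => ?_)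
    obtain ⟨a, ha, rfl⟩ := List.mem_map.1 hx
    obtain ⟨j, -, rfl⟩ := List.mem_map.1 ha
    exact hadd _ (by simp; omega) _

theorem prodOneAddCircuit_size_le :
    (prodOneAddCircuit e).size ≤ (2 * N + 2) + (2 * N + 2) * (N + 2) := by
  refine Nat.add_le_add_left ((Finset.sum_le_card_nsmul _ _ (N + 2) fun i _ => ?_).trans ?_) _
  · simp only [prodOneAddCircuit]
    split_ifs <;> simp [UnboundedGate.children]
  · rw [Finset.card_univ, smul_eq_mul]
    exact Nat.mul_le_mul_right _ (Fintype.card_fin _).le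

variable {α β : Type*} (H : Graph α β)

/-- The constant map to the looped vertex is a homomorphism from every graph. -/
theorem homPolynomial_eq_prod {e : β} {v : α} (h : H.IsLoopAt e v) (n : ℕ) :
    homPolynomial ℚ H n = ∏ e : CompleteEdge n, (1 + X e) := by
  classical
  have hhom (ε : CompleteEdge n → Fin 2) : IsHomomorphicTo (graphOfIndicator ε) H :=
    ⟨fun _ => v, fun _ => h.vertex_mem, fun _ _ _ => ⟨e, h⟩⟩
  simp only [homPolynomial, hhom, if_true, one_mul]
  have : ∀ e : CompleteEdge n, (1 + X e : MvPolynomial (CompleteEdge n) ℚ) =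
      ∑ i : Fin 2, X e ^ (i : ℕ) := fun e => by simp [Fin.sum_univ_two]
  rw [Finset.prod_congr rfl fun e _ => this e, Finset.prod_univ_sum, Fintype.piFinset_univ]

-- Only the empty graph can map to an edgeless `H`. The constant is 0 if `H` has no vertices and `n`
-- is positive.
open Classical in
theorem homPolynomial_eq_ite (hE : E(H) = ∅) (n : ℕ) :
    homPolynomial ℚ H n =
      C (if IsHomomorphicTo (graphOfIndicator (0 : CompleteEdge n → Fin 2)) H then 1 else 0) := by
  rw [homPolynomial, Finset.sum_eq_single 0]
  · split_ifs <;> simp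
  · intro ε _ hε
    rw [if_neg, zero_mul]
    rintro ⟨φ, -, hadj⟩
    obtain ⟨⟨e, he⟩, hne⟩ := Function.ne_iff.1 hε
    induction e using Sym2.ind with | _ u v =>
    have huv : u ≠ v := by simpa using he
    obtain ⟨b, hb⟩ := hadj u v ((graphOfIndicator_adj ε huv).2 (by
      have := Fin.exists_fin_two.1 ⟨ε ⟨s(u, v), he⟩, rfl⟩
      exact this.resolve_left hne))
    exact (Set.mem_empty_iff_false b).1 (hE ▸ hb.edge_mem)
  · simp

theorem inVAC0_homPolynomial (h : (∃ e v, H.IsLoopAt e v) ∨ E(H) = ∅) :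
    InVAC0 fun n => homPolynomial ℚ H n := by
  classical
  have hp := isPFamily_homPolynomial H
  rcases h with ⟨e, v, h⟩ | h
  · have hN : PolyBounded fun n => Fintype.card (CompleteEdge n) := by
      simpa [Nat.card_eq_fintype_card] using hp.2.1
    refine ⟨hp, 2, fun n => (2 * Fintype.card (CompleteEdge n) + 2) +
      (2 * Fintype.card (CompleteEdge n) + 2) * (Fintype.card (CompleteEdge n) + 2), ?_,
      fun n => ⟨prodOneAddCircuit (Fintype.equivFin (CompleteEdge n)).symm,
        prodOneAddCircuit_depth_le _, prodOneAddCircuit_size_le _, ?_⟩⟩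
    · repeat first
        | exact hN
        | exact .const _
        | refine .add ?_ ?_
        | refine .mul ?_ ?_
    · dsimp only
      rw [homPolynomial_eq_prod H h n, ← (Fintype.equivFin (CompleteEdge n)).symm.prod_comp]
      exact prodOneAddCircuit_computes _
  · refine ⟨hp, 0, fun _ => 1, .const 1, fun n => ⟨⟨1, fun _ => .const
      (if IsHomomorphicTo (graphOfIndicator (0 : CompleteEdge n → Fin 2)) H then 1 else 0), 0⟩,
      ?_, ?_, ?_⟩⟩
    · refine Finset.sup_le fun i _ => ?_
      unfold UnboundedCircuit.gateDepth
      simp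
    · simp [UnboundedCircuit.size, UnboundedGate.children]
    · dsimp only
      rw [homPolynomial_eq_ite H h n, UnboundedCircuit.Computes]
      unfold UnboundedCircuit.value
      rfl

end VACZero

/-! ### Derivations of an acyclic polynomial system as 0-1 vectors -/

section Derivations

/-- A 0-1 vector of sum 0 is zero and one of sum 1 is a unit vector. For larger `n` bits cannot
record repeated choices, which is why demands must be kept at most one. -/
theorem sum_bits_card_eq {J A : Type*} [Fintype J] [DecidableEq J] [CommSemiring A] (a : J → A)
    {n : ℕ} (hn : n ≤ 1) :
    ∑ c : J → Fin 2, (if ∑ j, (c j : ℕ) = n then ∏ j, a j ^ (c j : ℕ) else 0) = (∑ j, a j) ^ n := by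
  rw [← Finset.sum_filter]
  rcases Nat.le_one_iff_eq_zero_or_eq_one.1 hn with rfl | rfl
  · have : (Finset.univ.filter fun c : J → Fin 2 => ∑ j, (c j : ℕ) = 0) = {0} := by
      ext c
      simp [Finset.sum_eq_zero_iff, funext_iff]
    rw [this]
    simp
  · have : (Finset.univ.filter fun c : J → Fin 2 => ∑ j, (c j : ℕ) = 1) =
        Finset.univ.image fun j => Pi.single j 1 := by
      ext c
      simp only [Finset.mem_filter, Finset.mem_univ, true_and, Finset.mem_image]
      constructor
      · intro h
        obtain ⟨j, -, hj⟩ := Finset.exists_ne_zero_of_sum_ne_zero (h ▸ one_ne_zero)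
        have h₂ := (c j).2
        rw [← Finset.add_sum_erase _ _ (Finset.mem_univ j)] at h
        have h₀ : ∑ i ∈ Finset.univ.erase j, (c i : ℕ) = 0 := by omega
        refine ⟨j, funext fun i => ?_⟩
        by_cases hi : i = j
        · subst hi
          rw [Pi.single_eq_same]
          refine Fin.ext ?_
          rw [Fin.val_one]
          omega
        · rw [Pi.single_eq_of_ne hi]
          exact (Fin.ext (Finset.sum_eq_zero_iff.1 h₀ i (by simp [hi]))).symm
      · rintro ⟨j, rfl⟩
        rw [Finset.sum_eq_single j (fun i _ hi => by simp [hi]) (by simp)]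
        simp
    rw [this, Finset.sum_image]
    · rw [pow_one]
      refine Finset.sum_congr rfl fun j _ => ?_
      rw [Finset.prod_eq_single j (fun i _ hi => by simp [hi]) (by simp)]
      simp
    · intro i _ j _ h
      by_contra hij
      have := congrFun h i
      simp [hij] at this

theorem sum_bits_forall_card_eq {Y J A : Type*} [Fintype Y] [DecidableEq Y] [Fintype J]
    [DecidableEq J] [CommSemiring A] (a : Y → J → A) {n : Y → ℕ} (hn : ∀ y, n y ≤ 1) :
    ∑ c : Y → J → Fin 2, (if ∀ y, ∑ j, (c y j : ℕ) = n y then ∏ y, ∏ j, a y j ^ (c y j : ℕ) else 0) =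
      ∏ y, (∑ j, a y j) ^ n y := by
  rw [Finset.prod_congr rfl fun y _ => (sum_bits_card_eq (a y) (hn y)).symm, Finset.prod_univ_sum,
    Fintype.piFinset_univ]
  refine Finset.sum_congr rfl fun c _ => ?_
  by_cases h : ∀ y, ∑ j, (c y j : ℕ) = n y
  · rw [if_pos h]
    exact Finset.prod_congr rfl fun y _ => (if_pos (h y)).symm
  · rw [if_neg h]
    obtain ⟨y, hy⟩ := not_forall.1 h
    exact (Finset.prod_eq_zero (Finset.mem_univ y) (if_neg hy)).symm

/-- Let values `V` be given by polynomial expressions `V h y = ∑ j, lam h y j * ∏ V ^ cnt h y j` in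
values at larger positions. If the variables carry positive loads in such a way that
productions do not increase loads, then a monomial in the values of load at most one is the sum over
the 0-1 vectors that select for each demanded value one production. -/
theorem sum_derivations {Y J P A : Type*} [Fintype Y] [DecidableEq Y] [Fintype J] [DecidableEq J]
    [CommSemiring A] (L : ℕ) (lam : Fin L → Y → J → A) (cnt : Fin L → Y → J → Fin L → Y → ℕ)
    (V : Fin L → Y → A) (inc : P → Fin L → Y → ℕ)
    (hcnt : ∀ h y j h' y', ¬ h < h' → cnt h y j h' y' = 0)
    (hV : ∀ h y, V h y = ∑ j, lam h y j * ∏ h', ∏ y', V h' y' ^ cnt h y j h' y')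
    (hpos : ∀ h y, ∃ p, 1 ≤ inc p h y)
    (hinc : ∀ p h y j, ∑ h', ∑ y', cnt h y j h' y' * inc p h' y' ≤ inc p h y)
    (n : Fin L → Y → ℕ) (hn : ∀ p, ∑ h, ∑ y, n h y * inc p h y ≤ 1) :
    ∑ u : Fin L → Y → J → Fin 2,
      (if ∀ h y, ∑ j, (u h y j : ℕ) = n h y + ∑ h', ∑ y', ∑ j, (u h' y' j : ℕ) * cnt h' y' j h y
        then ∏ h, ∏ y, ∏ j, lam h y j ^ (u h y j : ℕ) else 0) =
      ∏ h, ∏ y, V h y ^ n h y := by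
  induction L with
  | zero => simp
  | succ L ih =>
    have h0 (h : Fin (L + 1)) (y : Y) (j : J) (y' : Y) : cnt h y j 0 y' = 0 :=
      hcnt _ _ _ _ _ (Fin.not_lt_zero h)
    have hV' (h : Fin (L + 1)) (y : Y) : V h y =
        ∑ j, lam h y j * ∏ h' : Fin L, ∏ y', V h'.succ y' ^ cnt h y j h'.succ y' := by
      rw [hV]
      simp only [Fin.prod_univ_succ, h0, pow_zero, Finset.prod_const_one, one_mul]
    have hinc' (p : P) (h : Fin (L + 1)) (y : Y) (j : J) :
        ∑ h' : Fin L, ∑ y', cnt h y j h'.succ y' * inc p h'.succ y' ≤ inc p h y := by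
      refine le_trans ?_ (hinc p h y j)
      rw [Fin.sum_univ_succ]
      exact Nat.le_add_left _ _
    -- The demands on later positions once `u₀` has served position `0`. Productions do not increase
    -- loads, so the bound by one passes to `n'`.
    let n' (u₀ : Y → J → Fin 2) (h : Fin L) (y : Y) : ℕ :=
      n h.succ y + ∑ y', ∑ j, (u₀ y' j : ℕ) * cnt 0 y' j h.succ y
    -- A variable of positive load at some `p` cannot be demanded twice within load one.
    have hn1 (y : Y) : n 0 y ≤ 1 := by
      obtain ⟨p, hp⟩ := hpos 0 y
      calc n 0 y ≤ n 0 y * inc p 0 y := Nat.le_mul_of_pos_right _ hp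
        _ ≤ ∑ y, n 0 y * inc p 0 y :=
          Finset.single_le_sum (f := fun y => n 0 y * inc p 0 y) (fun _ _ => Nat.zero_le _)
            (Finset.mem_univ y)
        _ ≤ ∑ h, ∑ y, n h y * inc p h y :=
          Finset.single_le_sum (f := fun h => ∑ y, n h y * inc p h y) (fun _ _ => Nat.zero_le _)
            (Finset.mem_univ 0)
        _ ≤ 1 := hn p
    have step (u₀ : Y → J → Fin 2) (hu : ∀ y, ∑ j, (u₀ y j : ℕ) = n 0 y) :=
      ih (fun h => lam h.succ) (fun h y j h' => cnt h.succ y j h'.succ) (fun h => V h.succ)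
        (fun p h => inc p h.succ)
        (fun h y j h' y' hh => hcnt _ _ _ _ _ (by simpa using hh))
        (fun h y => hV' h.succ y) (fun h y => hpos h.succ y) (fun p h y j => hinc' p h.succ y j)
        (n' u₀) (fun p => by
          refine le_trans ?_ (hn p)
          have e : ∑ h : Fin L, ∑ y, (∑ y', ∑ j, (u₀ y' j : ℕ) * cnt 0 y' j h.succ y) *
              inc p h.succ y = ∑ y', ∑ j, (u₀ y' j : ℕ) *
                ∑ h : Fin L, ∑ y, cnt 0 y' j h.succ y * inc p h.succ y := by
            simp only [Finset.sum_mul, Finset.mul_sum, mul_assoc]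
            rw [Finset.sum_congr rfl fun h _ => Finset.sum_comm, Finset.sum_comm]
            refine Finset.sum_congr rfl fun y' _ => ?_
            rw [Finset.sum_congr rfl fun h _ => Finset.sum_comm, Finset.sum_comm]
          simp only [n', add_mul, Finset.sum_add_distrib, e]
          rw [Fin.sum_univ_succ, add_comm]
          refine Nat.add_le_add_right ?_ _
          refine Finset.sum_le_sum fun y _ => ?_
          rw [← hu y, Finset.sum_mul]
          exact Finset.sum_le_sum fun j _ => Nat.mul_le_mul_left _ (hinc' p 0 y j))
    have hprod (u₀ : Y → J → Fin 2) : ∏ h : Fin L, ∏ y, V h.succ y ^ n' u₀ h y =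
        (∏ h : Fin L, ∏ y, V h.succ y ^ n h.succ y) *
          ∏ y, ∏ j, (∏ h : Fin L, ∏ y', V h.succ y' ^ cnt 0 y j h.succ y') ^ (u₀ y j : ℕ) := by
      simp only [n', pow_add, Finset.prod_mul_distrib, ← Finset.prod_pow_eq_pow_sum,
        ← Finset.prod_pow]
      congr 1
      rw [Finset.prod_congr rfl fun h _ => Finset.prod_comm, Finset.prod_comm]
      refine Finset.prod_congr rfl fun y' _ => ?_
      rw [Finset.prod_congr rfl fun h _ => Finset.prod_comm, Finset.prod_comm]
      refine Finset.prod_congr rfl fun j _ => Finset.prod_congr rfl fun h _ =>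
        Finset.prod_congr rfl fun y _ => ?_
      rw [← pow_mul, mul_comm]
    rw [← (Fin.consEquiv fun _ => Y → J → Fin 2).sum_comp, Fintype.sum_prod_type]
    have main (u₀ : Y → J → Fin 2) : ∑ u : Fin L → Y → J → Fin 2,
        (if ∀ h y, ∑ j, (Fin.consEquiv (fun _ => Y → J → Fin 2) (u₀, u) h y j : ℕ) = n h y +
          ∑ h', ∑ y', ∑ j, (Fin.consEquiv (fun _ => Y → J → Fin 2) (u₀, u) h' y' j : ℕ) *
            cnt h' y' j h y
        then ∏ h, ∏ y, ∏ j, lam h y j ^ (Fin.consEquiv (fun _ => Y → J → Fin 2) (u₀, u) h y j : ℕ)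
        else 0) =
        (∏ h : Fin L, ∏ y, V h.succ y ^ n h.succ y) * if ∀ y, ∑ j, (u₀ y j : ℕ) = n 0 y then
          ∏ y, ∏ j, (lam 0 y j * ∏ h : Fin L, ∏ y', V h.succ y' ^ cnt 0 y j h.succ y') ^ (u₀ y j : ℕ)
          else 0 := by
      simp only [Fin.forall_fin_succ, Fin.consEquiv_apply, Fin.cons_zero, Fin.cons_succ, h0,
        mul_zero, Finset.sum_const_zero, add_zero, Fin.prod_univ_succ, Fin.sum_univ_succ, ite_and]
      split_ifs with hu
      · simp only [mul_pow, Finset.prod_mul_distrib]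
        rw [mul_left_comm, ← hprod, ← step u₀ hu, Finset.mul_sum]
        refine Finset.sum_congr rfl fun u _ => ?_
        rw [mul_ite, mul_zero]
        simp only [n', add_assoc]
      · simp
    simp only [main]
    rw [← Finset.mul_sum, sum_bits_forall_card_eq _ hn1, Fin.prod_univ_succ, mul_comm]
    congr 1
    exact Finset.prod_congr rfl fun y _ => by rw [hV' 0 y]

end Derivations

/-! ### Homogeneous components of the values of a straight-line program -/

theorem homogeneousComponent_mul {σ R : Type*} [CommSemiring R] (f g : MvPolynomial σ R) (n : ℕ) :
    homogeneousComponent n (f * g) =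
      ∑ p ∈ Finset.HasAntidiagonal.antidiagonal n,
        homogeneousComponent p.1 f * homogeneousComponent p.2 g := by
  classical
  ext d
  simp only [coeff_homogeneousComponent, coeff_sum, coeff_mul]
  rw [Finset.sum_comm]
  split_ifs with h
  · refine Finset.sum_congr rfl fun x hx => ?_
    have hd : x.1.degree + x.2.degree = n := by
      rw [← map_add, Finset.HasAntidiagonal.mem_antidiagonal.1 hx, h]
    rw [Finset.sum_eq_single (x.1.degree, x.2.degree)]
    · simp
    · rintro ⟨i, j⟩ - hne
      by_cases hi : x.1.degree = i
      · by_cases hj : x.2.degree = j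
        · exact absurd (by rw [hi, hj]) hne
        · simp [hj]
      · simp [hi]
    · simp [hd]
  · symm
    refine Finset.sum_eq_zero fun x hx => Finset.sum_eq_zero fun p hp => ?_
    have hd : x.1.degree + x.2.degree ≠ n := by
      rwa [← map_add, Finset.HasAntidiagonal.mem_antidiagonal.1 hx]
    have hp := Finset.HasAntidiagonal.mem_antidiagonal.1 hp
    by_cases hi : x.1.degree = p.1
    · rw [if_neg (c := x.2.degree = p.2), mul_zero]
      omega
    · rw [if_neg hi, zero_mul]

/-- The cyclic interval of length `e` contains, without overlap, its first `j` positions and the `e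
- j` that follow; `q` is the position relative to its start. This keeps the two factors of a product
from competing for a position. -/
theorem cyclic_interval_split {D : ℕ} (q j e : Fin D) (hj : j ≤ e) :
    (if (q : ℕ) < j then 1 else 0) + (if ((q - j : Fin D) : ℕ) < (e - j : Fin D) then 1 else 0) ≤
      if (q : ℕ) < e then 1 else 0 := by
  have hq := q.2
  have he := e.2
  rw [Fin.sub_val_of_le hj]
  have hj' : (j : ℕ) ≤ e := hj
  rcases le_or_gt j q with h | h
  · rw [Fin.sub_val_of_le h]
    have h' : (j : ℕ) ≤ q := h
    split_ifs <;> omega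
  · rw [Fin.coe_sub_iff_lt.2 h]
    have h' : (q : ℕ) < j := h
    split_ifs <;> omega

/-! ### Homogeneous components at cyclic offsets as an acyclic system. -/

section DegreeSystem

variable {τ : Type} {L D : ℕ} [NeZero D]

/-- A demand for the degree `j` component of value `a` at offset `k`; constants are free. -/
def demand (a : Fin L) (j k : Fin D) (h : Fin L) (y : Fin D × Fin D) : ℕ :=
  if j ≠ 0 ∧ h = a ∧ y = (j, k) then 1 else 0

/-- The constant contributed by a component of degree `0`. -/
noncomputable def freeCoeff (v : Fin L → MvPolynomial τ ℚ) (a : Fin L) (j : Fin D) : ℚ :=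
  if j = 0 then coeff 0 (v a) else 1

/-- The weight of the production `j` for the component of degree `y.1` of the value computed by an
instruction. -/
noncomputable def prodWeight (v : Fin L → MvPolynomial τ ℚ) (r : Instr ℚ τ L)
    (y : Fin D × Fin D) (j : Fin D) : MvPolynomial τ ℚ :=
  match r with
  | .var x => if (y.1 : ℕ) = 1 ∧ j = 0 then X x else C 0
  | .const c => if y.1 = 0 ∧ j = 0 then C c else C 0
  | .add a b => if (j : ℕ) = 0 then C (freeCoeff v a y.1) else
      if (j : ℕ) = 1 then C (freeCoeff v b y.1) else C 0
  | .mul a b => if j ≤ y.1 then C (freeCoeff v a j * freeCoeff v b (y.1 - j)) else C 0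

/-- The demands of the production `j` for the component of degree `y.1` at offset `y.2` of the value
computed by an instruction. -/
def prodDemand (r : Instr ℚ τ L) (y : Fin D × Fin D) (j : Fin D) (h : Fin L)
    (y' : Fin D × Fin D) : ℕ :=
  match r with
  | .var _ => 0
  | .const _ => 0
  | .add a b => if (j : ℕ) = 0 then demand a y.1 y.2 h y' else
      if (j : ℕ) = 1 then demand b y.1 y.2 h y' else 0
  | .mul a b => if j ≤ y.1 then demand a j y.2 h y' + demand b (y.1 - j) (y.2 + j) h y' else 0

/-- The component of degree `y.1` at offset `y.2` occupies the positions of a cyclic interval. -/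
def load (p : Fin D) (y : Fin D × Fin D) : ℕ :=
  -- An interval of length 0 would carry no load, but `sum_derivations` needs a positive one. The
  -- value 1 is harmless, as no production demands a component of degree 0.
  if y.1 = 0 then 1 else if ((p - y.2 : Fin D) : ℕ) < y.1 then 1 else 0

theorem sum_demand_mul_load (a : Fin L) (j k p : Fin D) :
    ∑ h, ∑ y, demand a j k h y * load p y = if ((p - k : Fin D) : ℕ) < j then 1 else 0 := by
  by_cases hj : j = 0
  · simp [demand, hj]
  · rw [Finset.sum_eq_single a, Finset.sum_eq_single (j, k)]
    · simp [demand, load, hj]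
    · intro y _ hy
      simp [demand, hy]
    · simp
    · intro h _ hh
      simp [demand, hh]
    · simp

/-- In degree 0 the coefficient is the whole component and the demand is empty; in positive degree
it is the other way round. Constants may therefore be reused freely. -/
theorem freeCoeff_mul_prod_demand (v : Fin L → MvPolynomial τ ℚ) (a : Fin L) (j k : Fin D) :
    C (freeCoeff v a j) * ∏ h, ∏ y : Fin D × Fin D,
      homogeneousComponent (y.1 : ℕ) (v h) ^ demand a j k h y =
      homogeneousComponent (j : ℕ) (v a) := by
  by_cases hj : j = 0
  · simp [demand, hj, freeCoeff]
  · rw [Finset.prod_eq_single a, Finset.prod_eq_single (j, k)]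
    · simp [demand, freeCoeff, hj]
    · intro y _ hy
      simp [demand, hy]
    · simp
    · intro h _ hh
      simp [demand, hh]
    · simp

theorem demand_le_one (a : Fin L) (j k : Fin D) (h : Fin L) (y : Fin D × Fin D) :
    demand a j k h y ≤ 1 := by
  unfold demand
  split_ifs <;> omega

theorem prodDemand_le_two (r : Instr ℚ τ L) (y : Fin D × Fin D) (j : Fin D) (h : Fin L)
    (y' : Fin D × Fin D) : prodDemand r y j h y' ≤ 2 := by
  cases r with
  | var x => simp [prodDemand]
  | const c => simp [prodDemand]
  | add a b =>
    have := demand_le_one a y.1 y.2 h y'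
    have := demand_le_one b y.1 y.2 h y'
    simp only [prodDemand]
    split_ifs <;> omega
  | mul a b =>
    have := demand_le_one a j y.2 h y'
    have := demand_le_one b (y.1 - j) (y.2 + j) h y'
    simp only [prodDemand]
    split_ifs <;> omega

theorem prodDemand_eq_zero {v : Fin L → MvPolynomial τ ℚ} {i : Fin L} {r : Instr ℚ τ L}
    (hr : r.Produces v i) (y : Fin D × Fin D) (j : Fin D) {h : Fin L} (hih : ¬ i < h)
    (y' : Fin D × Fin D) : prodDemand r y j h y' = 0 := by
  cases r with
  | var x => rfl
  | const c => rfl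
  | add a b =>
    have ha : h ≠ a := fun e => hih (e ▸ hr.1)
    have hb : h ≠ b := fun e => hih (e ▸ hr.2.1)
    simp [prodDemand, demand, ha, hb]
  | mul a b =>
    have ha : h ≠ a := fun e => hih (e ▸ hr.1)
    have hb : h ≠ b := fun e => hih (e ▸ hr.2.1)
    simp [prodDemand, demand, ha, hb]

theorem sum_prodDemand_mul_load_le (r : Instr ℚ τ L) (y : Fin D × Fin D) (j p : Fin D) :
    ∑ h, ∑ y', prodDemand r y j h y' * load p y' ≤ load p y := by
  have key : (if ((p - y.2 : Fin D) : ℕ) < y.1 then 1 else 0) ≤ load p y := by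
    unfold load
    split_ifs <;> simp_all
  cases r with
  | var x => simp [prodDemand]
  | const c => simp [prodDemand]
  | add a b =>
    simp only [prodDemand]
    split_ifs
    · rwa [sum_demand_mul_load]
    · rwa [sum_demand_mul_load]
    · simp
  | mul a b =>
    simp only [prodDemand]
    split_ifs with hj
    · simp only [add_mul, Finset.sum_add_distrib]
      rw [sum_demand_mul_load, sum_demand_mul_load, ← sub_sub]
      exact (cyclic_interval_split _ _ _ hj).trans key
    · simp

/-- For a sum, productions 0 and 1 select the summand; for a product, production `j` gives degree
`j` to the first factor and shifts the offset of the second by `j`. The offset does not affect the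
value. -/
theorem homogeneousComponent_eq_sum_prod (hD : 2 ≤ D) {v : Fin L → MvPolynomial τ ℚ} {i : Fin L}
    {r : Instr ℚ τ L} (hr : r.Produces v i) (y : Fin D × Fin D) :
    homogeneousComponent (y.1 : ℕ) (v i) = ∑ j, prodWeight v r y j * ∏ h, ∏ y' : Fin D × Fin D,
      homogeneousComponent (y'.1 : ℕ) (v h) ^ prodDemand r y j h y' := by
  classical
  cases r with
  | var x =>
    have hx : homogeneousComponent (y.1 : ℕ) (v i) = if (y.1 : ℕ) = 1 then X x else 0 := by
      rw [show v i = X x from hr]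
      exact homogeneousComponent_of_mem (isHomogeneous_X ℚ x)
    rw [hx, Finset.sum_eq_single 0]
    · simp [prodWeight, prodDemand]
    · intro j _ hj
      simp [prodWeight, hj]
    · simp
  | const c =>
    have hx : homogeneousComponent (y.1 : ℕ) (v i) = if y.1 = 0 then C c else 0 := by
      rw [show v i = C c from hr, homogeneousComponent_of_mem (isHomogeneous_C τ c)]
      exact if_congr (Fin.ext_iff (b := (0 : Fin D))).symm rfl rfl
    rw [hx, Finset.sum_eq_single 0]
    · simp [prodWeight, prodDemand]
    · intro j _ hj
      simp [prodWeight, hj]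
    · simp
  | add a b =>
    have h01 : (⟨0, by omega⟩ : Fin D) ≠ ⟨1, by omega⟩ := by simp
    rw [show v i = v a + v b from hr.2.2, map_add, Finset.sum_eq_add_of_mem ⟨0, by omega⟩ ⟨1, by omega⟩
      (Finset.mem_univ _) (Finset.mem_univ _) h01]
    · rw [← freeCoeff_mul_prod_demand v a y.1 y.2, ← freeCoeff_mul_prod_demand v b y.1 y.2]
      simp [prodWeight, prodDemand]
    · rintro j - ⟨h0, h1⟩
      have h0 : (j : ℕ) ≠ 0 := fun h => h0 (Fin.ext h)
      have h1 : (j : ℕ) ≠ 1 := fun h => h1 (Fin.ext h)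
      simp [prodWeight, h0, h1]
  | mul a b =>
    have hy := y.1.2
    have hfull : ∀ j : Fin D, prodWeight v (.mul a b) y j * ∏ h, ∏ y' : Fin D × Fin D,
        homogeneousComponent (y'.1 : ℕ) (v h) ^ prodDemand (.mul a b : Instr ℚ τ L) y j h y' =
        if (j : ℕ) ≤ y.1 then
          homogeneousComponent (j : ℕ) (v a) * homogeneousComponent ((y.1 : ℕ) - j) (v b) else 0 := by
      intro j
      by_cases hj : j ≤ y.1
      · have h₂ := freeCoeff_mul_prod_demand v b (y.1 - j) (y.2 + j)
        rw [Fin.sub_val_of_le hj] at h₂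
        have hj' : (j : ℕ) ≤ y.1 := hj
        rw [if_pos hj', ← h₂, ← freeCoeff_mul_prod_demand v a j y.2]
        simp only [prodWeight, prodDemand, if_pos hj, pow_add, Finset.prod_mul_distrib, C_mul]
        ring
      · have hj' : ¬ (j : ℕ) ≤ y.1 := hj
        simp only [prodWeight, if_neg hj, if_neg hj', C_0, zero_mul]
    rw [show v i = v a * v b from hr.2.2, homogeneousComponent_mul,
      Finset.Nat.sum_antidiagonal_eq_sum_range_succ_mk, Finset.sum_congr rfl fun j _ => hfull j,
      Fin.sum_univ_eq_sum_range (fun j => if j ≤ (y.1 : ℕ) then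
        homogeneousComponent j (v a) * homogeneousComponent ((y.1 : ℕ) - j) (v b) else 0),
      ← Finset.sum_filter]
    refine Finset.sum_congr ?_ fun _ _ => rfl
    ext j
    simp only [Finset.mem_range, Finset.mem_filter]
    omega

theorem prodWeight_eq (v : Fin L → MvPolynomial τ ℚ) (r : Instr ℚ τ L)
    (y : Fin D × Fin D) (j : Fin D) :
    (∃ c, prodWeight v r y j = C c) ∨ ∃ x, prodWeight v r y j = X x := by
  cases r with
  | var x =>
    simp only [prodWeight]
    split_ifs
    · exact .inr ⟨x, rfl⟩
    · exact .inl ⟨0, rfl⟩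
  | const c =>
    simp only [prodWeight]
    split_ifs <;> exact .inl ⟨_, rfl⟩
  | add a b =>
    simp only [prodWeight]
    split_ifs <;> exact .inl ⟨_, rfl⟩
  | mul a b =>
    simp only [prodWeight]
    split_ifs <;> exact .inl ⟨_, rfl⟩

/-- The initial demand is the single component of degree `e` of the output at offset 0, whose load
is at most one everywhere. -/
theorem homogeneousComponent_eq_sum_derivations (hD : 2 ≤ D) {v : Fin L → MvPolynomial τ ℚ}
    {r : Fin L → Instr ℚ τ L} (hr : ∀ i, (r i).Produces v i) (o : Fin L) (e : Fin D) :
    homogeneousComponent (e : ℕ) (v o) = ∑ u : Fin L → Fin D × Fin D → Fin D → Fin 2,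
      if ∀ h y, ∑ j, (u h y j : ℕ) = (if h = o ∧ y = (e, 0) then 1 else 0) +
        ∑ h', ∑ y', ∑ j, (u h' y' j : ℕ) * prodDemand (r h') y' j h y
      then ∏ h, ∏ y, ∏ j, prodWeight v (r h) y j ^ (u h y j : ℕ) else 0 := by
  rw [sum_derivations L (fun h => prodWeight v (r h)) (fun h => prodDemand (r h))
    (fun h y => homogeneousComponent (y.1 : ℕ) (v h)) (fun p _ => load p)
    (fun h y j h' y' hh => prodDemand_eq_zero (hr h) y j hh y')
    (fun h y => homogeneousComponent_eq_sum_prod hD (hr h) y) ?_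
    (fun p h y j => sum_prodDemand_mul_load_le (r h) y j p)
    (fun h y => if h = o ∧ y = (e, 0) then 1 else 0)]
  · rw [Finset.prod_eq_single o, Finset.prod_eq_single (e, 0)]
    · simp
    · intro y _ hy
      simp [hy]
    · simp
    · intro h _ hh
      simp [hh]
    · simp
  · intro p
    rw [Finset.sum_eq_single o, Finset.sum_eq_single (e, 0)]
    · simp only [load, and_self, if_true, one_mul]
      split_ifs <;> omega
    · intro y _ hy
      simp [hy]
    · simp
    · intro h _ hh
      simp [hh]
    · simp
  · intro _ y
    refine ⟨y.2, ?_⟩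
    unfold load
    split_ifs with h₁ h₂
    · exact le_rfl
    · exact le_rfl
    · rw [sub_self, Fin.val_zero] at h₂
      exact absurd (Nat.pos_of_ne_zero fun h => h₁ (Fin.ext h)) h₂

end DegreeSystem

/-! ### Weighted sums over zeros of quadratic forms in bits -/

section BitForms

variable {ι ι' : Type} [Fintype ι] [Fintype ι']

/-- An integer affine form in bits. -/
def IsAffineForm (A : (ι → Fin 2) → ℤ) : Prop :=
  ∃ (a : ℤ) (l : ι → ℤ), ∀ c, A c = a + ∑ i, l i * (c i : ℕ)

/-- An integer quadratic form in bits. -/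
def IsQuadraticForm (Q : (ι → Fin 2) → ℤ) : Prop :=
  ∃ (a : ℤ) (q : ι → ι → ℤ), ∀ c, Q c = a + ∑ i, ∑ j, q i j * ((c i : ℕ) * (c j : ℕ))

namespace IsAffineForm

theorem const (a : ℤ) : IsAffineForm fun _ : ι → Fin 2 => a := ⟨a, 0, by simp⟩

theorem bit (i : ι) : IsAffineForm fun c : ι → Fin 2 => ((c i : ℕ) : ℤ) := by
  classical
  exact ⟨0, fun j => if j = i then 1 else 0, by simp⟩

theorem add {A B : (ι → Fin 2) → ℤ} (hA : IsAffineForm A) (hB : IsAffineForm B) :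
    IsAffineForm fun c => A c + B c := by
  obtain ⟨a, l, h⟩ := hA
  obtain ⟨b, m, k⟩ := hB
  refine ⟨a + b, fun i => l i + m i, fun c => ?_⟩
  simp only [h, k, add_mul, Finset.sum_add_distrib]
  ring

theorem const_mul {A : (ι → Fin 2) → ℤ} (b : ℤ) (hA : IsAffineForm A) :
    IsAffineForm fun c => b * A c := by
  obtain ⟨a, l, h⟩ := hA
  refine ⟨b * a, fun i => b * l i, fun c => ?_⟩
  simp only [h, mul_add, Finset.mul_sum, mul_assoc]

theorem sub {A B : (ι → Fin 2) → ℤ} (hA : IsAffineForm A) (hB : IsAffineForm B) :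
    IsAffineForm fun c => A c - B c := by
  simpa [sub_eq_add_neg] using hA.add (hB.const_mul (-1))

theorem sum {κ : Type*} (s : Finset κ) {A : κ → (ι → Fin 2) → ℤ} (hA : ∀ k, IsAffineForm (A k)) :
    IsAffineForm fun c => ∑ k ∈ s, A k c := by
  classical
  induction s using Finset.induction_on with
  | empty => simpa using const 0
  | insert k s hk ih => simpa [Finset.sum_insert hk] using (hA k).add ih

theorem mul {A B : (ι → Fin 2) → ℤ} (hA : IsAffineForm A) (hB : IsAffineForm B) :
    IsQuadraticForm fun c => A c * B c := by
  classical
  obtain ⟨a, l, h⟩ := hA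
  obtain ⟨b, m, k⟩ := hB
  -- Bits are idempotent, so linear terms are moved to the diagonal.
  refine ⟨a * b, fun i j => l i * m j + if i = j then a * m i + b * l i else 0, fun c => ?_⟩
  have hsq (i : ι) : (((c i : ℕ) : ℤ) * ((c i : ℕ) : ℤ)) = (c i : ℕ) := by
    rcases Fin.exists_fin_two.1 ⟨c i, rfl⟩ with h | h <;> simp [h]
  simp only [h, k, add_mul, Finset.sum_add_distrib, ite_mul, zero_mul, Finset.sum_ite_eq,
    Finset.mem_univ, if_true, hsq, mul_add, Finset.mul_sum, Finset.sum_mul]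
  have e : ∑ j, ∑ i, l i * ((c i : ℕ) : ℤ) * (m j * ((c j : ℕ) : ℤ)) =
      ∑ i, ∑ j, l i * m j * (((c i : ℕ) : ℤ) * ((c j : ℕ) : ℤ)) := by
    rw [Finset.sum_comm]
    exact Finset.sum_congr rfl fun i _ => Finset.sum_congr rfl fun j _ => by ring
  have e' : ∑ i, l i * ((c i : ℕ) : ℤ) * b = ∑ i, b * l i * ((c i : ℕ) : ℤ) :=
    Finset.sum_congr rfl fun i _ => by ring
  rw [e, e', Finset.sum_congr rfl fun i _ => (mul_assoc a (m i) ((c i : ℕ) : ℤ)).symm]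
  ring

end IsAffineForm

namespace IsQuadraticForm

theorem zero : IsQuadraticForm fun _ : ι → Fin 2 => (0 : ℤ) := ⟨0, 0, by simp⟩

theorem add {A B : (ι → Fin 2) → ℤ} (hA : IsQuadraticForm A) (hB : IsQuadraticForm B) :
    IsQuadraticForm fun c => A c + B c := by
  obtain ⟨a, l, h⟩ := hA
  obtain ⟨b, m, k⟩ := hB
  refine ⟨a + b, fun i j => l i j + m i j, fun c => ?_⟩
  simp only [h, k, add_mul, Finset.sum_add_distrib]
  ring

theorem sum {κ : Type*} (s : Finset κ) {A : κ → (ι → Fin 2) → ℤ}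
    (hA : ∀ k, IsQuadraticForm (A k)) : IsQuadraticForm fun c => ∑ k ∈ s, A k c := by
  classical
  induction s using Finset.induction_on with
  | empty => simpa using zero
  | insert k s hk ih => simpa [Finset.sum_insert hk] using (hA k).add ih

end IsQuadraticForm

/-- The sum of the monomials `∏ a i ^ c i` over the zeros `c` of `Q`. -/
noncomputable def zeroSum {A : Type*} [CommSemiring A] [DecidableEq ι] (Q : (ι → Fin 2) → ℤ)
    (a : ι → A) : A :=
  ∑ c : ι → Fin 2, if Q c = 0 then ∏ i, a i ^ (c i : ℕ) else 0

end BitForms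

/-! ### Derivation constraints and auxiliary bits as one quadratic form. -/

section SumOverBits

variable {σ β : Type} {L D : ℕ} [NeZero D]

/-- The violation of the derivation constraint for the component `y` of the value `h`. -/
def constraintDefect (r : Fin L → Instr ℚ (σ ⊕ β) L) (o : Fin L) (e : Fin D) (h : Fin L)
    (y : Fin D × Fin D) (u : Fin L × (Fin D × Fin D) × Fin D → ℕ) : ℤ :=
  (∑ j, (u (h, y, j) : ℤ)) - ((if h = o ∧ y = (e, 0) then 1 else 0) +
    ∑ h', ∑ y', ∑ j, (prodDemand (r h') y' j h y : ℤ) * u (h', y', j))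

theorem abs_constraintDefect_le (r : Fin L → Instr ℚ (σ ⊕ β) L) (o : Fin L) (e : Fin D) (h : Fin L)
    (y : Fin D × Fin D) (u : Fin L × (Fin D × Fin D) × Fin D → ℕ) (hu : ∀ x, u x ≤ 1) :
    |constraintDefect r o e h y u| ≤ D + 1 + 2 * (L * (D * D * D)) := by
  have h₁ : ∑ j, (u (h, y, j) : ℤ) ≤ D := by
    refine (Finset.sum_le_card_nsmul _ _ 1 fun j _ => by exact_mod_cast hu _).trans ?_
    simp
  have h₁' : 0 ≤ ∑ j, (u (h, y, j) : ℤ) := Finset.sum_nonneg fun j _ => by positivity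
  have h₂ : ∑ h', ∑ y', ∑ j, (prodDemand (r h') y' j h y : ℤ) * u (h', y', j) ≤
      2 * (L * (D * D * D)) := by
    calc _ ≤ ∑ h' : Fin L, ∑ y' : Fin D × Fin D, ∑ j : Fin D, (2 : ℤ) := by
          refine Finset.sum_le_sum fun h' _ => Finset.sum_le_sum fun y' _ =>
            Finset.sum_le_sum fun j _ => ?_
          have := Nat.mul_le_mul (prodDemand_le_two (r h') y' j h y) (hu (h', y', j))
          exact_mod_cast this
      _ = _ := by simp; ring
  have h₂' : 0 ≤ ∑ h', ∑ y', ∑ j, (prodDemand (r h') y' j h y : ℤ) * u (h', y', j) :=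
    Finset.sum_nonneg fun h' _ => Finset.sum_nonneg fun y' _ => Finset.sum_nonneg fun j _ => by
      positivity
  unfold constraintDefect
  rw [abs_le]
  split_ifs <;> constructor <;> linarith

/-- The sum over auxiliary bits of a homogeneous component of a value of a straight-line program is
a weighted sum over the zeros of a quadratic form in bits. -/
theorem exists_sum_evalBits_eq_zeroSum [Fintype β] [DecidableEq β] (hD : 2 ≤ D)
    {v : Fin L → MvPolynomial (σ ⊕ β) ℚ} {r : Fin L → Instr ℚ (σ ⊕ β) L}
    (hr : ∀ i, (r i).Produces v i) (o : Fin L) (e : Fin D) :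
    ∃ (Q : ((Fin L × (Fin D × Fin D) × Fin D) ⊕ β → Fin 2) → ℤ)
      (a : (Fin L × (Fin D × Fin D) × Fin D) ⊕ β → MvPolynomial σ ℚ),
      IsQuadraticForm Q ∧ (∀ c, 0 ≤ Q c) ∧
      (∀ c, Q c ≤ L * (D * D) * (D + 1 + 2 * (L * (D * D * D))) ^ 2 + L * (D * D * D)) ∧
      (∀ x, (∃ c, a x = C c) ∨ ∃ y, a x = X y) ∧
      ∑ ε : β → Fin 2, evalBits ε (homogeneousComponent (e : ℕ) (v o)) = zeroSum Q a := by
  classical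
  let N := Fin L × (Fin D × Fin D) × Fin D
  -- A production weight is a constant, a true variable or an auxiliary bit `b`. In the last case
  -- `w` is 1 and `t` records `b`.
  have hlab (x : N) : ∃ (w : MvPolynomial σ ℚ) (t : Option β), ((∃ c, w = C c) ∨ ∃ y, w = X y) ∧
      ∀ ε : β → Fin 2, evalBits ε (prodWeight v (r x.1) x.2.1 x.2.2) =
        w * t.elim 1 fun b => C ((ε b : ℕ) : ℚ) := by
    rcases prodWeight_eq v (r x.1) x.2.1 x.2.2 with ⟨c, hc⟩ | ⟨y | b, hy⟩
    · exact ⟨C c, none, .inl ⟨c, rfl⟩, fun ε => by simp [hc, evalBits]⟩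
    · exact ⟨X y, none, .inr ⟨y, rfl⟩, fun ε => by simp [hy, evalBits]⟩
    · exact ⟨C 1, some b, .inl ⟨1, rfl⟩, fun ε => by simp [hy, evalBits]⟩
  choose w t hw ht using hlab
  -- A sum of squares: it vanishes exactly when all derivation constraints hold.
  let Q₁ (c : N ⊕ β → Fin 2) : ℤ :=
    ∑ h, ∑ y, constraintDefect r o e h y (fun x => (c (.inl x) : ℕ)) *
      constraintDefect r o e h y (fun x => (c (.inl x) : ℕ))
  -- Charges 1 for each selected production labelled by an auxiliary bit whose value is 0, for then
  -- the monomial evaluates to 0.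
  let Q₂ (c : N ⊕ β → Fin 2) : ℤ :=
    ∑ x : N, ((c (.inl x) : ℕ) : ℤ) * (t x).elim 0 fun b => 1 - ((c (.inr b) : ℕ) : ℤ)
  have hbit (i : Fin 2) : ((i : ℕ) : ℤ) ≤ 1 := by exact_mod_cast Nat.le_of_lt_succ i.2
  have hQ₂ (c : N ⊕ β → Fin 2) (x : N) :
      0 ≤ ((c (.inl x) : ℕ) : ℤ) * (t x).elim 0 fun b => 1 - ((c (.inr b) : ℕ) : ℤ) := by
    refine mul_nonneg (by positivity) ?_
    cases t x with
    | none => exact le_rfl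
    | some b => exact sub_nonneg.2 (hbit _)
  have hQ₁nn (c) : 0 ≤ Q₁ c :=
    Finset.sum_nonneg fun h _ => Finset.sum_nonneg fun y _ => mul_self_nonneg _
  have hQ₂nn (c) : 0 ≤ Q₂ c := Finset.sum_nonneg fun x _ => hQ₂ c x
  refine ⟨fun c => Q₁ c + Q₂ c, Sum.elim w fun _ => C 1, ?_, fun c => add_nonneg (hQ₁nn c) (hQ₂nn c),
    ?_, ?_, ?_⟩
  · refine IsQuadraticForm.add ?_ ?_
    · refine .sum _ fun h => .sum _ fun y => ?_
      have : IsAffineForm fun c : N ⊕ β → Fin 2 =>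
          constraintDefect r o e h y (fun x => (c (.inl x) : ℕ)) := by
        refine .sub (.sum _ fun j => .bit _) (.add (.const _) ?_)
        exact .sum _ fun h' => .sum _ fun y' => .sum _ fun j => .const_mul _ (.bit _)
      exact this.mul this
    · refine .sum _ fun x => ?_
      refine (IsAffineForm.bit _).mul ?_
      cases t x with
      | none => exact .const 0
      | some b => exact .sub (.const 1) (.bit _)
  · intro c
    refine add_le_add ?_ ?_
    · calc Q₁ c ≤ ∑ h : Fin L, ∑ y : Fin D × Fin D,
            ((D + 1 + 2 * (L * (D * D * D))) ^ 2 : ℤ) := by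
            refine Finset.sum_le_sum fun h _ => Finset.sum_le_sum fun y _ => ?_
            rw [← pow_two]
            exact sq_le_sq.2 ((abs_constraintDefect_le r o e h y _ fun x =>
              Nat.le_of_lt_succ (c (.inl x)).2).trans (le_abs_self _))
        _ = _ := by simp; ring
    · calc Q₂ c ≤ ∑ x : N, 1 := by
            refine Finset.sum_le_sum fun x _ => ?_
            have h₁ := hbit (c (.inl x))
            cases t x with
            | none => simp
            | some b =>
              have h₂ : (0 : ℤ) ≤ ((c (.inr b) : ℕ) : ℤ) := by positivity
              have h₃ := hbit (c (.inr b))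
              exact mul_le_one₀ h₁ (sub_nonneg.2 h₃) (sub_le_self _ h₂)
        _ = _ := by simp [N]
  · rintro (x | b)
    · exact hw x
    · exact .inl ⟨1, rfl⟩
  · have hzero (c : N ⊕ β → Fin 2) : Q₁ c + Q₂ c = 0 ↔
        (∀ h y, constraintDefect r o e h y (fun x => (c (.inl x) : ℕ)) = 0) ∧
        ∀ x, ((c (.inl x) : ℕ) : ℤ) * ((t x).elim 0 fun b => 1 - ((c (.inr b) : ℕ) : ℤ)) = 0 := by
      rw [add_eq_zero_iff_of_nonneg (hQ₁nn c) (hQ₂nn c)]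
      refine and_congr ?_ ?_
      · rw [Finset.sum_eq_zero_iff_of_nonneg fun h _ => Finset.sum_nonneg fun y _ => mul_self_nonneg _]
        refine forall_congr' fun h => ?_
        rw [Finset.sum_eq_zero_iff_of_nonneg fun y _ => mul_self_nonneg _]
        simp
      · rw [Finset.sum_eq_zero_iff_of_nonneg fun x _ => hQ₂ c x]
        simp
    have hcons (c : N ⊕ β → Fin 2) : (∀ h y, constraintDefect r o e h y
        (fun x => (c (.inl x) : ℕ)) = 0) ↔ ∀ h y, ∑ j, (c (.inl (h, y, j)) : ℕ) =
          (if h = o ∧ y = (e, 0) then 1 else 0) +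
            ∑ h', ∑ y', ∑ j, (c (.inl (h', y', j)) : ℕ) * prodDemand (r h') y' j h y := by
      refine forall_congr' fun h => forall_congr' fun y => ?_
      rw [constraintDefect, sub_eq_zero, ← Nat.cast_inj (R := ℤ)]
      push_cast
      simp only [mul_comm]
    have hpt (c : N ⊕ β → Fin 2) :
        evalBits (fun b => c (.inr b)) (if ∀ h y, ∑ j, (c (.inl (h, y, j)) : ℕ) =
          (if h = o ∧ y = (e, 0) then 1 else 0) +
            ∑ h', ∑ y', ∑ j, (c (.inl (h', y', j)) : ℕ) * prodDemand (r h') y' j h y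
          then ∏ h, ∏ y, ∏ j, prodWeight v (r h) y j ^ (c (.inl (h, y, j)) : ℕ) else 0) =
        if Q₁ c + Q₂ c = 0 then
          ∏ x : N ⊕ β, (Sum.elim w (fun _ => C 1) x : MvPolynomial σ ℚ) ^ (c x : ℕ) else 0 := by
      simp only [hzero, hcons, ite_and]
      split_ifs with h₁ h₂
      · simp only [map_prod, map_pow, Fintype.prod_sum_type, Sum.elim_inl, Sum.elim_inr, C_1,
          one_pow, Finset.prod_const_one, mul_one, Fintype.prod_prod_type]
        rw [Fintype.prod_prod_type]
        refine Finset.prod_congr rfl fun h _ => ?_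
        rw [Fintype.prod_prod_type, Fintype.prod_prod_type]
        refine Finset.prod_congr rfl fun y₁ _ =>
          Finset.prod_congr rfl fun y₂ _ => Finset.prod_congr rfl fun j _ => ?_
        have h₃ := h₂ (h, (y₁, y₂), j)
        rw [ht (h, (y₁, y₂), j)]
        rcases Fin.exists_fin_two.1 ⟨c (.inl (h, (y₁, y₂), j)), rfl⟩ with k | k
        · simp [k]
        · cases ht' : t (h, (y₁, y₂), j) with
          | none => simp
          | some b =>
            rw [ht', k] at h₃
            have h₄ : ((c (.inr b) : ℕ) : ℤ) = 1 := by
              simp only [Fin.val_one, Nat.cast_one, one_mul, Option.elim_some] at h₃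
              linarith
            have h₅ : (c (.inr b) : ℕ) = 1 := by exact_mod_cast h₄
            simp [h₅]
      · obtain ⟨⟨h, y, j⟩, hx⟩ := not_forall.1 h₂
        simp only [map_prod, map_pow]
        refine Finset.prod_eq_zero (Finset.mem_univ h) (Finset.prod_eq_zero (Finset.mem_univ y)
          (Finset.prod_eq_zero (Finset.mem_univ j) ?_))
        rw [ht (h, y, j)]
        rcases Fin.exists_fin_two.1 ⟨c (.inl (h, y, j)), rfl⟩ with k | k
        · simp [k] at hx
        · cases ht' : t (h, y, j) with
          | none => simp [ht'] at hx
          | some b =>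
            rcases Fin.exists_fin_two.1 ⟨c (.inr b), rfl⟩ with k' | k'
            · simp [k, k']
            · simp [ht', k'] at hx
      · rw [map_zero]
    let E : (N → Fin 2) ≃ (Fin L → Fin D × Fin D → Fin D → Fin 2) :=
      (Equiv.curry _ _ _).trans (Equiv.piCongrRight fun _ => Equiv.curry _ _ _)
    rw [zeroSum, ← (Equiv.sumArrowEquivProdArrow N β (Fin 2)).symm.sum_comp,
      Fintype.sum_prod_type, Finset.sum_comm]
    refine Finset.sum_congr rfl fun ε _ => ?_
    rw [homogeneousComponent_eq_sum_derivations hD hr, map_sum, ← E.sum_comp]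
    refine Finset.sum_congr rfl fun u _ => ?_
    exact hpt ((Equiv.sumArrowEquivProdArrow N β (Fin 2)).symm (u, ε))

end SumOverBits

/-! ### Evaluating homomorphism polynomials at weighted graphs -/

section Clique

variable {α β : Type*} {H : Graph α β}

theorem IsHomomorphicTo.comp {V W : Type*} {G : SimpleGraph V} {G' : SimpleGraph W}
    (h : IsHomomorphicTo G' H) (f : V → W) (hf : ∀ u v, G.Adj u v → G'.Adj (f u) (f v)) :
    IsHomomorphicTo G H := by
  obtain ⟨φ, hφ, hadj⟩ := h
  exact ⟨φ ∘ f, fun v => hφ _, fun u v huv => hadj _ _ (hf u v huv)⟩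

/-- The clique number of a loopless graph with an edge, shifted by two. -/
theorem exists_clique_number (hH : V(H).Finite) (h : ¬ ((∃ e v, H.IsLoopAt e v) ∨ E(H) = ∅)) :
    ∃ r, IsHomomorphicTo (⊤ : SimpleGraph (Fin r ⊕ Fin 2)) H ∧
      ¬ IsHomomorphicTo (⊤ : SimpleGraph (Fin r ⊕ Fin 3)) H := by
  classical
  push Not at h
  obtain ⟨hloop, e, he⟩ := h
  obtain ⟨u, v, huv⟩ := H.exists_isLink_of_mem_edgeSet he
  have h₀ : IsHomomorphicTo (⊤ : SimpleGraph (Fin 0 ⊕ Fin 2)) H := by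
    refine ⟨Sum.elim Fin.elim0 ![u, v], ?_, ?_⟩
    · rintro (i | i)
      · exact i.elim0
      · fin_cases i
        · exact huv.left_mem
        · exact huv.right_mem
    · rintro (i | i) (j | j) hij
      · exact i.elim0
      · exact i.elim0
      · exact j.elim0
      · fin_cases i <;> fin_cases j <;> simp at hij ⊢
        · exact ⟨e, huv⟩
        · exact ⟨e, huv.symm⟩
  -- Without loops, a homomorphism from a clique is injective, so cliques larger than the finite
  -- vertex set do not map.
  have hlarge : ∃ r, ¬ IsHomomorphicTo (⊤ : SimpleGraph (Fin r ⊕ Fin 2)) H := by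
    refine ⟨V(H).ncard, fun ⟨φ, hφ, hadj⟩ => ?_⟩
    have hinj : Function.Injective φ := by
      intro a b hab
      by_contra hne
      obtain ⟨e', he'⟩ := hadj a b hne
      exact hloop e' (φ b) (by rwa [hab] at he')
    have := Set.ncard_le_ncard (Set.range_subset_iff.2 hφ) hH
    rw [← Set.image_univ, Set.ncard_image_of_injective _ hinj, Set.ncard_univ] at this
    simp at this
  -- The least failing index is positive because an edge is a clique on two vertices; its
  -- predecessor is the required `r`.
  obtain ⟨r, hr⟩ : ∃ r, Nat.find hlarge = r + 1 :=
    Nat.exists_eq_succ_of_ne_zero fun h => Nat.find_spec hlarge (by rw [h]; exact h₀)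
  refine ⟨r, not_not.1 (Nat.find_min hlarge (by omega)), fun h => ?_⟩
  refine Nat.find_spec hlarge ?_
  rw [hr]
  let f : Fin (r + 1) ⊕ Fin 2 ≃ Fin r ⊕ Fin 3 := Fintype.equivOfCardEq (by simp)
  exact h.comp f fun u v huv => fun h => huv (f.injective h)

end Clique

/-! ### Sums over edge sets on an arbitrary finite vertex set. -/

section WeightedGraphs

variable {α β : Type*} (H : Graph α β)

/-- The pairs of distinct elements of `T`. -/
def properPairs (T : Type*) [Fintype T] [DecidableEq T] : Finset (Sym2 T) :=
  Finset.univ.filter fun e => ¬ e.IsDiag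

open Classical in
/-- The sum of the weights of the graphs on `T` that are homomorphic to `H`. -/
noncomputable def homSum {T A : Type*} [Fintype T] [DecidableEq T] [CommSemiring A]
    (W : Sym2 T → A) : A :=
  ∑ S ∈ (properPairs T).powerset,
    if IsHomomorphicTo (SimpleGraph.fromEdgeSet (S : Set (Sym2 T))) H then ∏ e ∈ S, W e else 0

/-- Indicator vectors of edges of `K_p` correspond to sets of proper pairs of `T`, and being
homomorphic to `H` is invariant under relabelling. -/
theorem aeval_homPolynomial {T : Type*} [Fintype T] [DecidableEq T] {σ : Type} {p : ℕ}
    (f : Fin p ≃ T) (W : Sym2 T → MvPolynomial σ ℚ) :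
    aeval (fun e : CompleteEdge p => W (Sym2.map f e)) (homPolynomial ℚ H p) = homSum H W := by
  classical
  have hinj : Function.Injective fun e : CompleteEdge p => Sym2.map f e :=
    (Sym2.map.injective f.injective).comp Subtype.val_injective
  have hdiag (e : CompleteEdge p) : ¬ (Sym2.map f e).IsDiag := by
    obtain ⟨e, he⟩ := e
    induction e using Sym2.ind with | _ u v =>
    simpa using he
  let toSet (ε : CompleteEdge p → Fin 2) : Finset (Sym2 T) :=
    (Finset.univ.filter fun e => ε e = 1).image fun e : CompleteEdge p => Sym2.map f e
  have hmem (ε : CompleteEdge p → Fin 2) (e : CompleteEdge p) :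
      Sym2.map f e ∈ toSet ε ↔ ε e = 1 := by
    simp only [toSet, Finset.mem_image, Finset.mem_filter, Finset.mem_univ, true_and]
    exact ⟨fun ⟨e', h, h'⟩ => hinj h' ▸ h, fun h => ⟨e, h, rfl⟩⟩
  have hhom (ε : CompleteEdge p → Fin 2) : IsHomomorphicTo (graphOfIndicator ε) H ↔
      IsHomomorphicTo (SimpleGraph.fromEdgeSet (toSet ε : Set (Sym2 T))) H := by
    have hadj (u v : Fin p) (huv : u ≠ v) : (graphOfIndicator ε).Adj u v ↔
        (SimpleGraph.fromEdgeSet (toSet ε : Set (Sym2 T))).Adj (f u) (f v) := by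
      rw [graphOfIndicator_adj ε huv, ← hmem]
      simp [huv]
    constructor
    · intro h
      refine h.comp f.symm fun u v huv => ?_
      rw [hadj _ _ (by simpa using huv.ne)]
      simpa using huv
    · intro h
      exact h.comp f fun u v huv => (hadj u v huv.ne).1 huv
  rw [homPolynomial, map_sum, homSum]
  refine Finset.sum_nbij' toSet (fun S e => if Sym2.map f e ∈ S then 1 else 0) ?_ ?_ ?_ ?_ ?_
  · intro ε _
    rw [Finset.mem_powerset]
    intro e he
    obtain ⟨e', -, rfl⟩ := Finset.mem_image.1 he
    exact Finset.mem_filter.2 ⟨Finset.mem_univ _, hdiag e'⟩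
  · simp
  · intro ε _
    funext e
    simp only [hmem]
    rcases Fin.exists_fin_two.1 ⟨ε e, rfl⟩ with h | h <;> simp [h]
  · intro S hS
    ext e
    simp only [toSet, Finset.mem_image, Finset.mem_filter, Finset.mem_univ, true_and]
    constructor
    · rintro ⟨e', h, rfl⟩
      by_contra hc
      simp [hc] at h
    · intro he
      have hd := (Finset.mem_filter.1 (Finset.mem_powerset.1 hS he)).2
      refine ⟨⟨Sym2.map f.symm e, ?_⟩, ?_, ?_⟩
      · induction e using Sym2.ind with | _ u v =>
        simpa using hd
      · simp [Sym2.map_map, he]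
      · simp [Sym2.map_map]
  · intro ε _
    rw [map_mul, map_prod]
    simp only [hhom]
    have hprod : ∏ e : CompleteEdge p, aeval (fun e : CompleteEdge p => W (Sym2.map f e))
        ((X e : MvPolynomial (CompleteEdge p) ℚ) ^ (ε e : ℕ)) = ∏ e ∈ toSet ε, W e := by
      rw [Finset.prod_image hinj.injOn, Finset.prod_filter]
      refine Finset.prod_congr rfl fun e _ => ?_
      rcases Fin.exists_fin_two.1 ⟨ε e, rfl⟩ with h | h <;> simp [h]
    rw [hprod]
    split_ifs <;> simp

end WeightedGraphs

/-! ### The clique gadget -/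

section Gadget

variable {α β : Type*} {H : Graph α β} {r : ℕ} {ι : Type}

/-- A clique, the last two vertices of which are called poles, and further vertices `ι`. -/
abbrev GadgetVertex (r : ℕ) (ι : Type) : Type := (Fin r ⊕ Fin 2) ⊕ ι

/-- The degree of an edge: `K` if it must be present, `1` if it joins a pole with a vertex in `ι`,
and `0` if it joins two vertices in `ι`. -/
def edgeDegree (r : ℕ) (ι : Type) (K : ℕ) : Sym2 (GadgetVertex r ι) → ℕ :=
  Sym2.lift ⟨fun u v => match u, v with
    | .inl _, .inl _ => K
    | .inl (.inl _), .inr _ => K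
    | .inr _, .inl (.inl _) => K
    | .inl (.inr _), .inr _ => 1
    | .inr _, .inl (.inr _) => 1
    | .inr _, .inr _ => 0, by
    rintro ((i | b) | x) ((j | b') | y) <;> rfl⟩

/-- The weight of an edge of the gadget. -/
noncomputable def edgeWeight {A : Type*} [CommRing A] (r : ℕ) (a : ι → A) (y : ι → ι → A)
    (hy : ∀ i j, y i j = y j i) : Sym2 (GadgetVertex r ι) → A :=
  Sym2.lift ⟨fun u v => match u, v with
    | .inl _, .inl _ => 1
    | .inl (.inl _), .inr _ => 1
    | .inr _, .inl (.inl _) => 1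
    | .inl (.inr b), .inr x => if b = 0 then a x else 1
    | .inr x, .inl (.inr b) => if b = 0 then a x else 1
    | .inr x, .inr x' => y x x' - 1, by
    rintro ((i | b) | x) ((j | b') | y) <;> first | rfl | simp [hy]⟩

/-- The edges of the gadget that must be present. -/
def forcedEdges (r : ℕ) (ι : Type) [Fintype ι] [DecidableEq ι] :
    Finset (Sym2 (GadgetVertex r ι)) :=
  (properPairs (GadgetVertex r ι)).filter fun e => edgeDegree r ι 2 e = 2

/-- The edge joining a pole with a vertex. -/
def poleEdge (r : ℕ) (p : Fin 2 × ι) : Sym2 (GadgetVertex r ι) := s(.inl (.inr p.1), .inr p.2)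

theorem poleEdge_injective : Function.Injective (poleEdge r : Fin 2 × ι → _) := by
  rintro ⟨b, x⟩ ⟨b', x'⟩ h
  simpa [poleEdge] using h

variable [Fintype ι] [DecidableEq ι]

/-- The edges selecting the colouring `c`: a vertex is joined with the pole of the other colour. -/
def selectedEdges (r : ℕ) (c : ι → Fin 2) : Finset (Sym2 (GadgetVertex r ι)) :=
  Finset.univ.image fun x => poleEdge r (c x + 1, x)

/-- The edges of `ι` cut by the colouring `c`. -/
def cutEdges (r : ℕ) (c : ι → Fin 2) : Finset (Sym2 (GadgetVertex r ι)) :=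
  (Finset.univ.filter fun p : ι × ι => c p.1 = 1 ∧ c p.2 = 0).image fun p => s(.inr p.1, .inr p.2)

theorem mem_cutEdges {c : ι → Fin 2} {x y : ι} :
    s(.inr x, .inr y) ∈ cutEdges r c ↔ c x ≠ c y := by
  simp only [cutEdges, Finset.mem_image, Finset.mem_filter, Finset.mem_univ, true_and, Prod.exists,
    Sym2.eq_iff, Sum.inr.injEq]
  have hx := Fin.exists_fin_two.1 ⟨c x, rfl⟩
  have hy := Fin.exists_fin_two.1 ⟨c y, rfl⟩
  constructor
  · rintro ⟨a, b, ⟨ha, hb⟩, ⟨rfl, rfl⟩ | ⟨rfl, rfl⟩⟩ <;> simp [ha, hb]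
  · intro h
    rcases hx with hx | hx <;> rcases hy with hy | hy
    · exact absurd (hx.trans hy.symm) h
    · exact ⟨y, x, ⟨hy, hx⟩, .inr ⟨rfl, rfl⟩⟩
    · exact ⟨x, y, ⟨hx, hy⟩, .inl ⟨rfl, rfl⟩⟩
    · exact absurd (hx.trans hy.symm) h

theorem poleEdge_mem_selectedEdges {c : ι → Fin 2} {b : Fin 2} {x : ι} :
    poleEdge r (b, x) ∈ selectedEdges r c ↔ b = c x + 1 := by
  simp only [selectedEdges, Finset.mem_image, Finset.mem_univ, true_and,
    poleEdge_injective.eq_iff, Prod.mk.injEq]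
  exact ⟨fun ⟨x', h, h'⟩ => h' ▸ h.symm, fun h => ⟨x, h.symm, rfl⟩⟩

theorem disjoint_forced_selected (c : ι → Fin 2) :
    Disjoint (forcedEdges r ι) (selectedEdges r c) := by
  rw [Finset.disjoint_left]
  intro e he he'
  obtain ⟨x, -, rfl⟩ := Finset.mem_image.1 he'
  exact absurd (Finset.mem_filter.1 he).2 (by simp [poleEdge, edgeDegree])

theorem disjoint_base_cut (c : ι → Fin 2) :
    Disjoint (forcedEdges r ι ∪ selectedEdges r c) (cutEdges r c) := by
  rw [Finset.disjoint_left]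
  intro e he he'
  obtain ⟨⟨x, y⟩, -, rfl⟩ := Finset.mem_image.1 he'
  rcases Finset.mem_union.1 he with he | he
  · exact absurd (Finset.mem_filter.1 he).2 (by simp [edgeDegree])
  · obtain ⟨x, -, h⟩ := Finset.mem_image.1 he
    simp [poleEdge] at h

theorem base_union_cut_subset (c : ι → Fin 2) :
    (forcedEdges r ι ∪ selectedEdges r c) ∪ cutEdges r c ⊆ properPairs (GadgetVertex r ι) := by
  refine Finset.union_subset (Finset.union_subset (Finset.filter_subset _ _) ?_) ?_
  · intro e he
    obtain ⟨x, -, rfl⟩ := Finset.mem_image.1 he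
    simp [properPairs, poleEdge]
  · intro e he
    obtain ⟨⟨x, y⟩, h, rfl⟩ := Finset.mem_image.1 he
    have h := (Finset.mem_filter.1 h).2
    have : x ≠ y := by
      rintro rfl
      simp_all
    simpa [properPairs] using this

/-- The pole edges in `S` reveal the colouring. The intervals of edge sets belonging to different
colourings are therefore disjoint. -/
theorem colouring_unique {c c' : ι → Fin 2} {S : Finset (Sym2 (GadgetVertex r ι))}
    (h : forcedEdges r ι ∪ selectedEdges r c ⊆ S)
    (h' : S ⊆ (forcedEdges r ι ∪ selectedEdges r c') ∪ cutEdges r c') : c = c' := by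
  funext x
  have hm : poleEdge r (c x + 1, x) ∈ S :=
    h (Finset.mem_union_right _ (poleEdge_mem_selectedEdges.2 rfl))
  rcases Finset.mem_union.1 (h' hm) with h₁ | h₁
  · rcases Finset.mem_union.1 h₁ with h₁ | h₁
    · exact absurd (Finset.mem_filter.1 h₁).2 (by simp [poleEdge, edgeDegree])
    · exact add_right_cancel (poleEdge_mem_selectedEdges.1 h₁)
  · obtain ⟨p, -, h₂⟩ := Finset.mem_image.1 h₁
    simp [poleEdge] at h₂

end Gadget

/-! ### The sum over colourings extracted from the gadget. -/

section GadgetSum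

variable {α β : Type*} {H : Graph α β} {r : ℕ} {ι : Type} [Fintype ι] [DecidableEq ι]

/-- Proper pairs are of three kinds: forced edges of degree `K`, pole edges of degree 1, and edges
inside `ι` of degree 0. Pole edges are counted vertex by vertex. -/
theorem sum_edgeDegree {K : ℕ} {S : Finset (Sym2 (GadgetVertex r ι))}
    (hS : S ⊆ properPairs (GadgetVertex r ι)) :
    ∑ e ∈ S, edgeDegree r ι K e = K * (S ∩ forcedEdges r ι).card +
      ∑ x, (Finset.univ.filter fun b => poleEdge r (b, x) ∈ S).card := by
  have hsplit : ∀ e ∈ S, edgeDegree r ι K e = (if e ∈ forcedEdges r ι then K else 0) +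
      if e ∈ Finset.univ.image (poleEdge r : Fin 2 × ι → _) then 1 else 0 := by
    intro e he
    have hmem : e ∈ forcedEdges r ι ↔ edgeDegree r ι 2 e = 2 :=
      Finset.mem_filter.trans (and_iff_right (hS he))
    simp only [hmem]
    induction e using Sym2.ind with | _ u v =>
    rcases u with (i | b) | x <;> rcases v with (j | b') | y <;>
    simp [edgeDegree, poleEdge]
  rw [Finset.sum_congr rfl hsplit, Finset.sum_add_distrib, Finset.sum_ite_mem, Finset.sum_const,
    smul_eq_mul, mul_comm, Finset.sum_ite_mem, Finset.sum_const, smul_eq_mul, mul_one]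
  congr 1
  have : S ∩ Finset.univ.image (poleEdge r : Fin 2 × ι → _) =
      (Finset.univ.filter fun p => poleEdge r p ∈ S).image (poleEdge r) := by
    ext e
    simp only [Finset.mem_inter, Finset.mem_image, Finset.mem_univ, true_and, Finset.mem_filter]
    constructor
    · rintro ⟨h, p, rfl⟩
      exact ⟨p, h, rfl⟩
    · rintro ⟨p, h, rfl⟩
      exact ⟨h, p, rfl⟩
  rw [this, Finset.card_image_of_injective _ poleEdge_injective]
  simp only [Finset.card_filter]
  rw [Fintype.sum_prod_type, Finset.sum_comm]

/-- Folding each vertex onto the pole of its colour maps the graph to the clique on `r + 2`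
vertices: it is joined only to the opposite pole and to vertices of the other colour. -/
theorem isHomomorphicTo_of_colouring (hr : IsHomomorphicTo (⊤ : SimpleGraph (Fin r ⊕ Fin 2)) H)
    {c : ι → Fin 2} {S : Finset (Sym2 (GadgetVertex r ι))}
    (hS : S ⊆ (forcedEdges r ι ∪ selectedEdges r c) ∪ cutEdges r c) :
    IsHomomorphicTo (SimpleGraph.fromEdgeSet (S : Set (Sym2 (GadgetVertex r ι)))) H := by
  refine hr.comp (Sum.elim id fun x => .inr (c x)) fun u v huv => ?_
  obtain ⟨huv, hne⟩ := SimpleGraph.fromEdgeSet_adj _ |>.1 huv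
  have key (b : Fin 2) (x : ι) (h : poleEdge r (b, x) ∈ S) : b ≠ c x := by
    rintro rfl
    rcases Finset.mem_union.1 (hS h) with h₁ | h₁
    · rcases Finset.mem_union.1 h₁ with h₁ | h₁
      · exact absurd (Finset.mem_filter.1 h₁).2 (by simp [poleEdge, edgeDegree])
      · have h₂ := poleEdge_mem_selectedEdges.1 h₁
        simp at h₂
    · obtain ⟨p, -, h₂⟩ := Finset.mem_image.1 h₁
      simp [poleEdge] at h₂
  have key' (x y : ι) (h : s(.inr x, .inr y) ∈ S) : c x ≠ c y := by
    rcases Finset.mem_union.1 (hS h) with h₁ | h₁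
    · rcases Finset.mem_union.1 h₁ with h₁ | h₁
      · exact absurd (Finset.mem_filter.1 h₁).2 (by simp [edgeDegree])
      · obtain ⟨p, -, h₂⟩ := Finset.mem_image.1 h₁
        simp [poleEdge] at h₂
    · exact mem_cutEdges.1 h₁
  rw [SimpleGraph.top_adj]
  rcases u with u | x <;> rcases v with v | y
  · simpa using hne
  · rcases u with i | b
    · simp
    · simpa using key b y huv
  · rcases v with i | b
    · simp
    · simpa using (key b x (by rw [poleEdge, Sym2.eq_swap]; exact huv)).symm
  · simpa using key' x y huv

/-- The `r` vertices other than the poles are adjacent to everything, so a triangle among poles and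
`ι` extends to a clique on `r + 3` vertices. -/
theorem false_of_clique (hr : ¬ IsHomomorphicTo (⊤ : SimpleGraph (Fin r ⊕ Fin 3)) H)
    {S : Finset (Sym2 (GadgetVertex r ι))} (hF : forcedEdges r ι ⊆ S)
    (hS : IsHomomorphicTo (SimpleGraph.fromEdgeSet (S : Set (Sym2 (GadgetVertex r ι)))) H)
    (t : Fin 3 → Fin 2 ⊕ ι) (ht : Function.Injective t)
    (hadj : ∀ i j, i < j → s((t i).elim (fun b => .inl (.inr b)) .inr,
      (t j).elim (fun b => .inl (.inr b)) .inr) ∈ S) : False := by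
  let g : Fin 2 ⊕ ι → GadgetVertex r ι := fun x => x.elim (fun b => .inl (.inr b)) .inr
  have hg : Function.Injective g := by
    rintro (b | x) (b' | y) h <;> simp_all [g]
  refine hr (hS.comp (Sum.elim (fun i => .inl (.inl i)) (g ∘ t)) fun u v huv => ?_)
  rw [SimpleGraph.fromEdgeSet_adj]
  have hforced (i : Fin r) (w : GadgetVertex r ι) (hw : .inl (.inl i) ≠ w) :
      s(.inl (.inl i), w) ∈ S := by
    refine hF (Finset.mem_filter.2 ⟨by simpa [properPairs] using hw, ?_⟩)
    rcases w with w | w <;> simp [edgeDegree]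
  have hgi (i : Fin r) (x : Fin 2 ⊕ ι) : (.inl (.inl i) : GadgetVertex r ι) ≠ g x := by
    rcases x with b | x <;> simp [g]
  rcases u with i | i <;> rcases v with j | j
  · have hij : i ≠ j := by simpa using huv
    exact ⟨hforced i _ (by simpa using hij), by simpa using hij⟩
  · exact ⟨hforced i _ (hgi i _), hgi i _⟩
  · exact ⟨by rw [Sym2.eq_swap]; exact hforced j _ (hgi j _), (hgi j _).symm⟩
  · have hij : i ≠ j := by simpa using huv
    refine ⟨?_, fun h => hij (ht (hg h))⟩
    rcases lt_or_gt_of_ne hij with h | h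
    · exact hadj i j h
    · rw [Sym2.eq_swap]
      exact hadj j i h

/-- The graphs on the gadget of the relevant degree that are homomorphic to `H` are given by a
colouring of `ι` and a set of cut edges. -/
theorem homomorphic_and_degree_iff (hr : IsHomomorphicTo (⊤ : SimpleGraph (Fin r ⊕ Fin 2)) H)
    (hr' : ¬ IsHomomorphicTo (⊤ : SimpleGraph (Fin r ⊕ Fin 3)) H)
    {S : Finset (Sym2 (GadgetVertex r ι))} (hS : S ⊆ properPairs (GadgetVertex r ι)) :
    (IsHomomorphicTo (SimpleGraph.fromEdgeSet (S : Set (Sym2 (GadgetVertex r ι)))) H ∧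
      ∑ e ∈ S, edgeDegree r ι (2 * Fintype.card ι + 1) e =
        (2 * Fintype.card ι + 1) * (forcedEdges r ι).card + Fintype.card ι) ↔
    ∃ c : ι → Fin 2, forcedEdges r ι ∪ selectedEdges r c ⊆ S ∧
      S ⊆ (forcedEdges r ι ∪ selectedEdges r c) ∪ cutEdges r c := by
  rw [sum_edgeDegree hS]
  constructor
  · rintro ⟨hhom, hdeg⟩
    -- Pole edges contribute less than `2 * |ι| + 1`, so they cannot make up for a missing forced
    -- edge.
    have hle : ∑ x, (Finset.univ.filter fun b => poleEdge r (b, x) ∈ S).card ≤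
        2 * Fintype.card ι := by
      refine (Finset.sum_le_card_nsmul _ _ 2 fun x _ => ?_).trans (by simp [mul_comm])
      exact (Finset.card_le_univ _).trans (by simp)
    have hF : forcedEdges r ι ⊆ S := by
      have h₁ : (S ∩ forcedEdges r ι).card ≤ (forcedEdges r ι).card :=
        Finset.card_le_card Finset.inter_subset_right
      have h₂ : (forcedEdges r ι).card ≤ (S ∩ forcedEdges r ι).card := by
        by_contra! hlt
        have := Nat.mul_le_mul_left (2 * Fintype.card ι + 1) (Nat.succ_le_of_lt hlt)
        rw [Nat.mul_succ] at this
        omega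
      have h₃ := Finset.eq_of_subset_of_card_le Finset.inter_subset_right h₂
      rw [← h₃]
      exact Finset.inter_subset_left
    rw [Finset.inter_eq_right.2 hF] at hdeg
    have hsum := Nat.add_left_cancel hdeg
    -- A vertex joined to both poles would form a triangle with them.
    have hone : ∀ x ∈ Finset.univ,
        (Finset.univ.filter fun b => poleEdge r (b, x) ∈ S).card ≤ 1 := by
      intro x _
      rw [Finset.card_le_one]
      by_contra! h
      obtain ⟨b, hb, b', hb', hne⟩ := h
      have hb := (Finset.mem_filter.1 hb).2
      have hb' := (Finset.mem_filter.1 hb').2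
      refine false_of_clique hr' hF hhom ![.inl b, .inl b', .inr x] ?_ ?_
      · intro i j h
        fin_cases i <;> fin_cases j <;> simp_all
      · intro i j hij
        have hf : s(.inl (.inr b), .inl (.inr b')) ∈ S :=
          hF (Finset.mem_filter.2 ⟨by simpa [properPairs] using hne, by simp [edgeDegree]⟩)
        fin_cases i <;> fin_cases j <;> simp at hij
        · exact hf
        · exact hb
        · exact hb'
    -- The counts are at most one and add up to `|ι|`.
    have hall : ∀ x ∈ Finset.univ,
        (Finset.univ.filter fun b => poleEdge r (b, x) ∈ S).card = 1 := by
      refine (Finset.sum_eq_sum_iff_of_le hone).1 ?_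
      rw [hsum]
      simp
    choose b hb using fun x => Finset.card_eq_one.1 (hall x (Finset.mem_univ x))
    have hb' (x : ι) (b' : Fin 2) : poleEdge r (b', x) ∈ S ↔ b' = b x := by
      simpa using Finset.ext_iff.1 (hb x) b'
    have hflip (i : Fin 2) : i + 1 + 1 = i := by fin_cases i <;> rfl
    refine ⟨fun x => b x + 1, Finset.union_subset hF ?_, ?_⟩
    · intro e he
      obtain ⟨x, -, rfl⟩ := Finset.mem_image.1 he
      exact (hb' x _).2 (hflip _)
    · intro e he
      have hd := hS he
      have hpole (b₀ : Fin 2) (x : ι) (h : poleEdge r (b₀, x) ∈ S) :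
          poleEdge r (b₀, x) ∈ (forcedEdges r ι ∪ selectedEdges r fun x => b x + 1) ∪
            cutEdges r fun x => b x + 1 :=
        Finset.mem_union_left _ (Finset.mem_union_right _ (poleEdge_mem_selectedEdges.2
          (((hb' x b₀).1 h).trans (hflip _).symm)))
      have hforce (e : Sym2 (GadgetVertex r ι)) (hd : e ∈ properPairs (GadgetVertex r ι))
          (h : edgeDegree r ι 2 e = 2) :
          e ∈ (forcedEdges r ι ∪ selectedEdges r fun x => b x + 1) ∪
            cutEdges r fun x => b x + 1 :=
        Finset.mem_union_left _ (Finset.mem_union_left _ (Finset.mem_filter.2 ⟨hd, h⟩))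
      induction e using Sym2.ind with | _ u v =>
      rcases u with (i | b₁) | x <;> rcases v with (j | b₂) | y
      · exact hforce _ hd (by simp [edgeDegree])
      · exact hforce _ hd (by simp [edgeDegree])
      · exact hforce _ hd (by simp [edgeDegree])
      · exact hforce _ hd (by simp [edgeDegree])
      · exact hforce _ hd (by simp [edgeDegree])
      · exact hpole _ _ he
      · exact hforce _ hd (by simp [edgeDegree])
      · rw [Sym2.eq_swap] at he ⊢
        exact hpole _ _ he
      -- An edge between vertices of equal colour would form a triangle with the pole both are
      -- joined to.
      · refine Finset.mem_union_right _ (mem_cutEdges.2 fun hxy => ?_)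
        have hxy : b x = b y := add_right_cancel hxy
        have hne : x ≠ y := by simpa [properPairs] using hd
        refine false_of_clique hr' hF hhom ![.inl (b x), .inr x, .inr y] ?_ ?_
        · intro i j h
          fin_cases i <;> fin_cases j <;> simp_all
        · intro i j hij
          fin_cases i <;> fin_cases j <;> simp at hij
          · exact (hb' x _).2 rfl
          · exact (hb' y _).2 hxy
          · exact he
  · rintro ⟨c, hc, hc'⟩
    have hF : forcedEdges r ι ⊆ S := Finset.union_subset_left hc
    refine ⟨isHomomorphicTo_of_colouring hr hc', ?_⟩
    rw [Finset.inter_eq_right.2 hF]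
    congr 1
    have hcount (x : ι) : (Finset.univ.filter fun b => poleEdge r (b, x) ∈ S).card = 1 := by
      rw [Finset.card_eq_one]
      refine ⟨c x + 1, ?_⟩
      ext b
      simp only [Finset.mem_filter, Finset.mem_univ, true_and, Finset.mem_singleton]
      constructor
      · intro h
        rcases Finset.mem_union.1 (hc' h) with h₁ | h₁
        · rcases Finset.mem_union.1 h₁ with h₁ | h₁
          · exact absurd (Finset.mem_filter.1 h₁).2 (by simp [poleEdge, edgeDegree])
          · exact poleEdge_mem_selectedEdges.1 h₁
        · obtain ⟨p, -, h₂⟩ := Finset.mem_image.1 h₁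
          simp [poleEdge] at h₂
      · rintro rfl
        exact hc (Finset.mem_union_right _ (poleEdge_mem_selectedEdges.2 rfl))
    simp [hcount]

/-- Summation over an interval of sets. -/
theorem sum_Icc_prod {E A : Type*} [DecidableEq E] [CommRing A] {s t : Finset E}
    (hst : Disjoint s t) (w : E → A) :
    ∑ S ∈ Finset.Icc s (s ∪ t), ∏ e ∈ S, w e = (∏ e ∈ s, w e) * ∏ e ∈ t, (1 + w e) := by
  rw [Finset.Icc_eq_image_powerset Finset.subset_union_left, Finset.union_sdiff_left,
    Finset.sdiff_eq_self_of_disjoint hst.symm, Finset.sum_image, Finset.prod_one_add, Finset.mul_sum]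
  · refine Finset.sum_congr rfl fun u hu => ?_
    exact Finset.prod_union (hst.mono_right (Finset.mem_powerset.1 hu))
  · intro u hu v hv h
    have hu' := hst.mono_right (Finset.mem_powerset.1 (Finset.mem_coe.1 hu))
    have hv' := hst.mono_right (Finset.mem_powerset.1 (Finset.mem_coe.1 hv))
    have h' : (s ∪ u) \ s = (s ∪ v) \ s := congrArg (· \ s) h
    rwa [Finset.union_sdiff_left, Finset.union_sdiff_left,
      Finset.sdiff_eq_self_of_disjoint hu'.symm, Finset.sdiff_eq_self_of_disjoint hv'.symm] at h'

/-- A vertex of colour 1 is joined to pole 0, whose edges carry the weights `a`; all other edges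
concerned have weight 1. -/
theorem prod_base_edgeWeight {A : Type*} [CommRing A] (a : ι → A) (y : ι → ι → A)
    (hy : ∀ i j, y i j = y j i) (c : ι → Fin 2) :
    ∏ e ∈ forcedEdges r ι ∪ selectedEdges r c, edgeWeight r a y hy e = ∏ x, a x ^ (c x : ℕ) := by
  rw [Finset.prod_union (disjoint_forced_selected c), Finset.prod_eq_one, one_mul, selectedEdges,
    Finset.prod_image]
  · refine Finset.prod_congr rfl fun x _ => ?_
    rcases Fin.exists_fin_two.1 ⟨c x, rfl⟩ with h | h <;> simp [edgeWeight, poleEdge, h]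
  · intro x _ x' _ h
    exact (Prod.mk.inj (poleEdge_injective h)).2
  · intro e he
    have he := (Finset.mem_filter.1 he).2
    induction e using Sym2.ind with | _ u v =>
    revert he
    rcases u with (i | b) | x <;> rcases v with (j | b') | y <;> simp [edgeDegree, edgeWeight]

/-- An optional cut edge contributes `1 + (y - 1) = y`. Ordering its ends by colour counts each cut
edge once. -/
theorem prod_cut_edgeWeight {A : Type*} [CommRing A] (a : ι → A) (y : ι → ι → A)
    (hy : ∀ i j, y i j = y j i) (c : ι → Fin 2) :
    ∏ e ∈ cutEdges r c, (1 + edgeWeight r a y hy e) =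
      ∏ i, ∏ j, if c i = 1 ∧ c j = 0 then y i j else 1 := by
  rw [cutEdges, Finset.prod_image, Finset.prod_filter, Fintype.prod_prod_type]
  · simp [edgeWeight]
  · rintro ⟨x, x'⟩ h ⟨z, z'⟩ h' heq
    simp only [Finset.coe_filter, Finset.mem_univ, true_and, Set.mem_ofPred_eq] at h h'
    simp only [Sym2.eq_iff, Sum.inr.injEq] at heq
    rcases heq with ⟨rfl, rfl⟩ | ⟨rfl, rfl⟩
    · rfl
    · rw [h.1] at h'
      simp at h'

/-- Interpolation of evaluations of the homomorphism sum at the gadget yields a sum over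
colourings. -/
theorem exists_sum_homSum_eq (hr : IsHomomorphicTo (⊤ : SimpleGraph (Fin r ⊕ Fin 2)) H)
    (hr' : ¬ IsHomomorphicTo (⊤ : SimpleGraph (Fin r ⊕ Fin 3)) H) {σ : Type} :
    ∃ k : Fin ((properPairs (GadgetVertex r ι)).card * (2 * Fintype.card ι + 1) + 1) → ℚ,
      ∀ (a : ι → MvPolynomial σ ℚ) (y : ι → ι → MvPolynomial σ ℚ) (hy : ∀ i j, y i j = y j i),
      ∑ j, C (k j) * homSum H (fun e => C (((j : ℚ) + 1) ^ edgeDegree r ι (2 * Fintype.card ι + 1) e)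
          * edgeWeight r a y hy e) =
        ∑ c : ι → Fin 2, (∏ x, a x ^ (c x : ℕ)) *
          ∏ i, ∏ j, if c i = 1 ∧ c j = 0 then y i j else 1 := by
  classical
  set K := 2 * Fintype.card ι + 1 with hK
  -- Selects total degree `K * |forced| + |ι|`: all forced edges and as many pole edges as there are
  -- vertices in `ι`.
  obtain ⟨k, hk⟩ := exists_interpolation_weights ((properPairs (GadgetVertex r ι)).card * K)
    (K * (forcedEdges r ι).card + Fintype.card ι)
  refine ⟨k, fun a y hy => ?_⟩
  have hdeg (e : Sym2 (GadgetVertex r ι)) : edgeDegree r ι K e ≤ K := by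
    induction e using Sym2.ind with | _ u v =>
    rcases u with (i | b) | x <;> rcases v with (j | b') | y <;> simp [edgeDegree, hK]
  simp only [homSum, Finset.mul_sum]
  rw [Finset.sum_comm]
  -- After interpolation a set `S` counts exactly when it lies in the interval of some colouring,
  -- and then that colouring is unique.
  have hterm : ∀ S ∈ (properPairs (GadgetVertex r ι)).powerset,
      ∑ j : Fin ((properPairs (GadgetVertex r ι)).card * K + 1), C (k j) *
        (if IsHomomorphicTo (SimpleGraph.fromEdgeSet (S : Set (Sym2 (GadgetVertex r ι)))) H then
          ∏ e ∈ S, (C (((j : ℚ) + 1) ^ edgeDegree r ι K e) * edgeWeight r a y hy e) else 0) =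
      ∑ c : ι → Fin 2, if S ∈ Finset.Icc (forcedEdges r ι ∪ selectedEdges r c)
        ((forcedEdges r ι ∪ selectedEdges r c) ∪ cutEdges r c) then
          ∏ e ∈ S, edgeWeight r a y hy e else 0 := by
    intro S hS
    have hS := Finset.mem_powerset.1 hS
    have hle : ∑ e ∈ S, edgeDegree r ι K e ≤ (properPairs (GadgetVertex r ι)).card * K :=
      (Finset.sum_le_card_nsmul _ _ K fun e _ => hdeg e).trans
        (Nat.mul_le_mul_right _ (Finset.card_le_card hS))
    have hiff := homomorphic_and_degree_iff hr hr' hS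
    have hLHS : ∑ j : Fin ((properPairs (GadgetVertex r ι)).card * K + 1), C (k j) *
        (if IsHomomorphicTo (SimpleGraph.fromEdgeSet (S : Set (Sym2 (GadgetVertex r ι)))) H then
          ∏ e ∈ S, (C (((j : ℚ) + 1) ^ edgeDegree r ι K e) * edgeWeight r a y hy e) else 0) =
        if IsHomomorphicTo (SimpleGraph.fromEdgeSet (S : Set (Sym2 (GadgetVertex r ι)))) H ∧
          ∑ e ∈ S, edgeDegree r ι K e = K * (forcedEdges r ι).card + Fintype.card ι then
          ∏ e ∈ S, edgeWeight r a y hy e else 0 := by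
      by_cases h₁ : IsHomomorphicTo
          (SimpleGraph.fromEdgeSet (S : Set (Sym2 (GadgetVertex r ι)))) H
      · simp only [h₁, if_true, true_and, Finset.prod_mul_distrib, ← map_prod,
          Finset.prod_pow_eq_pow_sum]
        simp only [← mul_assoc, ← C_mul, ← Finset.sum_mul, ← map_sum]
        rw [hk _ hle]
        split_ifs <;> simp
      · simp [h₁]
    rw [hLHS]
    by_cases h : ∃ c : ι → Fin 2, forcedEdges r ι ∪ selectedEdges r c ⊆ S ∧
      S ⊆ (forcedEdges r ι ∪ selectedEdges r c) ∪ cutEdges r c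
    · rw [if_pos (hiff.2 h)]
      obtain ⟨c, hc, hc'⟩ := h
      rw [Finset.sum_eq_single c]
      · rw [if_pos (Finset.mem_Icc.2 ⟨hc, hc'⟩)]
      · intro c' _ hne
        refine if_neg fun h => hne ?_
        exact (colouring_unique hc (Finset.mem_Icc.1 h).2).symm
      · simp
    · rw [if_neg fun h' => h (hiff.1 h'), Finset.sum_eq_zero]
      intro c _
      exact if_neg fun hc => h ⟨c, Finset.mem_Icc.1 hc⟩
  refine (Finset.sum_congr rfl fun S hS => Eq.trans ?_ (hterm S hS)).trans ?_
  · refine Finset.sum_congr rfl fun j _ => ?_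
    congr
  rw [Finset.sum_comm]
  refine Finset.sum_congr rfl fun c _ => ?_
  rw [← Finset.sum_filter, ← prod_base_edgeWeight a y hy c, ← prod_cut_edgeWeight a y hy c,
    ← sum_Icc_prod (disjoint_base_cut c)]
  refine Finset.sum_congr ?_ fun _ _ => rfl
  ext S
  simp only [Finset.mem_filter, Finset.mem_powerset, and_iff_right_iff_imp]
  exact fun h => (Finset.mem_Icc.1 h).2.trans (base_union_cut_subset c)

end GadgetSum

/-! ### Sums over zeros of quadratic forms by homomorphism polynomials -/

theorem prod_zpow_eq_zpow_sum {ι F : Type*} [Field F] {s : F} (hs : s ≠ 0) (t : Finset ι)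
    (f : ι → ℤ) : ∏ i ∈ t, s ^ f i = s ^ ∑ i ∈ t, f i := by
  classical
  induction t using Finset.induction_on with
  | empty => simp
  | insert i t hi ih => rw [Finset.prod_insert hi, Finset.sum_insert hi, zpow_add₀ hs, ih]

/-! ### From zeros of quadratic forms to weighted cuts. -/

section CutForms

variable {ι : Type} [Fintype ι]

/-- Up to the factor two, a quadratic form is an affine form minus a weight of a cut. -/
theorem IsQuadraticForm.exists_cut {Q : (ι → Fin 2) → ℤ} (h : IsQuadraticForm Q) :
    ∃ (a : ℤ) (l : ι → ℤ) (k : ι → ι → ℤ), (∀ i j, k i j = k j i) ∧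
      ∀ c, 2 * Q c = a + ∑ i, l i * (c i : ℕ) +
        ∑ i, ∑ j, if c i = 1 ∧ c j = 0 then k i j else 0 := by
  obtain ⟨a, q, hq⟩ := h
  -- On bits `c_i c_j` is `c_i` minus the indicator of `c_i = 1, c_j = 0`. Doubling allows `q` to be
  -- symmetrized over the integers, as undirected edge weights require.
  refine ⟨2 * a, fun i => ∑ j, (q i j + q j i), fun i j => -(q i j + q j i),
    fun i j => by ring, fun c => ?_⟩
  have hsymm : ∑ i, ∑ j, q i j * ((c i : ℕ) * (c j : ℕ) : ℤ) =
      ∑ i, ∑ j, q j i * ((c i : ℕ) * (c j : ℕ) : ℤ) := by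
    rw [Finset.sum_comm]
    exact Finset.sum_congr rfl fun i _ => Finset.sum_congr rfl fun j _ => by ring
  have hterm (i j : ι) : (q i j + q j i) * ((c i : ℕ) * (c j : ℕ) : ℤ) =
      (q i j + q j i) * (c i : ℕ) +
        if c i = 1 ∧ c j = 0 then -(q i j + q j i) else 0 := by
    rcases Fin.exists_fin_two.1 ⟨c i, rfl⟩ with hi | hi <;>
    rcases Fin.exists_fin_two.1 ⟨c j, rfl⟩ with hj | hj <;> simp [hi, hj]
  calc 2 * Q c = 2 * a + (∑ i, ∑ j, q i j * ((c i : ℕ) * (c j : ℕ) : ℤ) +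
        ∑ i, ∑ j, q j i * ((c i : ℕ) * (c j : ℕ) : ℤ)) := by rw [← hsymm, hq]; ring
    _ = _ := by
      simp only [← Finset.sum_add_distrib, ← add_mul, hterm, add_assoc, Finset.sum_mul]

variable [DecidableEq ι]

/-- The sum over the colourings `c` of `ι`, weighted by the cut edges and by the vertices of
colour one. -/
noncomputable def cutSum {A : Type*} [CommSemiring A] (a : ι → A) (y : ι → ι → A) : A :=
  ∑ c : ι → Fin 2, (∏ x, a x ^ (c x : ℕ)) * ∏ i, ∏ j, if c i = 1 ∧ c j = 0 then y i j else 1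

theorem cutSum_zpow {σ : Type*} {Q : (ι → Fin 2) → ℤ} {a : ℤ} {l : ι → ℤ} {k : ι → ι → ℤ}
    (h : ∀ c, 2 * Q c = a + ∑ i, l i * (c i : ℕ) +
      ∑ i, ∑ j, if c i = 1 ∧ c j = 0 then k i j else 0)
    {s : ℚ} (hs : s ≠ 0) (b : ι → MvPolynomial σ ℚ) :
    C (s ^ a) * cutSum (fun x => C (s ^ l x) * b x) (fun i j => C (s ^ k i j)) =
      ∑ c : ι → Fin 2, C (s ^ (2 * Q c)) * ∏ x, b x ^ (c x : ℕ) := by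
  rw [cutSum, Finset.mul_sum]
  refine Finset.sum_congr rfl fun c _ => ?_
  have h₁ : ∏ x, (C (s ^ l x) * b x) ^ (c x : ℕ) =
      C (s ^ ∑ i, l i * (c i : ℕ)) * ∏ x, b x ^ (c x : ℕ) := by
    simp only [mul_pow, Finset.prod_mul_distrib, ← map_pow, ← map_prod, ← zpow_natCast, ← zpow_mul]
    rw [prod_zpow_eq_zpow_sum hs]
  have h₂ : (∏ i, ∏ j, if c i = 1 ∧ c j = 0 then (C (s ^ k i j) : MvPolynomial σ ℚ) else 1) =
      C (s ^ ∑ i, ∑ j, if c i = 1 ∧ c j = 0 then k i j else 0) := by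
    simp only [← prod_zpow_eq_zpow_sum hs, map_prod]
    refine Finset.prod_congr rfl fun i _ => Finset.prod_congr rfl fun j _ => ?_
    split_ifs <;> simp
  rw [h₁, h₂, h, zpow_add₀ hs, zpow_add₀ hs]
  simp only [C_mul]
  ring

/-- A sum over the zeros of a bounded quadratic form is a combination of sums over cuts. -/
theorem exists_cutSum_eq_zeroSum {Q : (ι → Fin 2) → ℤ} {B : ℕ} (h : IsQuadraticForm Q)
    (h₀ : ∀ c, 0 ≤ Q c) (hB : ∀ c, Q c ≤ B) :
    ∃ (w : Fin (2 * B + 1) → ℚ) (l : Fin (2 * B + 1) → ι → ℚ) (k : Fin (2 * B + 1) → ι → ι → ℚ),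
      (∀ t i j, k t i j = k t j i) ∧ ∀ {σ : Type} (b : ι → MvPolynomial σ ℚ),
        ∑ t, C (w t) * cutSum (fun x => C (l t x) * b x) (fun i j => C (k t i j)) =
          zeroSum Q b := by
  obtain ⟨a, l, k, hk, hQ⟩ := h.exists_cut
  -- The exponents `2 * Q c` lie between 0 and `2 * B`; the coefficient at exponent 0 keeps the
  -- zeros of `Q`. The separate vertex and cut exponents may be negative, which nonzero nodes
  -- permit.
  obtain ⟨w, hw⟩ := exists_interpolation_weights (2 * B) 0
  refine ⟨fun t => w t * ((t : ℚ) + 1) ^ a, fun t x => ((t : ℚ) + 1) ^ l x,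
    fun t i j => ((t : ℚ) + 1) ^ k i j, fun t i j => by simp only [hk i j], fun b => ?_⟩
  have hs (t : Fin (2 * B + 1)) : (t : ℚ) + 1 ≠ 0 := by positivity
  simp only [C_mul, mul_assoc, cutSum_zpow hQ (hs _), Finset.mul_sum]
  rw [Finset.sum_comm, zeroSum]
  refine Finset.sum_congr rfl fun c _ => ?_
  obtain ⟨m, hm⟩ := Int.eq_ofNat_of_zero_le (h₀ c)
  have hmB := hB c
  simp only [← mul_assoc, ← C_mul, ← Finset.sum_mul, ← map_sum, hm]
  have hcast (s : ℚ) : s ^ (2 * (m : ℤ)) = s ^ (2 * m) := by norm_cast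
  simp only [hcast]
  rw [hw _ (by omega)]
  rcases Nat.eq_zero_or_pos m with rfl | hpos
  · simp
  · simp [hpos.ne']

end CutForms

/-! ### Sizes of the oracle formulas. -/

section OracleSize

variable {α β : Type*} {H : Graph α β} {r : ℕ} {ι σ : Type}

theorem HasOracleFormula.homSum {T : Type} [Fintype T] [DecidableEq T] {p n : ℕ} (f : Fin p ≃ T)
    {W : Sym2 T → MvPolynomial σ ℚ} (h : ∀ e, HasOracleFormula (homPolynomial ℚ H p) n (W e)) :
    HasOracleFormula (homPolynomial ℚ H p) (p * p * n + 1) (homSum H W) := by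
  rw [← aeval_homPolynomial H f]
  exact (HasOracleFormula.oracle _ fun e : CompleteEdge p => h _).mono
    (Nat.succ_le_succ (Nat.mul_le_mul_right _ (card_completeEdge_le p)))

theorem HasOracleFormula.edgeWeight {τ : Type} [Fintype τ] {g : MvPolynomial τ ℚ} {n : ℕ}
    (hn : 1 ≤ n) {a : ι → MvPolynomial σ ℚ} (ha : ∀ x, HasOracleFormula g n (a x)) (k : ι → ι → ℚ)
    (hk : ∀ i j, (C (k i j) : MvPolynomial σ ℚ) = C (k j i)) (e : Sym2 (GadgetVertex r ι)) :
    HasOracleFormula g n (edgeWeight r a (fun i j => C (k i j)) hk e) := by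
  have hone : HasOracleFormula g n (1 : MvPolynomial σ ℚ) := (HasOracleFormula.const 1).mono hn
  induction e using Sym2.ind with | _ u v =>
  rcases u with (i | b) | x <;> rcases v with (j | b') | y <;>
  simp only [_root_.edgeWeight, Sym2.lift_mk]
  · exact hone
  · exact hone
  · exact hone
  · exact hone
  · exact hone
  · split_ifs
    exacts [ha _, hone]
  · exact hone
  · split_ifs
    exacts [ha _, hone]
  · rw [← C_1, ← C_sub]
    exact (HasOracleFormula.const _).mono hn

variable [Fintype ι] [DecidableEq ι]

/-- The size of an oracle formula for a sum over cuts. -/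
def cutSumSize (r N n : ℕ) : ℕ :=
  ((r + 2 + N) * (r + 2 + N) * (2 * N + 1) + 1) * ((r + 2 + N) * (r + 2 + N) * (n + 2) + 4) + 1

theorem HasOracleFormula.cutSum (hr : IsHomomorphicTo (⊤ : SimpleGraph (Fin r ⊕ Fin 2)) H)
    (hr' : ¬ IsHomomorphicTo (⊤ : SimpleGraph (Fin r ⊕ Fin 3)) H) {p n : ℕ} (hn : 1 ≤ n)
    (hp : p = r + 2 + Fintype.card ι) {a : ι → MvPolynomial σ ℚ}
    (ha : ∀ x, HasOracleFormula (homPolynomial ℚ H p) n (a x)) {k : ι → ι → ℚ}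
    (hk : ∀ i j, k i j = k j i) :
    HasOracleFormula (homPolynomial ℚ H p) (cutSumSize r (Fintype.card ι) n)
      (cutSum a fun i j => C (k i j)) := by
  obtain ⟨w, hw⟩ := exists_sum_homSum_eq (ι := ι) hr hr' (σ := σ)
  rw [_root_.cutSum, ← hw a (fun i j => C (k i j)) fun i j => by rw [hk]]
  have hcard : (properPairs (GadgetVertex r ι)).card ≤ p * p := by
    refine (Finset.card_le_univ _).trans ?_
    have := Fintype.card_le_of_surjective
      (fun x : GadgetVertex r ι × GadgetVertex r ι => s(x.1, x.2))
      (fun e => by induction e using Sym2.ind with | _ a b => exact ⟨(a, b), rfl⟩)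
    simpa [← hp] using this
  let f : Fin p ≃ GadgetVertex r ι := Fintype.equivOfCardEq (by simp [hp])
  refine (HasOracleFormula.sum fun j _ => (HasOracleFormula.const _).mul
    (HasOracleFormula.homSum f fun e => (HasOracleFormula.const _).mul
      (HasOracleFormula.edgeWeight hn ha _ _ e))).mono ?_
  rw [cutSumSize, ← hp, Finset.card_univ, Fintype.card_fin]
  refine Nat.succ_le_succ (Nat.mul_le_mul (Nat.succ_le_succ (Nat.mul_le_mul_right _ hcard)) ?_)
  rw [show 1 + n + 1 = n + 2 by omega]
  omega

/-- The size of an oracle formula for a sum over the zeros of a quadratic form. -/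
def zeroSumSize (r N B : ℕ) : ℕ := (2 * B + 1) * (cutSumSize r N 3 + 3) + 1

theorem HasOracleFormula.zeroSum (hr : IsHomomorphicTo (⊤ : SimpleGraph (Fin r ⊕ Fin 2)) H)
    (hr' : ¬ IsHomomorphicTo (⊤ : SimpleGraph (Fin r ⊕ Fin 3)) H) {p : ℕ}
    (hp : p = r + 2 + Fintype.card ι) {Q : (ι → Fin 2) → ℤ} {B : ℕ} (h : IsQuadraticForm Q)
    (h₀ : ∀ c, 0 ≤ Q c) (hB : ∀ c, Q c ≤ B) {a : ι → MvPolynomial σ ℚ}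
    (ha : ∀ x, (∃ c, a x = C c) ∨ ∃ y, a x = X y) :
    HasOracleFormula (homPolynomial ℚ H p) (zeroSumSize r (Fintype.card ι) B) (zeroSum Q a) := by
  obtain ⟨w, l, k, hk, hw⟩ := exists_cutSum_eq_zeroSum h h₀ hB
  rw [← hw a]
  have ha' (x : ι) : HasOracleFormula (homPolynomial ℚ H p) 1 (a x) := by
    rcases ha x with ⟨c, h⟩ | ⟨y, h⟩ <;> rw [h]
    exacts [.const c, .var y]
  refine (HasOracleFormula.sum fun t _ => (HasOracleFormula.const _).mul
    (HasOracleFormula.cutSum hr hr' (by omega) hp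
      (fun x => (HasOracleFormula.const _).mul (ha' x)) (hk t))).mono ?_
  rw [zeroSumSize, Finset.card_univ, Fintype.card_fin]
  exact Nat.succ_le_succ (Nat.mul_le_mul_left _ (by norm_num; omega))

end OracleSize

/-! ### The c-reduction. -/

section Hardness

variable {α β : Type*} {H : Graph α β}

/-- The size of an oracle formula for a sum over bits of a polynomial of degree less than `D`
computed by a straight-line program of length `L`. -/
def sumBitsSize (r m L D : ℕ) : ℕ :=
  D * (zeroSumSize r (L * (D * D * D) + m)
    (L * (D * D) * (D + 1 + 2 * (L * (D * D * D))) ^ 2 + L * (D * D * D)) + 1) + 1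

/-- One sum over zeros for each homogeneous component. All of them use the same number of bits,
hence the same oracle polynomial: `r + 2` clique vertices and one vertex for each bit. -/
theorem exists_hasOracleFormula_sum_evalBits {r : ℕ}
    (hr : IsHomomorphicTo (⊤ : SimpleGraph (Fin r ⊕ Fin 2)) H)
    (hr' : ¬ IsHomomorphicTo (⊤ : SimpleGraph (Fin r ⊕ Fin 3)) H) {σ : Type} {m D : ℕ}
    {C : ArithCircuit ℚ (σ ⊕ Fin m)} {g : MvPolynomial (σ ⊕ Fin m) ℚ} (hC : C.Computes g)
    (hD : D = g.totalDegree + 2) :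
    ∃ L ≤ 3 * C.size + 1,
      HasOracleFormula (homPolynomial ℚ H (r + 2 + (L * (D * D * D) + m))) (sumBitsSize r m L D)
        (∑ ε : Fin m → Fin 2, evalBits ε g) := by
  obtain ⟨l, hl, hlen, hg⟩ := hC.exists_straightLine
  refine ⟨l.length, hlen, ?_⟩
  choose prog hprog using hl.exists_instr
  obtain ⟨o, rfl⟩ := List.get_of_mem hg
  have : NeZero D := ⟨by omega⟩
  have hsum : ∑ ε : Fin m → Fin 2, evalBits ε (l.get o) =
      ∑ e : Fin D, ∑ ε : Fin m → Fin 2, evalBits ε (homogeneousComponent (e : ℕ) (l.get o)) := by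
    rw [Finset.sum_comm]
    refine Finset.sum_congr rfl fun ε _ => ?_
    -- The top index `totalDegree + 1` contributes a zero component; it is included so that `D` is
    -- at least 2.
    rw [← map_sum, Fin.sum_univ_eq_sum_range (fun e => homogeneousComponent e (l.get o)) D, hD,
      Finset.sum_range_succ, sum_homogeneousComponent,
      homogeneousComponent_eq_zero _ _ (Nat.lt_succ_self _), add_zero]
  rw [hsum]
  have hcard : Fintype.card ((Fin l.length × (Fin D × Fin D) × Fin D) ⊕ Fin m) =
      l.length * (D * D * D) + m := by simp
  refine (HasOracleFormula.sum (n := zeroSumSize r (l.length * (D * D * D) + m)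
    (l.length * (D * D) * (D + 1 + 2 * (l.length * (D * D * D))) ^ 2 + l.length * (D * D * D)))
    fun e _ => ?_).mono ?_
  · obtain ⟨Q, a, hQ, h₀, hB, ha, h⟩ :=
      exists_sum_evalBits_eq_zeroSum (by omega) hprog o e
    rw [h, ← hcard]
    exact HasOracleFormula.zeroSum hr hr' rfl hQ h₀ (by exact_mod_cast hB) ha
  · rw [Finset.card_univ, Fintype.card_fin, sumBitsSize]

theorem PolyBounded.cutSumSize (r n : ℕ) {N : ℕ → ℕ} (hN : PolyBounded N) :
    PolyBounded fun k => cutSumSize r (N k) n := by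
  simp only [_root_.cutSumSize]
  repeat first
    | exact hN
    | exact .const _
    | refine .add ?_ ?_
    | refine .mul ?_ ?_

theorem PolyBounded.zeroSumSize (r : ℕ) {N B : ℕ → ℕ} (hN : PolyBounded N) (hB : PolyBounded B) :
    PolyBounded fun k => zeroSumSize r (N k) (B k) :=
  ((((const 2).mul hB).add (const 1)).mul ((hN.cutSumSize r 3).add (const 3))).add (const 1)

theorem PolyBounded.sumBitsSize (r : ℕ) {m L D : ℕ → ℕ} (hm : PolyBounded m) (hL : PolyBounded L)
    (hD : PolyBounded D) : PolyBounded fun k => sumBitsSize r (m k) (L k) (D k) := by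
  have hDDD := hL.mul ((hD.mul hD).mul hD)
  exact (hD.mul (((hDDD.add hm).zeroSumSize r (((hL.mul (hD.mul hD)).mul
    (((hD.add (const 1)).add ((const 2).mul hDDD)).pow 2)).add hDDD)).add (const 1))).add (const 1)

theorem InVNP.cReduces_homPolynomial (hH : V(H).Finite)
    (h : ¬ ((∃ e v, H.IsLoopAt e v) ∨ E(H) = ∅)) {σ : ℕ → Type}
    {f : ∀ n, MvPolynomial (σ n) ℚ} (hf : InVNP f) :
    CReduces f fun n => homPolynomial ℚ H n := by
  obtain ⟨r, hr, hr'⟩ := exists_clique_number hH h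
  obtain ⟨⟨hfin, -, -⟩, m, g, ⟨⟨-, hcard, hdeg⟩, s, hs, hC⟩, hfg⟩ := hf
  choose C hCs hC using hC
  choose L hL hform using fun n => exists_hasOracleFormula_sum_evalBits hr hr' (hC n) rfl
  -- The auxiliary bits are among the variables of the p-family `g`.
  have hm : PolyBounded m := hcard.mono fun n => by
    have := hfin n
    simp [Nat.card_sum]
  have hL' : PolyBounded L := (((PolyBounded.const 3).mul hs).add (.const 1)).mono fun n =>
    (hL n).trans (by have := hCs n; omega)
  have hD : PolyBounded fun n => (g n).totalDegree + 2 := hdeg.add (.const 2)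
  refine ⟨_, _, (PolyBounded.const (r + 2)).add ((hL'.mul ((hD.mul hD).mul hD)).add hm),
    hm.sumBitsSize r hL' hD, fun n => ?_⟩
  obtain ⟨C', hsize, hC'⟩ := (hform n).exists_circuit
  exact ⟨C', hsize, hC'.trans (hfg n).symm⟩

end Hardness

theorem mainTheorem1 {α β : Type*} (H : Graph α β) (hH : V(H).Finite) :
    (((∃ e v, H.IsLoopAt e v) ∨ E(H) = ∅) → InVAC0 (fun n => homPolynomial ℚ H n)) ∧
    (¬ ((∃ e v, H.IsLoopAt e v) ∨ E(H) = ∅) → IsVNPComplete (fun n => homPolynomial ℚ H n)) :=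
  ⟨inVAC0_homPolynomial H, fun h => ⟨inVNP_homPolynomial H hH, fun _ _ hf =>
    hf.cReduces_homPolynomial hH h⟩⟩
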